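/- **Setting.** Let $k\ge 1$, $1\le l\le n$, $m\ge 0$ be integers, let $E$ be a smooth manifold of dimension $n+m$, and let $\theta_k\in J^k(E,n)$ be a $k$-jet of $n$-dimensional submanifolds of $E$, with base point $\theta_0\in E$. Let $\underline R\subset T_{\theta_0}E$ be the common tangent space of the submanifolds with $k$-jet $\theta_k$, put $N=T_{\theta_0}E/\underline R$, and let $J^{k+1}_{\theta_k}$ be the set of all $(k+1)$-jets which project to $\theta_k$. It is an affine space over $S^{k+1}\underline R^*\otimes N$ (the difference of two jets is the difference of their Taylor terms of order $k+1$, modulo $\underline R$). Let $\mathrm{Gr}=\mathrm{Gr}(\underline R,l)$ be the Grassmannian of $l$-dimensional subspaces of $\underline R$ and $I=\mathrm{Gr}\times J^{k+1}_{\theta_k}$, so that $T_{(L,\theta)}I=\mathrm{Hom}(L,\underline R/L)\oplus(S^{k+1}\underline R^*\otimes N)$. For $L\in\mathrm{Gr}$ and $0\le p\le k+2$ let $\mu^p_L\subset S^{k+1}\underline R^*\otimes N$ be the space of those symmetric forms which vanish whenever at least $p$ of their $k+1$ arguments lie in $L$. For $-1\le q\le k+1$ and $p=k+1-q$, let $\mathcal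 V^p=\{0\oplus f: f\in\mu^p_L\}$, a distribution on $I$, and let $M^q$ be the manifold of its leaves: $(L,\theta)$ and $(L',\theta')$ lie in the same leaf iff $L=L'$ and $\theta-\theta'\in\mu^p_L$. There are natural projections $M^{q}\to M^{q-1}\to\dots\to M^{-1}=\mathrm{Gr}$. For $0\le q\le k+1$ let $\mathcal F^p$ be the sum of $\mathcal V^{p+1}$ and the vertical distribution of the projection $I\to J^{k+1}_{\theta_k}$, and let $\mathcal F^{[q]}$ be the distribution on $M^q$ whose plane at a leaf $\phi$ consists of the images of the vectors of $\mathcal F^p$ at points of $\phi$. For $q\ge 1$, with $\Pi:M^q\to M^{q-1}$ the projection, put $$Q_{\phi}=T_\phi\Pi\bigl(\mathcal F^{[q]}_\phi\bigr)\subset T_{\Pi(\phi)}M^{q-1}\qquad(\phi\in M^q).$$ An *integral element* of a distribution $\mathcal E$ on $M$ at $x$ is a subspace $Q\subset\mathcal E_x$ with $[X,Y]_x\in\mathcal E_x$ for all local smooth sections $X,Y$ of $\mathcal E$ with $X_x,Y_x\in Q$. A subspace of $T_xM$ is *horizontal* for a map $M\to B$ if it meets the kernel of the differential of this map at $x$ only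 in $0$. A *horizontal maximal integral element* of $(M^{q-1},\mathcal F^{[q-1]})$ at $x$ is an integral element at $x$ which is horizontal for $M^{q-1}\to M^{q-2}$ and which has the largest dimension among all such integral elements at $x$. The *prolongation* of $(M,\mathcal E)$ with respect to a bundle $\pi:M\to B$ is the manifold $M^{(1)}$ of all $(\dim B)$-dimensional $\pi$-horizontal integral elements of $\mathcal E$ (with smooth structure as a subset of the bundle of tangent planes of $M$), with the distribution whose plane at $S\in M^{(1)}$ is the preimage of $S$ under the differential of the projection $M^{(1)}\to M$. **Statement.** 1. For $1\le q\le k+1$ and every $\phi_q\in M^q$, the plane $Q_{\phi_q}$ is a horizontal maximal integral element of $(M^{q-1},\mathcal F^{[q-1]})$ of dimension $\dim\mathrm{Gr}(\underline R,l)$. Moreover, a subspace of a plane of $\mathcal F^{[q-1]}$ is horizontal for $M^{q-1}\to M^{q-2}$ if and only if it is horizontal for $M^{q-1}\to\mathrm{Gr}(\underline R,l)$. 2. For $1\le q\le k+1$ the map $\phi_q\mapsto Q_{\phi_q}$ is injective on every fiber of $M^q\to M^{q-1}$. 3. For $2\le q\le k+1$ and every $\phi_{q-1}\in M^{q-1}$,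 every horizontal maximal integral element of $\mathcal F^{[q-1]}$ at $\phi_{q-1}$ is of the form $Q_{\phi_q}$ with $\phi_q\in M^q$ in the fiber over $\phi_{q-1}$. 4. For $2\le q\le k+1$, $(M^q,\mathcal F^{[q]})$ is the prolongation of $(M^{q-1},\mathcal F^{[q-1]})$ with respect to $M^{q-1}\to\mathrm{Gr}(\underline R,l)$: the map $\phi_q\mapsto Q_{\phi_q}$ identifies $M^q$ with the manifold of all $(\dim\mathrm{Gr}(\underline R,l))$-dimensional horizontal integral elements of $\mathcal F^{[q-1]}$ (bijectively, and compatibly with the smooth structures), and $\mathcal F^{[q]}_{\phi_q}=(T_{\phi_q}\Pi)^{-1}(Q_{\phi_q})$ for every $\phi_q\in M^q$. -/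

import Mathlib

open Set Function Module Filter Topology Asymptotics
set_option linter.unusedSectionVars false
open scoped Manifold ContDiff

noncomputable section
namespace PartialJets

section Atlas

variable (ι H M : Type*) [NormedAddCommGroup H] [NormedSpace ℝ H]

/-- A smooth atlas on the set `M` with model vector space `H`, given by injective
parametrizations `param i : H → M` (the inverses of the charts) which cover `M`, have open
overlaps and smooth coordinate changes. -/
structure ParamAtlas where
  param : ι → H → M
  inj : ∀ i, Injective (param i)
  cover : ∀ x, ∃ i, x ∈ range (param i)
  isOpen_overlap : ∀ i j, IsOpen {h | param i h ∈ range (param j)}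
  smooth_transition : ∀ i j,
    ContDiffOn ℝ ∞ (fun h => invFun (param j) (param i h)) {h | param i h ∈ range (param j)}

variable {ι H M}

namespace ParamAtlas

variable (c : ParamAtlas ι H M)

/-- The chart inverse to `param i`. -/
def chart (i : ι) : PartialEquiv M H where
  toFun := invFun (c.param i)
  invFun := c.param i
  source := range (c.param i)
  target := univ
  map_source' _ _ := mem_univ _
  map_target' h _ := mem_range_self h
  left_inv' _ hx := invFun_eq hx
  right_inv' h _ := leftInverse_invFun (c.inj i) h

lemma chart_trans_source (i j : ι) :
    ((c.chart i).symm.trans (c.chart j)).source = {h | c.param i h ∈ range (c.param j)} := by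
  ext h; simp [chart]

/-- The manifold structure on `M` whose charts are the inverses of the parametrizations. -/
def core : ChartedSpaceCore H M where
  atlas := range c.chart
  chartAt x := c.chart (c.cover x).choose
  mem_chart_source x := (c.cover x).choose_spec
  chart_mem_atlas x := mem_range_self _
  open_source := by
    rintro _ _ ⟨i, rfl⟩ ⟨j, rfl⟩
    rw [chart_trans_source]
    exact c.isOpen_overlap i j
  continuousOn_toFun := by
    rintro _ _ ⟨i, rfl⟩ ⟨j, rfl⟩
    rw [chart_trans_source]
    exact (c.smooth_transition i j).continuousOn

@[reducible] def topologicalSpace : TopologicalSpace M := c.core.toTopologicalSpace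

@[reducible] def chartedSpace : @ChartedSpace H _ M c.topologicalSpace := c.core.toChartedSpace

lemma isManifold :
    @IsManifold ℝ _ H _ _ H _ 𝓘(ℝ, H) ∞ M c.topologicalSpace c.chartedSpace := by
  let _ := c.topologicalSpace
  let _ := c.chartedSpace
  refine isManifold_of_contDiffOn _ _ _ ?_
  intro e e' he he'
  have key : ∀ e : OpenPartialHomeomorph M H, e ∈ atlas H M →
      ∃ i, e.toPartialEquiv = c.chart i := by
    intro e he
    obtain ⟨f, hf⟩ := mem_iUnion.1 he
    obtain ⟨⟨i, rfl⟩, h2⟩ := mem_iUnion.1 hf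
    rw [mem_singleton_iff.1 h2]
    exact ⟨i, rfl⟩
  obtain ⟨i, hi⟩ := key e he
  obtain ⟨j, hj⟩ := key e' he'
  have h1 : ⇑e.symm = c.param i := by
    have : ⇑e.symm = ⇑e.toPartialEquiv.symm := rfl
    rw [this, hi]; rfl
  have h2 : ⇑e' = invFun (c.param j) := by
    have : ⇑e' = ⇑e'.toPartialEquiv := rfl
    rw [this, hj]; rfl
  have h3 : (e.symm ≫ₕ e').source = {h | c.param i h ∈ range (c.param j)} := by
    have : (e.symm ≫ₕ e').source = (e.toPartialEquiv.symm.trans e'.toPartialEquiv).source := rfl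
    rw [this, hi, hj, chart_trans_source]
  rw [OpenPartialHomeomorph.coe_trans, h1, h2, h3]
  simpa only [modelWithCornersSelf_coe, modelWithCornersSelf_coe_symm, range_id, inter_univ,
    preimage_id, Function.comp_def, id] using c.smooth_transition i j

end ParamAtlas
end Atlas

section SymForms

variable (j : ℕ) (R N : Type*) [NormedAddCommGroup R] [NormedSpace ℝ R]
  [NormedAddCommGroup N] [NormedSpace ℝ N]

/-- `S^j R* ⊗ N`: symmetric `j`-linear maps from `R` to `N`. -/
def SymForm : Submodule ℝ (ContinuousMultilinearMap ℝ (fun _ : Fin j => R) N) where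
  carrier := {f | ∀ (σ : Equiv.Perm (Fin j)) (v : Fin j → R), f (v ∘ σ) = f v}
  add_mem' hf hg σ v := by simp [hf σ v, hg σ v]
  zero_mem' σ v := rfl
  smul_mem' c f hf σ v := by simp [hf σ v]

instance SymForm.normedAddCommGroup : NormedAddCommGroup (SymForm j R N) :=
  Submodule.normedAddCommGroup _

instance SymForm.normedSpace : NormedSpace ℝ (SymForm j R N) := Submodule.normedSpace _

variable {j R N}

open Classical in
/-- `μ_L^p ⊆ S^j R* ⊗ N`: the forms which vanish as soon as `p` of their arguments lie in `L`,
that is, the homogeneous polynomials all of whose `p`-fold derivatives along `L` vanish. -/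
def vanishing (p : ℕ) (L : Submodule ℝ R) : Submodule ℝ (SymForm j R N) where
  carrier := {f | ∀ v : Fin j → R, p ≤ (Finset.univ.filter fun i => v i ∈ L).card → f.1 v = 0}
  add_mem' hf hg v hv := by simp [hf v hv, hg v hv]
  zero_mem' v _ := rfl
  smul_mem' c f hf v hv := by simp [hf v hv]

variable {R' : Type*} [NormedAddCommGroup R'] [NormedSpace ℝ R']

/-- Composition of a symmetric form with a linear map. -/
def pullback (T : R' →L[ℝ] R) (f : SymForm j R N) : SymForm j R' N :=
  ⟨f.1.compContinuousLinearMap fun _ => T, fun σ v => f.2 σ fun i => T (v i)⟩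

lemma pullback_apply (T : R' →L[ℝ] R) (f : SymForm j R N) (v : Fin j → R') :
    (pullback T f).1 v = f.1 (fun i => T (v i)) := rfl

lemma pullback_mem_vanishing (p : ℕ) (T : R' ≃L[ℝ] R) (f : SymForm j R N)
    {L : Submodule ℝ R} {L' : Submodule ℝ R'} (h : ∀ r, r ∈ L' ↔ T r ∈ L) :
    pullback (T : R' →L[ℝ] R) f ∈ vanishing p L' ↔ f ∈ vanishing p L := by
  classical
  constructor
  · intro hf v hv
    have := hf (fun i => T.symm (v i)) (by convert! hv using 4; simp [h])
    simpa [pullback_apply] using this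
  · intro hf v hv
    have := hf (fun i => T (v i)) (by convert! hv using 4; simp [h])
    simpa [pullback_apply] using this

instance [FiniteDimensional ℝ R] [FiniteDimensional ℝ N] :
    FiniteDimensional ℝ (ContinuousMultilinearMap ℝ (fun _ : Fin j => R) N) := by
  let F : ContinuousMultilinearMap ℝ (fun _ : Fin j => R) N →ₗ[ℝ]
      MultilinearMap ℝ (fun _ : Fin j => R) N :=
    { toFun := fun f => f.toMultilinearMap
      map_add' := fun _ _ => rfl
      map_smul' := fun _ _ => rfl }
  exact Module.Finite.of_injective F ContinuousMultilinearMap.toMultilinearMap_injective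

instance [FiniteDimensional ℝ R] [FiniteDimensional ℝ N] (p : ℕ) (L : Submodule ℝ R) :
    IsClosed ((vanishing p L : Submodule ℝ (SymForm j R N)) : Set (SymForm j R N)) :=
  Submodule.closed_of_finiteDimensional _

end SymForms

section Grassmann

variable (l : ℕ) (R : Type*) [NormedAddCommGroup R] [NormedSpace ℝ R]

/-- The Grassmannian of `l`-dimensional subspaces of `R`. -/
def Gr : Type _ := {L : Submodule ℝ R // finrank ℝ L = l}

/-- The model `ℝ^l × ℝ^(n-l)` of `R`, where `n = dim R`. -/
abbrev Split : Type := (Fin l → ℝ) × (Fin (finrank ℝ R - l) → ℝ)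

/-- The model vector space `Hom(ℝ^l, ℝ^(n-l))` of the Grassmannian. -/
abbrev GrModel : Type := (Fin l → ℝ) →L[ℝ] (Fin (finrank ℝ R - l) → ℝ)

/-- Linear coordinates `(x, y)` on `R` with `l` coordinates `x` and `n - l` coordinates `y`. -/
abbrev Frame : Type _ := R ≃L[ℝ] Split l R

variable {l R}

/-- The coordinates `(x, y - A x)`, in which the graph `y = A x` becomes `ℝ^l × 0`. -/
def Frame.adapted (b : Frame l R) (A : GrModel l R) : Frame l R :=
  b.trans (ContinuousLinearEquiv.equivOfInverse
    ((ContinuousLinearMap.fst ℝ _ _).prod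
      (ContinuousLinearMap.snd ℝ _ _ - A.comp (ContinuousLinearMap.fst ℝ _ _)))
    ((ContinuousLinearMap.fst ℝ _ _).prod
      (ContinuousLinearMap.snd ℝ _ _ + A.comp (ContinuousLinearMap.fst ℝ _ _)))
    (fun x => by ext <;> simp) (fun x => by ext <;> simp))

lemma Frame.adapted_apply (b : Frame l R) (A : GrModel l R) (r : R) :
    b.adapted A r = ((b r).1, (b r).2 - A (b r).1) := rfl

lemma Frame.adapted_symm_apply (b : Frame l R) (A : GrModel l R) (x : Split l R) :
    (b.adapted A).symm x = b.symm (x.1, x.2 + A x.1) := rfl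

variable (l R) in
/-- The subspace `ℝ^l × 0`. -/
def baseDirection : Submodule ℝ (Split l R) :=
  LinearMap.ker (LinearMap.snd ℝ (Fin l → ℝ) (Fin (finrank ℝ R - l) → ℝ))

lemma finrank_baseDirection : finrank ℝ (baseDirection l R) = l := by
  have : baseDirection l R = LinearMap.range (LinearMap.inl ℝ (Fin l → ℝ) _) :=
    LinearMap.range_inl ℝ _ _ |>.symm
  rw [this, LinearMap.finrank_range_of_inj LinearMap.inl_injective]
  simp

/-- The parametrization `A ↦ {y = A x}` of the Grassmannian in the linear coordinates `b`. -/
def Gr.param (b : Frame l R) (A : GrModel l R) : Gr l R :=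
  ⟨(baseDirection l R).comap ((b.adapted A : R →L[ℝ] Split l R) : R →ₗ[ℝ] Split l R), by
    rw [show Submodule.comap ((b.adapted A : R →L[ℝ] Split l R) : R →ₗ[ℝ] Split l R)
      (baseDirection l R) = _ from
      Submodule.comap_equiv_eq_map_symm (b.adapted A).toLinearEquiv (baseDirection l R)]
    exact (LinearEquiv.finrank_map_eq (b.adapted A).toLinearEquiv.symm _).trans finrank_baseDirection⟩

lemma Gr.mem_param (b : Frame l R) (A : GrModel l R) (r : R) :
    r ∈ (Gr.param b A).1 ↔ (b r).2 = A (b r).1 := by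
  simp [Gr.param, baseDirection, Frame.adapted_apply, sub_eq_zero]

lemma Gr.param_injective (b : Frame l R) : Injective (Gr.param b) := by
  intro A A' h
  ext1 w
  have : b.symm (w, A w) ∈ (Gr.param b A').1 := by
    rw [← h, Gr.mem_param]; simp
  rw [Gr.mem_param] at this
  simpa using this

lemma Gr.exists_param [FiniteDimensional ℝ R] (L : Gr l R) :
    ∃ b, L ∈ range (Gr.param (R := R) b) := by
  obtain ⟨L, hL⟩ := L
  obtain ⟨C, hC⟩ := Submodule.exists_isCompl L
  have hsum := Submodule.finrank_add_eq_of_isCompl hC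
  let e1 : L ≃ₗ[ℝ] (Fin l → ℝ) := LinearEquiv.ofFinrankEq _ _ (by simp [hL])
  let e2 : C ≃ₗ[ℝ] (Fin (finrank ℝ R - l) → ℝ) := LinearEquiv.ofFinrankEq _ _ (by simp; omega)
  let e : R ≃ₗ[ℝ] Split l R := (Submodule.prodEquivOfIsCompl L C hC).symm.trans (e1.prodCongr e2)
  refine ⟨e.toContinuousLinearEquiv, 0, ?_⟩
  apply Subtype.ext
  ext r
  rw [Gr.mem_param]
  simp [e, LinearEquiv.prodCongr_apply]

/-- First component of the map `w ↦ b₁ (b⁻¹ (w, A w))`, where `b₁` is the second frame. -/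
def overlapFst (b b' : Frame l R) (A : GrModel l R) : (Fin l → ℝ) →L[ℝ] (Fin l → ℝ) :=
  (ContinuousLinearMap.fst ℝ _ _).comp ((b.symm.trans b' : Split l R →L[ℝ] Split l R).comp
    ((ContinuousLinearMap.id ℝ _).prod A))

/-- Second component of the same map. -/
def overlapSnd (b b' : Frame l R) (A : GrModel l R) : GrModel l R :=
  (ContinuousLinearMap.snd ℝ _ _).comp ((b.symm.trans b' : Split l R →L[ℝ] Split l R).comp
    ((ContinuousLinearMap.id ℝ _).prod A))

/-- The coordinate change of the Grassmannian. -/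
def changeOfChart (b b' : Frame l R) (A : GrModel l R) : GrModel l R :=
  (overlapSnd b b' A).comp (overlapFst b b' A).inverse

lemma Gr.eq_of_le {L L' : Gr l R} [FiniteDimensional ℝ R] (h : L.1 ≤ L'.1) : L = L' :=
  Subtype.ext (Submodule.eq_of_le_of_finrank_eq h (L.2.trans L'.2.symm))

lemma overlap_apply (b b' : Frame l R) (A : GrModel l R) (w : Fin l → ℝ) :
    b' (b.symm (w, A w)) = (overlapFst b b' A w, overlapSnd b b' A w) := rfl

lemma isInvertible_of_param_eq [FiniteDimensional ℝ R] {b b' : Frame l R} {A A' : GrModel l R}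
    (h : Gr.param b A = Gr.param b' A') : (overlapFst b b' A).IsInvertible := by
  have hinj : Injective (overlapFst b b' A) := by
    rw [injective_iff_map_eq_zero]
    intro w hw
    have hm : b.symm (w, A w) ∈ (Gr.param b' A').1 := by
      rw [← h, Gr.mem_param]; simp
    rw [Gr.mem_param, overlap_apply] at hm
    simp only [hw, map_zero] at hm
    have : b' (b.symm (w, A w)) = 0 := by rw [overlap_apply, hw, hm]; rfl
    have : (w, A w) = (0 : Split l R) := by simpa using this
    exact congrArg Prod.fst this
  refine ⟨(LinearEquiv.ofInjectiveEndo (overlapFst b b' A : (Fin l → ℝ) →ₗ[ℝ] (Fin l → ℝ))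
    hinj).toContinuousLinearEquiv, ?_⟩
  ext1 w; rfl

lemma param_changeOfChart [FiniteDimensional ℝ R] {b b' : Frame l R} {A : GrModel l R}
    (h : (overlapFst b b' A).IsInvertible) : Gr.param b' (changeOfChart b b' A) = Gr.param b A := by
  symm
  apply Gr.eq_of_le
  intro r hr
  rw [Gr.mem_param] at hr ⊢
  have h1 : r = b.symm ((b r).1, A (b r).1) := by rw [← hr]; simp
  rw [h1, overlap_apply]
  obtain ⟨e, he⟩ := h
  simp [changeOfChart, ← he]

lemma overlap_eq [FiniteDimensional ℝ R] (b b' : Frame l R) :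
    {A | Gr.param b A ∈ range (Gr.param b')} = {A | (overlapFst b b' A).IsInvertible} := by
  ext A
  constructor
  · rintro ⟨A', h⟩
    exact isInvertible_of_param_eq h.symm
  · intro h
    exact ⟨_, param_changeOfChart h⟩

lemma contDiff_overlapFst (b b' : Frame l R) : ContDiff ℝ ∞ (overlapFst b b') := by
  have h (A : GrModel l R) : (ContinuousLinearMap.id ℝ (Fin l → ℝ)).prod A =
      ContinuousLinearMap.inl ℝ _ _ + (ContinuousLinearMap.inr ℝ _ _).comp A := by
    ext <;> simp
  unfold overlapFst
  simp_rw [h]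
  fun_prop

lemma contDiff_overlapSnd (b b' : Frame l R) : ContDiff ℝ ∞ (overlapSnd b b') := by
  have h (A : GrModel l R) : (ContinuousLinearMap.id ℝ (Fin l → ℝ)).prod A =
      ContinuousLinearMap.inl ℝ _ _ + (ContinuousLinearMap.inr ℝ _ _).comp A := by
    ext <;> simp
  unfold overlapSnd
  simp_rw [h]
  fun_prop

lemma isOpen_overlap [FiniteDimensional ℝ R] (b b' : Frame l R) :
    IsOpen {A | Gr.param b A ∈ range (Gr.param b')} := by
  rw [overlap_eq]
  exact (ContinuousLinearEquiv.isOpen (𝕜 := ℝ) (E := Fin l → ℝ) (F := Fin l → ℝ)).preimage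
    (contDiff_overlapFst b b').continuous

lemma contDiffOn_changeOfChart [FiniteDimensional ℝ R] (b b' : Frame l R) :
    ContDiffOn ℝ ∞ (changeOfChart b b') {A | Gr.param b A ∈ range (Gr.param b')} := by
  rw [overlap_eq]
  rintro A ⟨e, he⟩
  apply ContDiffAt.contDiffWithinAt
  have h1 : ContDiffAt ℝ ∞ ContinuousLinearMap.inverse (overlapFst b b' A) := by
    rw [← he]; exact contDiffAt_map_inverse e
  have h2 := h1.comp A (contDiff_overlapFst b b').contDiffAt
  exact (contDiff_overlapSnd b b').contDiffAt.clm_comp h2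

/-- The standard smooth atlas of the Grassmannian. -/
def Gr.paramAtlas [FiniteDimensional ℝ R] : ParamAtlas (Frame l R) (GrModel l R) (Gr l R) where
  param := Gr.param
  inj := Gr.param_injective
  cover := Gr.exists_param
  isOpen_overlap := isOpen_overlap
  smooth_transition b b' := (contDiffOn_changeOfChart b b').congr fun A hA => by
    rw [overlap_eq] at hA
    apply Gr.param_injective b'
    rw [param_changeOfChart hA]
    exact invFun_eq ⟨_, param_changeOfChart hA⟩

variable [FiniteDimensional ℝ R]

instance : TopologicalSpace (Gr l R) := Gr.paramAtlas.topologicalSpace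
instance : ChartedSpace (GrModel l R) (Gr l R) := Gr.paramAtlas.chartedSpace
instance : IsManifold 𝓘(ℝ, GrModel l R) ∞ (Gr l R) := Gr.paramAtlas.isManifold

end Grassmann

section Tower

variable (j l : ℕ) (R N : Type*) [NormedAddCommGroup R] [NormedSpace ℝ R] [FiniteDimensional ℝ R]
  [NormedAddCommGroup N] [NormedSpace ℝ N] [FiniteDimensional ℝ N]
  (J : Type*) [AddTorsor (SymForm j R N) J] (p : ℕ)

/-- Two points of `Gr(R, l) × J`, where `J` is an affine space over `S^j R* ⊗ N`, lie in the same
leaf of the distribution `V^p` iff their first components are the same plane `L` and their second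
components differ by an element of `μ_L^p`. -/
def leafSetoid : Setoid (Gr l R × J) where
  r x y := x.1 = y.1 ∧ x.2 -ᵥ y.2 ∈ vanishing p x.1.1
  iseqv := by
    refine ⟨fun x => ⟨rfl, by simp⟩, ?_, ?_⟩
    · rintro ⟨L, θ⟩ ⟨L', θ'⟩ ⟨h, h'⟩
      obtain rfl : L = L' := h
      refine ⟨rfl, ?_⟩
      rw [← neg_vsub_eq_vsub_rev]
      exact Submodule.neg_mem _ h'
    · rintro ⟨L, θ⟩ ⟨L', θ'⟩ ⟨L'', θ''⟩ ⟨h, h1⟩ ⟨h', h2⟩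
      obtain rfl : L = L' := h
      obtain rfl : L = L'' := h'
      refine ⟨rfl, ?_⟩
      have := Submodule.add_mem _ h1 h2
      rwa [vsub_add_vsub_cancel] at this

/-- The space of leaves of `V^p` on `Gr(R, l) × J`. For `j = k + 1` and `J` the space of
`(k+1)`-jets over a fixed `k`-jet this is `M^q` with `q = k + 1 - p`. -/
def LeafSpace : Type _ := Quotient (leafSetoid j l R N J p)

/-- The model of the fibres of the leaf space over the Grassmannian: the quotient of
`S^j (ℝ^l × ℝ^(n-l))* ⊗ N` by `μ^p` of `ℝ^l × 0`. -/
def LeafFiber : Type _ :=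
  SymForm j (Split l R) N ⧸ (vanishing p (baseDirection l R) :
    Submodule ℝ (SymForm j (Split l R) N))

instance : NormedAddCommGroup (LeafFiber j l R N p) :=
  inferInstanceAs (NormedAddCommGroup (SymForm j (Split l R) N ⧸
    (vanishing p (baseDirection l R) : Submodule ℝ (SymForm j (Split l R) N))))

instance : NormedSpace ℝ (LeafFiber j l R N p) :=
  Submodule.Quotient.normedSpace
    (vanishing p (baseDirection l R) : Submodule ℝ (SymForm j (Split l R) N)) ℝ

/-- The model vector space of the leaf space. -/
abbrev LeafModel : Type _ := GrModel l R × LeafFiber j l R N p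

variable {j l R N J p}

def LeafFiber.mk : SymForm j (Split l R) N →ₗ[ℝ] LeafFiber j l R N p :=
  Submodule.mkQ (vanishing p (baseDirection l R) : Submodule ℝ (SymForm j (Split l R) N))

lemma LeafFiber.mk_surjective : Surjective (LeafFiber.mk : _ → LeafFiber j l R N p) :=
  Submodule.mkQ_surjective _

lemma LeafFiber.mk_eq_iff {f g : SymForm j (Split l R) N} :
    (LeafFiber.mk f : LeafFiber j l R N p) = LeafFiber.mk g ↔
      f - g ∈ vanishing p (baseDirection l R) :=
  Submodule.Quotient.eq _

/-- A representative of a class in `LeafFiber`. -/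
def LeafFiber.rep (y : LeafFiber j l R N p) : SymForm j (Split l R) N :=
  surjInv LeafFiber.mk_surjective y

lemma LeafFiber.mk_rep (y : LeafFiber j l R N p) : LeafFiber.mk y.rep = y :=
  surjInv_eq LeafFiber.mk_surjective y

instance : FiniteDimensional ℝ (LeafFiber j l R N p) :=
  Module.Finite.of_surjective LeafFiber.mk LeafFiber.mk_surjective

/-- The leaf through a point of `Gr(R, l) × J`. -/
def leaf (x : Gr l R × J) : LeafSpace j l R N J p := Quotient.mk (leafSetoid j l R N J p) x

lemma leaf_eq_iff {x y : Gr l R × J} : (leaf x : LeafSpace j l R N J p) = leaf y ↔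
    x.1 = y.1 ∧ x.2 -ᵥ y.2 ∈ vanishing p x.1.1 := Quotient.eq (r := leafSetoid j l R N J p)

variable (R N J j) in
/-- A chosen origin of the affine space `J`. -/
def origin : J := Classical.choice (AddTorsor.nonempty (G := SymForm j R N))

/-- The parametrization `(A, [f]) ↦` leaf of `({y = A x}, origin + f(x, y - A x))` of the leaf
space. It does not depend on the choice of the representative `f`. -/
def LeafSpace.param (b : Frame l R) (z : LeafModel j l R N p) : LeafSpace j l R N J p :=
  leaf (Gr.param b z.1, pullback (b.adapted z.1 : R →L[ℝ] Split l R) z.2.rep +ᵥ origin j R N J)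

lemma LeafSpace.param_eq_iff (b b' : Frame l R) (A A' : GrModel l R)
    (f f' : SymForm j (Split l R) N) :
    (LeafSpace.param b (A, LeafFiber.mk f) : LeafSpace j l R N J p) =
        LeafSpace.param b' (A', LeafFiber.mk f') ↔
      Gr.param b A = Gr.param b' A' ∧
      pullback (b.adapted A : R →L[ℝ] Split l R) f - pullback (b'.adapted A' : R →L[ℝ] Split l R) f'
        ∈ vanishing p (Gr.param b A).1 := by
  have key (b : Frame l R) (A : GrModel l R) (f : SymForm j (Split l R) N) :
      (LeafSpace.param b (A, LeafFiber.mk f) : LeafSpace j l R N J p) =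
      leaf (Gr.param b A, pullback (b.adapted A : R →L[ℝ] Split l R) f +ᵥ origin j R N J) := by
    rw [param, leaf_eq_iff]
    refine ⟨rfl, ?_⟩
    simp only [vadd_vsub_vadd_cancel_right]
    exact (pullback_mem_vanishing p (b.adapted A) (_ - f) (L := baseDirection l R)
      (fun r => Iff.rfl)).2 (LeafFiber.mk_eq_iff.1 (LeafFiber.mk_rep _))
  rw [key, key, leaf_eq_iff]
  simp only [vadd_vsub_vadd_cancel_right]

/-- The linear change of the adapted coordinates that accompanies a change of chart. -/
def transitionMap (b b' : Frame l R) (A : GrModel l R) : Split l R ≃L[ℝ] Split l R :=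
  (b'.adapted (changeOfChart b b' A)).symm.trans (b.adapted A)

lemma contDiffOn_transitionMap (b b' : Frame l R) :
    ContDiffOn ℝ ∞ (fun A => (transitionMap b b' A : Split l R →L[ℝ] Split l R))
      {A | Gr.param b A ∈ range (Gr.param b')} := by
  have h (A : GrModel l R) : (transitionMap b b' A : Split l R →L[ℝ] Split l R) =
      ((b : R →L[ℝ] Split l R) - (ContinuousLinearMap.inr ℝ _ _).comp
        (A.comp ((ContinuousLinearMap.fst ℝ _ _).comp (b : R →L[ℝ] Split l R)))).comp
      ((b'.symm : Split l R →L[ℝ] R).comp (ContinuousLinearMap.id ℝ _ +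
        (ContinuousLinearMap.inr ℝ _ _).comp ((changeOfChart b b' A).comp
          (ContinuousLinearMap.fst ℝ _ _)))) := by
    refine ContinuousLinearMap.ext fun x => ?_
    have hx : (x.1, x.2 + (changeOfChart b b' A) x.1) =
        x + (0, (changeOfChart b b' A) x.1) := by ext <;> simp
    simp [transitionMap, hx, Frame.adapted_apply, Frame.adapted_symm_apply, Prod.ext_iff]
    abel
  simp_rw [h]
  have := contDiffOn_changeOfChart b b'
  fun_prop

lemma contDiff_of_linear {E F : Type*} [NormedAddCommGroup E] [NormedSpace ℝ E]
    [FiniteDimensional ℝ E] [NormedAddCommGroup F] [NormedSpace ℝ F] (f : E →ₗ[ℝ] F) :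
    ContDiff ℝ ∞ f := (LinearMap.toContinuousLinearMap f).contDiff

lemma contDiff_mk_pullback {X : Type*} [NormedAddCommGroup X] [NormedSpace ℝ X] {s : Set X}
    {T : X → Split l R →L[ℝ] Split l R} (hT : ContDiffOn ℝ ∞ T s)
    {f : X → SymForm j (Split l R) N} (hf : ContDiffOn ℝ ∞ f s) :
    ContDiffOn ℝ ∞ (fun x => (LeafFiber.mk (pullback (T x) (f x)) : LeafFiber j l R N p)) s := by
  obtain ⟨P, hP⟩ := LinearMap.exists_leftInverse_of_injective
    (SymForm j (Split l R) N).subtype (Submodule.ker_subtype _)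
  let Q : ContinuousMultilinearMap ℝ (fun _ : Fin j => Split l R) N →ₗ[ℝ]
      LeafFiber j l R N p := LeafFiber.mk.comp P
  let C := ContinuousMultilinearMap.compContinuousLinearMapContinuousMultilinear ℝ
    (fun _ : Fin j => Split l R) (fun _ : Fin j => Split l R) N
  have h (x : X) : (LeafFiber.mk (pullback (T x) (f x)) : LeafFiber j l R N p) =
      Q (C (fun _ => T x) (f x).1) := by
    have := LinearMap.congr_fun hP (pullback (T x) (f x))
    exact congrArg LeafFiber.mk this.symm
  simp_rw [h]
  have h1 : ContDiffOn ℝ ∞ (fun x => (fun _ : Fin j => T x)) s := contDiffOn_pi.2 fun _ => hT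
  have h2 : ContDiffOn ℝ ∞ (fun x => C (fun _ : Fin j => T x)) s :=
    C.contDiff.comp_contDiffOn h1
  have h3 : ContDiff ℝ ∞ (fun g : SymForm j (Split l R) N => g.1) :=
    contDiff_of_linear (E := SymForm j (Split l R) N)
      (F := ContinuousMultilinearMap ℝ (fun _ : Fin j => Split l R) N)
      (SymForm j (Split l R) N).subtype
  have h4 : ContDiffOn ℝ ∞ (fun x => (f x).1) s := h3.comp_contDiffOn hf
  exact (contDiff_of_linear Q).comp_contDiffOn (h2.clm_apply h4)

lemma LeafSpace.param_transition {b b' : Frame l R} {A : GrModel l R}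
    (hA : Gr.param b A ∈ range (Gr.param b')) (f : SymForm j (Split l R) N) :
    (LeafSpace.param b' (changeOfChart b b' A, LeafFiber.mk
      (pullback (transitionMap b b' A : Split l R →L[ℝ] Split l R) f)) :
        LeafSpace j l R N J p) = LeafSpace.param b (A, LeafFiber.mk f) := by
  have hA' : A ∈ {A | Gr.param b A ∈ range (Gr.param b')} := hA
  rw [PartialJets.overlap_eq] at hA'
  refine (LeafSpace.param_eq_iff b' b _ A _ f).2 ⟨param_changeOfChart hA', ?_⟩
  have : pullback (b'.adapted (changeOfChart b b' A) : R →L[ℝ] Split l R)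
      (pullback (transitionMap b b' A : Split l R →L[ℝ] Split l R) f) =
      pullback (b.adapted A : R →L[ℝ] Split l R) f := by
    apply Subtype.ext
    ext v
    simp [pullback_apply, transitionMap]
  rw [this, sub_self]
  exact Submodule.zero_mem _

lemma LeafSpace.param_injective (b : Frame l R) :
    Injective (LeafSpace.param b : LeafModel j l R N p → LeafSpace j l R N J p) := by
  rintro ⟨A, y⟩ ⟨A', y'⟩ h
  obtain ⟨f, rfl⟩ := LeafFiber.mk_surjective y
  obtain ⟨f', rfl⟩ := LeafFiber.mk_surjective y'
  obtain ⟨h1, h2⟩ := (LeafSpace.param_eq_iff b b A A' f f').1 h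
  obtain rfl := Gr.param_injective b h1
  refine Prod.ext rfl (LeafFiber.mk_eq_iff.2 ?_)
  exact (pullback_mem_vanishing p (b.adapted A) (f - f') (L := baseDirection l R)
      (fun r => Iff.rfl)).1 h2

lemma LeafSpace.exists_param (φ : LeafSpace j l R N J p) :
    ∃ b : Frame l R, φ ∈ range (LeafSpace.param b) := by
  obtain ⟨⟨L, θ⟩, rfl⟩ := Quotient.exists_rep φ
  obtain ⟨b, A, rfl⟩ := Gr.exists_param L
  let f := pullback ((b.adapted A).symm : Split l R →L[ℝ] R) (θ -ᵥ origin j R N J)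
  refine ⟨b, (A, LeafFiber.mk f), leaf_eq_iff.2 ⟨rfl, ?_⟩⟩
  have h : θ = pullback (b.adapted A : R →L[ℝ] Split l R) f +ᵥ origin j R N J := by
    rw [eq_vadd_iff_vsub_eq]
    apply Subtype.ext
    ext v
    simp [f, pullback_apply]
  simp only
  rw [h, vadd_vsub_vadd_cancel_right]
  exact (pullback_mem_vanishing p (b.adapted A) (_ - f) (L := baseDirection l R)
      (L' := (Gr.param b A).1) (fun r => Iff.rfl)).2 (LeafFiber.mk_eq_iff.1 (LeafFiber.mk_rep _))

lemma LeafSpace.overlap_eq (b b' : Frame l R) :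
    {z : LeafModel j l R N p | (LeafSpace.param b z : LeafSpace j l R N J p) ∈
      range (LeafSpace.param b')} = Prod.fst ⁻¹' {A | Gr.param b A ∈ range (Gr.param b')} := by
  ext z
  constructor
  · rintro ⟨z', h⟩
    exact ⟨z'.1, (leaf_eq_iff.1 h).1⟩
  · intro h
    obtain ⟨A, y⟩ := z
    obtain ⟨f, rfl⟩ := LeafFiber.mk_surjective y
    exact ⟨_, LeafSpace.param_transition h f⟩

variable (j l R N J p) in
/-- The smooth atlas of the leaf space. -/
def LeafSpace.paramAtlas :
    ParamAtlas (Frame l R) (LeafModel j l R N p) (LeafSpace j l R N J p) where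
  param := LeafSpace.param
  inj := LeafSpace.param_injective
  cover := LeafSpace.exists_param
  isOpen_overlap b b' := by
    rw [LeafSpace.overlap_eq]
    exact (isOpen_overlap b b').preimage continuous_fst
  smooth_transition b b' := by
    obtain ⟨σ, hσ⟩ := LinearMap.exists_rightInverse_of_surjective
      (LeafFiber.mk : _ →ₗ[ℝ] LeafFiber j l R N p)
      (LinearMap.range_eq_top.2 LeafFiber.mk_surjective)
    have hσ' (y : LeafFiber j l R N p) : LeafFiber.mk (σ y) = y := LinearMap.congr_fun hσ y
    have h1 : ContDiffOn ℝ ∞ (fun z : LeafModel j l R N p => z.1)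
        (Prod.fst ⁻¹' {A | Gr.param b A ∈ range (Gr.param b')}) := contDiff_fst.contDiffOn
    rw [LeafSpace.overlap_eq]
    refine ContDiffOn.congr (f := fun z => (changeOfChart b b' z.1, LeafFiber.mk
      (pullback (transitionMap b b' z.1 : Split l R →L[ℝ] Split l R) (σ z.2)))) ?_ ?_
    · refine ((contDiffOn_changeOfChart b b').comp h1 fun _ h => h).prodMk
        (contDiff_mk_pullback ((contDiffOn_transitionMap b b').comp h1 fun _ h => h) ?_)
      have h2 : ContDiff ℝ ∞ (fun y => σ y) :=
        contDiff_of_linear (E := LeafFiber j l R N p) (F := SymForm j (Split l R) N) σ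
      exact (h2.comp contDiff_snd).contDiffOn
    · rintro ⟨A, y⟩ hz
      have h2 := LeafSpace.param_transition (J := J) (p := p) (A := A) hz (σ y)
      rw [hσ'] at h2
      apply LeafSpace.param_injective (J := J) b'
      rw [h2]
      exact invFun_eq ⟨_, h2⟩

instance : TopologicalSpace (LeafSpace j l R N J p) :=
  (LeafSpace.paramAtlas j l R N J p).topologicalSpace
instance : ChartedSpace (LeafModel j l R N p) (LeafSpace j l R N J p) :=
  (LeafSpace.paramAtlas j l R N J p).chartedSpace
instance : IsManifold 𝓘(ℝ, LeafModel j l R N p) ∞ (LeafSpace j l R N J p) :=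
  (LeafSpace.paramAtlas j l R N J p).isManifold

lemma param_torsor_injective : Injective fun f : SymForm j R N => f +ᵥ origin j R N J :=
  fun _ _ h => vadd_right_cancel _ h

variable (j R N J) in
/-- The smooth structure of an affine space over `SymForm j R N`, given by the chart
`f ↦ origin + f`. -/
def torsorAtlas : ParamAtlas Unit (SymForm j R N) J where
  param _ f := f +ᵥ origin j R N J
  inj _ := param_torsor_injective
  cover θ := ⟨(), θ -ᵥ origin j R N J, vsub_vadd _ _⟩
  isOpen_overlap _ _ := by
    convert isOpen_univ
    ext f
    simp
  smooth_transition _ _ := contDiff_id.contDiffOn.congr fun f _ =>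
    leftInverse_invFun (param_torsor_injective (J := J)) f

end Tower

section Taylor

variable {R N : Type*} [NormedAddCommGroup R] [NormedSpace ℝ R]
  [NormedAddCommGroup N] [NormedSpace ℝ N]

lemma diagonal_eq_zero {i : ℕ} (f : ContinuousMultilinearMap ℝ (fun _ : Fin i => R) N)
    (h : (fun r => f fun _ => r) =o[𝓝 0] fun r => ‖r‖ ^ i) (r : R) : f (fun _ => r) = 0 := by
  have ht : Tendsto (fun t : ℝ => t • r) (𝓝[≠] 0) (𝓝 0) := by
    have : Tendsto (fun t : ℝ => t • r) (𝓝 0) (𝓝 ((0 : ℝ) • r)) :=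
      (continuous_id.smul continuous_const).tendsto 0
    rw [zero_smul] at this
    exact this.mono_left nhdsWithin_le_nhds
  have h1 := h.comp_tendsto ht
  have h2 : (fun t : ℝ => t ^ i • f fun _ => r) =o[𝓝[≠] 0] fun t => t ^ i := by
    have h3 : (fun t : ℝ => ‖t • r‖ ^ i) =O[𝓝[≠] 0] fun t => t ^ i := by
      refine IsBigO.of_bound (‖r‖ ^ i) (Eventually.of_forall fun t => ?_)
      simp [norm_smul, mul_pow, mul_comm]
    refine (h1.trans_isBigO h3).congr_left fun t => ?_
    simpa using f.map_smul_univ (fun _ => t) fun _ => r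
  by_contra hne
  have hpos : 0 < ‖f fun _ => r‖ := norm_pos_iff.2 hne
  obtain ⟨t, ht1, ht2⟩ := ((h2.def (half_pos hpos)).and self_mem_nhdsWithin).exists
  have htpos : 0 < ‖t ^ i‖ := norm_pos_iff.2 (pow_ne_zero _ ht2)
  rw [norm_smul] at ht1
  nlinarith

lemma norm_pow_isBigO {X : Type*} [NormedAddCommGroup X] {i k : ℕ} (h : i ≤ k) :
    (fun y : X => ‖y‖ ^ k) =O[𝓝 0] fun y => ‖y‖ ^ i := by
  refine IsBigO.of_bound 1 ?_
  filter_upwards [Metric.closedBall_mem_nhds (0 : X) one_pos] with y hy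
  rw [mem_closedBall_zero_iff] at hy
  simpa using pow_le_pow_of_le_one (norm_nonneg _) hy h

lemma symForm_eq_zero {i : ℕ} (f : SymForm i R N) (h : ∀ r, f.1 (fun _ => r) = 0) : f = 0 := by
  apply Subtype.ext
  ext v
  have h1 := f.1.iteratedFDeriv_comp_diagonal (0 : R) v
  have h2 : (fun r : R => f.1 fun _ => r) = fun _ => 0 := funext h
  rw [h2] at h1
  have h3 (σ : Equiv.Perm (Fin i)) : f.1 (fun k => v (σ k)) = f.1 v := f.2 σ v
  simp only [h3, Finset.sum_const, Finset.card_univ, Fintype.card_perm, Fintype.card_fin] at h1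
  have h4 : iteratedFDeriv ℝ i (fun _ : R => (0 : N)) 0 = 0 := by
    simp
  rw [h4, zero_apply, eq_comm, ← Nat.cast_smul_eq_nsmul ℝ,
    smul_eq_zero] at h1
  exact h1.resolve_left (by exact_mod_cast i.factorial_ne_zero)

lemma exists_symForm {k : ℕ} {G : R → N} (hG : ContDiffAt ℝ ∞ G 0)
    [CompleteSpace N]
    (hk : G =o[𝓝 0] fun r => ‖r‖ ^ k) :
    ∃ f : SymForm (k + 1) R N,
      (fun r => G r - f.1 fun _ => r) =o[𝓝 0] fun r => ‖r‖ ^ (k + 1) := by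
  have taylor (i : ℕ) : (fun y => G y - ∑ s ∈ Finset.range (i + 1),
      ((s.factorial : ℝ)⁻¹ • iteratedFDeriv ℝ s G 0 fun _ => y)) =O[𝓝 0]
      fun y => ‖y‖ ^ (i + 1) := by
    have h1 : ContDiffAt ℝ (i + 1) G 0 := hG.of_le (by exact_mod_cast le_top)
    have h2 := h1.eventually (by simp)
    have h3 : ContinuousAt (iteratedFDeriv ℝ (i + 1) G) 0 :=
      (h1.iteratedFDeriv_right (m := 0) (i := i + 1) (by simp)).continuousAt
    have h4 : ∀ᶠ y in 𝓝 (0 : R), ‖iteratedFDeriv ℝ (i + 1) G y‖ <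
        ‖iteratedFDeriv ℝ (i + 1) G 0‖ + 1 :=
      h3.norm.eventually_lt continuousAt_const (by simp)
    obtain ⟨ε, hε, hball⟩ := Metric.eventually_nhds_iff_ball.1 (h2.and h4)
    refine IsBigO.of_bound ((i.factorial : ℝ)⁻¹ * (‖iteratedFDeriv ℝ (i + 1) G 0‖ + 1)) ?_
    filter_upwards [Metric.ball_mem_nhds (0 : R) hε] with y hy
    have hmem (t : ℝ) (ht : t ∈ Icc (0 : ℝ) 1) : t • y ∈ Metric.ball (0 : R) ε := by
      rw [mem_ball_zero_iff] at hy ⊢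
      rw [norm_smul, Real.norm_of_nonneg ht.1]
      exact lt_of_le_of_lt (mul_le_of_le_one_left (norm_nonneg _) ht.2) hy
    have h5 := map_add_eq_sum_add_integral_iteratedFDeriv (f := G) (x := 0) (y := y) (n := i)
      (fun t ht => by simpa using (hball _ (hmem t ht)).1)
    simp only [zero_add] at h5
    rw [h5, add_sub_cancel_left, norm_smul, mul_assoc]
    simp only [norm_inv, RCLike.norm_natCast, norm_pow, norm_norm]
    gcongr
    refine (intervalIntegral.norm_integral_le_of_norm_le_const (a := 0) (b := 1)
      (C := (‖iteratedFDeriv ℝ (i + 1) G 0‖ + 1) * ‖y‖ ^ (i + 1)) ?_).trans (by simp)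
    intro t ht
    rw [uIoc_of_le zero_le_one] at ht
    have ht' : t ∈ Icc (0 : ℝ) 1 := ⟨ht.1.le, ht.2⟩
    rw [norm_smul]
    have h6 : ‖(1 - t) ^ i‖ ≤ 1 := by
      rw [norm_pow, Real.norm_of_nonneg (by linarith [ht'.2])]
      exact pow_le_one₀ (by linarith [ht'.2]) (by linarith [ht'.1])
    have h7 : ‖iteratedFDeriv ℝ (i + 1) G (t • y) fun _ => y‖ ≤
        (‖iteratedFDeriv ℝ (i + 1) G 0‖ + 1) * ‖y‖ ^ (i + 1) := by
      refine (ContinuousMultilinearMap.le_opNorm _ _).trans ?_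
      simp only [Finset.prod_const, Finset.card_univ, Fintype.card_fin]
      gcongr
      exact (hball _ (hmem t ht')).2.le
    exact (mul_le_of_le_one_left (norm_nonneg _) h6).trans h7
  have vanish : ∀ i ≤ k, ∀ y, iteratedFDeriv ℝ i G 0 (fun _ => y) = 0 := by
    intro i
    induction i using Nat.strong_induction_on with
    | _ i ih =>
    intro hi y
    refine diagonal_eq_zero _ ?_ y
    have h1 : (fun y => G y - ((i.factorial : ℝ)⁻¹ • iteratedFDeriv ℝ i G 0 fun _ => y)) =O[𝓝 0]
        fun y => ‖y‖ ^ (i + 1) := by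
      refine (taylor i).congr_left fun y => ?_
      rw [Finset.sum_range_succ, Finset.sum_eq_zero, zero_add]
      intro s hs
      rw [ih s (Finset.mem_range.1 hs) ((Finset.mem_range.1 hs).le.trans hi), smul_zero]
    have h2 : (fun y : R => ‖y‖ ^ (i + 1)) =o[𝓝 0] fun y => ‖y‖ ^ i :=
      isLittleO_norm_pow_norm_pow i.lt_succ_self
    have h3 : G =o[𝓝 0] fun y => ‖y‖ ^ i :=
      hk.trans_isBigO (norm_pow_isBigO hi)
    have h4 := (h3.sub (h1.trans_isLittleO h2)).const_smul_left (i.factorial : ℝ)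
    refine h4.congr_left fun y => ?_
    have : (i.factorial : ℝ) ≠ 0 := by exact_mod_cast i.factorial_ne_zero
    simp [smul_smul, this]
  have h1 : (fun y => G y - (((k + 1).factorial : ℝ)⁻¹ •
      iteratedFDeriv ℝ (k + 1) G 0 fun _ => y)) =o[𝓝 0] fun y => ‖y‖ ^ (k + 1) := by
    refine ((taylor (k + 1)).trans_isLittleO
      (isLittleO_norm_pow_norm_pow (Nat.lt_succ_self _))).congr_left fun y => ?_
    rw [Finset.sum_range_succ, Finset.sum_eq_zero, zero_add]
    intro s hs
    rw [vanish s (Nat.lt_succ_iff.1 (Finset.mem_range.1 hs)), smul_zero]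
  let D := iteratedFDeriv ℝ (k + 1) G 0
  let c : ℝ := ((k + 1).factorial : ℝ)⁻¹
  refine ⟨⟨(c * c) • ∑ σ : Equiv.Perm (Fin (k + 1)), D.domDomCongr σ, ?_⟩, ?_⟩
  · intro σ v
    simp only [smul_apply, sum_apply,
      ContinuousMultilinearMap.domDomCongr_apply]
    congr 1
    exact Fintype.sum_equiv (Equiv.mulLeft σ) _ _ fun τ => rfl
  · refine h1.congr_left fun y => ?_
    simp only [smul_apply, sum_apply,
      ContinuousMultilinearMap.domDomCongr_apply, Finset.sum_const, Finset.card_univ,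
      Fintype.card_perm, Fintype.card_fin, c, D]
    have : ((k + 1).factorial : ℝ) ≠ 0 := by exact_mod_cast (k + 1).factorial_ne_zero
    rw [← Nat.cast_smul_eq_nsmul ℝ, smul_smul]
    congr 2
    field_simp

end Taylor
section GermDiffeo

variable {X Y Z : Type*} [NormedAddCommGroup X] [NormedSpace ℝ X]
  [NormedAddCommGroup Y] [NormedSpace ℝ Y] [NormedAddCommGroup Z] [NormedSpace ℝ Z]

/-- `φ` is (a representative of) a germ of a diffeomorphism at the origin fixing the origin. -/
def IsGermDiffeo (φ : X → Y) : Prop :=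
  ContDiffAt ℝ ∞ φ 0 ∧ φ 0 = 0 ∧ Bijective (fderiv ℝ φ 0)

lemma IsGermDiffeo.id : IsGermDiffeo (fun x : X => x) :=
  ⟨contDiffAt_id, rfl, by simpa using! bijective_id⟩

lemma IsGermDiffeo.tendsto {φ : X → Y} (h : IsGermDiffeo φ) : Tendsto φ (𝓝 0) (𝓝 0) := by
  simpa [h.2.1] using h.1.continuousAt.tendsto

lemma IsGermDiffeo.differentiableAt {φ : X → Y} (h : IsGermDiffeo φ) : DifferentiableAt ℝ φ 0 :=
  h.1.differentiableAt (by simp)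

lemma IsGermDiffeo.comp {ψ : Y → Z} {φ : X → Y} (hψ : IsGermDiffeo ψ) (hφ : IsGermDiffeo φ) :
    IsGermDiffeo (fun x => ψ (φ x)) := by
  have h1 : ContDiffAt ℝ ∞ ψ (φ 0) := by rw [hφ.2.1]; exact hψ.1
  refine ⟨h1.comp 0 hφ.1, by simp [hφ.2.1, hψ.2.1], ?_⟩
  have h2 : fderiv ℝ (fun x => ψ (φ x)) 0 = (fderiv ℝ ψ 0).comp (fderiv ℝ φ 0) := by
    rw [show (fun x => ψ (φ x)) = ψ ∘ φ from rfl, fderiv_comp 0 (h1.differentiableAt (by simp))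
      hφ.differentiableAt, hφ.2.1]
  rw [h2]
  exact hψ.2.2.comp hφ.2.2

lemma IsGermDiffeo.isBigO {φ : X → Y} (h : IsGermDiffeo φ) (r : ℕ) :
    (fun x => ‖φ x‖ ^ r) =O[𝓝 0] fun x => ‖x‖ ^ r := by
  have h1 := h.differentiableAt.isBigO_sub
  simp only [h.2.1, sub_zero] at h1
  exact h1.norm_norm.pow r

lemma IsGermDiffeo.exists_inverse [FiniteDimensional ℝ X] [FiniteDimensional ℝ Y] {φ : X → Y}
    (h : IsGermDiffeo φ) : ∃ ψ : Y → X, IsGermDiffeo ψ ∧ (∀ᶠ y in 𝓝 0, φ (ψ y) = y) ∧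
      ∀ᶠ x in 𝓝 0, ψ (φ x) = x := by
  have := FiniteDimensional.complete ℝ X
  let e : X ≃L[ℝ] Y := (LinearEquiv.ofBijective (fderiv ℝ φ 0 : X →ₗ[ℝ] Y)
    h.2.2).toContinuousLinearEquiv
  have he : HasFDerivAt φ (e : X →L[ℝ] Y) 0 := h.differentiableAt.hasFDerivAt
  have hs := h.1.hasStrictFDerivAt' he (by simp)
  let ψ := hs.localInverse φ e 0
  have hψ0 : ψ 0 = 0 := by
    have := hs.localInverse_apply_image
    rwa [h.2.1] at this
  have hd : HasStrictFDerivAt ψ (e.symm : Y →L[ℝ] X) (φ 0) := hs.to_localInverse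
  have hc : ContDiffAt ℝ ∞ ψ (φ 0) := h.1.to_localInverse he (by simp)
  have h1 : ∀ᶠ y in 𝓝 (φ 0), φ (ψ y) = y := hs.eventually_right_inverse
  have h2 := hs.eventually_left_inverse
  rw [h.2.1] at hd hc h1
  refine ⟨ψ, ⟨hc, hψ0, ?_⟩, h1, h2⟩
  rw [hd.hasFDerivAt.fderiv]
  exact e.symm.bijective

lemma IsGermDiffeo.isLittleO_comp {φ : X → Y} (h : IsGermDiffeo φ) {r : ℕ} {u : Y → Z}
    (hu : u =o[𝓝 0] fun y => ‖y‖ ^ r) : (fun x => u (φ x)) =o[𝓝 0] fun x => ‖x‖ ^ r :=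
  (hu.comp_tendsto h.tendsto).trans_isBigO (h.isBigO r)

end GermDiffeo

section TaylorDifference

lemma IsGermDiffeo.isBigO_norm {X Y : Type*} [NormedAddCommGroup X] [NormedSpace ℝ X]
    [NormedAddCommGroup Y] [NormedSpace ℝ Y] {φ : X → Y} (h : IsGermDiffeo φ) :
    φ =O[𝓝 0] fun x => ‖x‖ := by
  have := h.isBigO 1
  simp only [pow_one] at this
  exact this.of_norm_left

variable {X V N : Type*} [NormedAddCommGroup X] [NormedSpace ℝ X] [FiniteDimensional ℝ X]
  [NormedAddCommGroup V] [NormedSpace ℝ V] [FiniteDimensional ℝ V]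
  [NormedAddCommGroup N] [NormedSpace ℝ N]

instance isClosed_submodule (R : Submodule ℝ V) : IsClosed (R : Set V) :=
  R.closed_of_finiteDimensional

/-- The parametrized submanifolds `c`, `c'` have the same tangent plane `R` at the origin, agree up
to order `k` after a reparametrization, and the class modulo `R` of the difference of their Taylor
expansions has `f` as its homogeneous term of order `k + 1`. Here the parameter domain of `c'` is
identified with `R` through the differential `T` of `c'`. -/
def IsTaylorDifference (k : ℕ) (R : Submodule ℝ V) (c c' : X → V)
    (f : SymForm (k + 1) R (V ⧸ R)) : Prop :=
  ∃ φ : X → X, IsGermDiffeo φ ∧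
    ((fun x => c (φ x) - c' x) =o[𝓝 0] fun x => ‖x‖ ^ k) ∧
    ∃ T : X →L[ℝ] R, (∀ x, (T x : V) = fderiv ℝ c' 0 x) ∧
      (fun x => R.mkQ (c (φ x) - c' x) - f.1 fun _ => T x) =o[𝓝 0] fun x => ‖x‖ ^ (k + 1)

lemma diagonal_sub_isLittleO {Y : Type*} [NormedAddCommGroup Y] [NormedSpace ℝ Y] {i : ℕ}
    (f : ContinuousMultilinearMap ℝ (fun _ : Fin (i + 1) => Y) N)
    {a b : X → Y} (ha : a =O[𝓝 0] fun x => ‖x‖) (hb : b =O[𝓝 0] fun x => ‖x‖)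
    (hab : (fun x => a x - b x) =o[𝓝 0] fun x => ‖x‖) :
    (fun x => (f fun _ => a x) - f fun _ => b x) =o[𝓝 0] fun x => ‖x‖ ^ (i + 1) := by
  have h1 : (fun x => (f fun _ => a x) - f fun _ => b x) =O[𝓝 0]
      fun x => (max ‖a x‖ ‖b x‖) ^ i * ‖a x - b x‖ := by
    refine IsBigO.of_bound (‖f‖ * (i + 1)) (Eventually.of_forall fun x => ?_)
    refine (f.norm_image_sub_le _ _).trans ?_
    have e1 (y : Y) : ‖(fun _ : Fin (i + 1) => y)‖ = ‖y‖ := pi_norm_const y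
    have e2 : (fun _ : Fin (i + 1) => a x) - (fun _ => b x) = fun _ => (a x - b x) := rfl
    rw [e2, e1, e1, e1, Real.norm_of_nonneg (by positivity)]
    simp [mul_assoc]
  have h2 : (fun x => max ‖a x‖ ‖b x‖) =O[𝓝 0] fun x => ‖x‖ := by
    have : (fun x => max ‖a x‖ ‖b x‖) =O[𝓝 0] fun x => ‖a x‖ + ‖b x‖ := by
      refine IsBigO.of_bound 1 (Eventually.of_forall fun x => ?_)
      rw [Real.norm_of_nonneg (by positivity), Real.norm_of_nonneg (by positivity), one_mul]
      exact max_le_add_of_nonneg (norm_nonneg _) (norm_nonneg _)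
    exact this.trans (ha.norm_left.add hb.norm_left)
  refine h1.trans_isLittleO ?_
  simp_rw [pow_succ]
  exact (h2.pow i).mul_isLittleO hab.norm_left

/-- A map with vanishing differential is Lipschitz with small constants. -/
lemma sub_isLittleO_of_fderiv_eq_zero {u : X → N} (hu : ContDiffAt ℝ ∞ u 0)
    (hu' : fderiv ℝ u 0 = 0) {k : ℕ} {a b : X → X} (ha : a =O[𝓝 0] fun x => ‖x‖)
    (hb : b =O[𝓝 0] fun x => ‖x‖) (hab : (fun x => a x - b x) =o[𝓝 0] fun x => ‖x‖ ^ k) :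
    (fun x => u (a x) - u (b x)) =o[𝓝 0] fun x => ‖x‖ ^ (k + 1) := by
  have h1 : ContDiffAt ℝ 1 (fderiv ℝ u) 0 := hu.fderiv_right (m := 1) (by norm_num; exact WithTop.coe_le_coe.2 le_top)
  have h2 : fderiv ℝ u =O[𝓝 0] fun x => ‖x‖ := by
    have := (h1.differentiableAt (by simp)).isBigO_sub
    simpa [hu'] using this.norm_right
  obtain ⟨C, hC, h3⟩ := h2.exists_pos
  have h4 : ∀ᶠ y in 𝓝 (0 : X), DifferentiableAt ℝ u y := by
    filter_upwards [(hu.of_le (m := 1) (by exact_mod_cast le_top)).eventually (by simp)] with y hy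
    exact hy.differentiableAt (by simp)
  obtain ⟨ε, hε, h5⟩ := Metric.eventually_nhds_iff_ball.1 (h3.bound.and h4)
  obtain ⟨A, hA, ha'⟩ := ha.exists_pos
  obtain ⟨B, hB, hb'⟩ := hb.exists_pos
  have h6 : ∀ᶠ x in 𝓝 (0 : X), (A + B) * ‖x‖ < ε := by
    have : Tendsto (fun x : X => (A + B) * ‖x‖) (𝓝 0) (𝓝 ((A + B) * ‖(0 : X)‖)) :=
      (continuous_const.mul continuous_norm).tendsto 0
    exact this.eventually_lt_const (by simpa using hε)
  have h7 : (fun x => u (a x) - u (b x)) =O[𝓝 0] fun x => ‖x‖ * ‖a x - b x‖ := by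
    refine IsBigO.of_bound (C * (A + B)) ?_
    filter_upwards [h6, ha'.bound, hb'.bound] with x hx hxa hxb
    rw [norm_norm] at hxa hxb
    have hs : ∀ y ∈ Metric.closedBall (0 : X) ((A + B) * ‖x‖), y ∈ Metric.ball (0 : X) ε :=
      fun y hy => Metric.closedBall_subset_ball hx hy
    have := (convex_closedBall (0 : X) ((A + B) * ‖x‖)).norm_image_sub_le_of_norm_fderiv_le
      (𝕜 := ℝ) (f := u) (C := C * ((A + B) * ‖x‖)) (fun y hy => (h5 y (hs y hy)).2)
      (fun y hy => by
        have h8 := (h5 y (hs y hy)).1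
        rw [norm_norm] at h8
        rw [mem_closedBall_zero_iff] at hy
        exact h8.trans (by gcongr))
      (x := b x) (y := a x)
      (by rw [mem_closedBall_zero_iff]; nlinarith [norm_nonneg x])
      (by rw [mem_closedBall_zero_iff]; nlinarith [norm_nonneg x])
    refine this.trans (le_of_eq ?_)
    rw [Real.norm_of_nonneg (by positivity)]
    ring
  refine h7.trans_isLittleO ?_
  simp_rw [pow_succ']
  exact (isBigO_refl _ _).mul_isLittleO hab.norm_left

lemma isLittleO_of_comp_sub {c : X → V} (hc : ContDiffAt ℝ ∞ c 0)
    (hi : Injective (fderiv ℝ c 0)) {k : ℕ} {a b : X → X} (ha : Tendsto a (𝓝 0) (𝓝 0))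
    (hb : Tendsto b (𝓝 0) (𝓝 0))
    (hab : (fun x => c (a x) - c (b x)) =o[𝓝 0] fun x => ‖x‖ ^ k) :
    (fun x => a x - b x) =o[𝓝 0] fun x => ‖x‖ ^ k := by
  have hs : HasStrictFDerivAt c (fderiv ℝ c 0) 0 := hc.hasStrictFDerivAt (by simp)
  obtain ⟨K, -, hK⟩ := LinearMap.exists_antilipschitzWith (fderiv ℝ c 0 : X →ₗ[ℝ] V)
    (LinearMap.ker_eq_bot.2 hi)
  have h0 : (fun p : X × X => p.1 - p.2) =O[𝓝 (0, 0)] fun p => fderiv ℝ c 0 (p.1 - p.2) := by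
    refine IsBigO.of_bound K (Eventually.of_forall fun p => ?_)
    have := hK.le_mul_dist (p.1 - p.2) 0
    rwa [map_zero, dist_zero_right, dist_zero_right] at this
  have h1 : (fun p : X × X => p.1 - p.2) =O[𝓝 (0, 0)] fun p => c p.1 - c p.2 :=
    h0.trans (((hs.isLittleO.trans_isBigO h0).right_isBigO_add).congr_right fun p => by simp)
  have h2 : Tendsto (fun x => (a x, b x)) (𝓝 0) (𝓝 ((0 : X), (0 : X))) := ha.prodMk_nhds hb
  exact (h1.comp_tendsto h2).trans_isLittleO hab

lemma mkQ_sub_isLittleO {R : Submodule ℝ V} {c : X → V} (hc : ContDiffAt ℝ ∞ c 0)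
    (hi : Injective (fderiv ℝ c 0)) (hR : ∀ x, fderiv ℝ c 0 x ∈ R) {k : ℕ} {a b : X → X}
    (ha : IsGermDiffeo a) (hb : IsGermDiffeo b)
    (hab : (fun x => c (a x) - c (b x)) =o[𝓝 0] fun x => ‖x‖ ^ k) :
    (fun x => R.mkQ (c (a x) - c (b x))) =o[𝓝 0] fun x => ‖x‖ ^ (k + 1) := by
  have h1 := isLittleO_of_comp_sub hc hi ha.tendsto hb.tendsto hab
  let q : V →L[ℝ] V ⧸ R := LinearMap.toContinuousLinearMap R.mkQ
  have hu : ContDiffAt ℝ ∞ (fun y => q (c y)) 0 := q.contDiff.contDiffAt.comp 0 hc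
  have hu' : fderiv ℝ (fun y => q (c y)) 0 = 0 := by
    have := (q.hasFDerivAt.comp (0 : X) (hc.differentiableAt (by simp)).hasFDerivAt).fderiv
    rw [show (fun y => q (c y)) = q ∘ c from rfl, this]
    ext x
    simp [q, hR x]
  have h3 := sub_isLittleO_of_fderiv_eq_zero hu hu' ha.isBigO_norm
    hb.isBigO_norm h1
  exact h3.congr_left fun x => by simp [q]

lemma fderiv_eq_of_isLittleO {c c' : X → V} {φ : X → X} (hc : DifferentiableAt ℝ c 0)
    (hc' : DifferentiableAt ℝ c' 0) (hφ : IsGermDiffeo φ) (h0 : c 0 = c' 0) {k : ℕ} (hk : 1 ≤ k)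
    (h : (fun x => c (φ x) - c' x) =o[𝓝 0] fun x => ‖x‖ ^ k) :
    (fderiv ℝ c 0).comp (fderiv ℝ φ 0) = fderiv ℝ c' 0 := by
  have h' := h.trans_isBigO (norm_pow_isBigO hk)
  simp only [pow_one] at h'
  have h1 : HasFDerivAt (fun x => c (φ x)) ((fderiv ℝ c 0).comp (fderiv ℝ φ 0)) 0 := by
    have := hc.hasFDerivAt
    rw [← hφ.2.1] at this
    have := this.comp 0 hφ.differentiableAt.hasFDerivAt
    rwa [hφ.2.1] at this
  have h2 := h1.sub hc'.hasFDerivAt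
  have h3 : HasFDerivAt (fun x => c (φ x) - c' x) (0 : X →L[ℝ] V) 0 := by
    rw [hasFDerivAt_iff_isLittleO_nhds_zero]
    simpa [hφ.2.1, h0] using h'.of_norm_right
  exact sub_eq_zero.1 (h2.unique h3)

lemma form_isLittleO {R : Submodule ℝ V} {c c' : X → V} {φ : X → X} (hφ : IsGermDiffeo φ)
    (h : (fderiv ℝ c 0).comp (fderiv ℝ φ 0) = fderiv ℝ c' 0) {k : ℕ}
    (f : SymForm (k + 1) R (V ⧸ R)) {T T' : X →L[ℝ] R} (hT : ∀ x, (T x : V) = fderiv ℝ c 0 x)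
    (hT' : ∀ x, (T' x : V) = fderiv ℝ c' 0 x) :
    (fun x => (f.1 fun _ => T (φ x)) - f.1 fun _ => T' x) =o[𝓝 0] fun x => ‖x‖ ^ (k + 1) := by
  have hTT (x : X) : T' x = T (fderiv ℝ φ 0 x) := by
    apply Subtype.ext
    rw [hT', hT, ← h]; rfl
  have h1 : (fun x => φ x) =O[𝓝 0] fun x => ‖x‖ := hφ.isBigO_norm
  refine diagonal_sub_isLittleO f.1 (((T.isBigO_id _).comp_tendsto hφ.tendsto).trans h1)
    (T'.isBigO_id _).norm_right ?_
  have h2 := hφ.differentiableAt.hasFDerivAt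
  rw [hasFDerivAt_iff_isLittleO_nhds_zero] at h2
  simp only [zero_add, hφ.2.1, sub_zero] at h2
  refine (((T.isBigO_comp _ _).trans_isLittleO h2).norm_right).congr_left fun x => ?_
  rw [hTT, map_sub]

namespace IsTaylorDifference

variable {k : ℕ} {R : Submodule ℝ V} {c c' c'' : X → V} {f g : SymForm (k + 1) R (V ⧸ R)}

lemma symForm_ext {T : X →L[ℝ] R} (hT : Surjective T)
    (h : (fun x => (f.1 fun _ => T x) - g.1 fun _ => T x) =o[𝓝 0] fun x => ‖x‖ ^ (k + 1)) :
    f = g := by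
  rw [← sub_eq_zero]
  refine symForm_eq_zero _ fun r => ?_
  obtain ⟨x, rfl⟩ := hT r
  exact diagonal_eq_zero ((pullback T (f - g)).1) h x

lemma unique (hc : ContDiffAt ℝ ∞ c 0) (hi : Injective (fderiv ℝ c 0))
    (hR : LinearMap.range (fderiv ℝ c 0).toLinearMap = R)
    (hR' : LinearMap.range (fderiv ℝ c' 0).toLinearMap = R)
    (h : IsTaylorDifference k R c c' f) (h' : IsTaylorDifference k R c c' g) : f = g := by
  obtain ⟨φ, hφ, h1, T, hT, h2⟩ := h
  obtain ⟨φ', hφ', h1', T', hT', h2'⟩ := h'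
  obtain rfl : T = T' := by
    ext x; rw [hT, hT']
  have h3 : (fun x => c (φ x) - c (φ' x)) =o[𝓝 0] fun x => ‖x‖ ^ k :=
    (h1.sub h1').congr_left fun x => by abel
  have h4 := mkQ_sub_isLittleO (R := R) hc hi (fun x => by rw [← hR]; exact ⟨x, rfl⟩) hφ hφ' h3
  refine symForm_ext (T := T) ?_ (((h4.sub h2).add h2').congr_left fun x => ?_)
  · intro r
    obtain ⟨x, hx⟩ := hR'.symm.le r.2
    exact ⟨x, Subtype.ext ((hT x).trans hx)⟩
  · simp only [map_sub]; abel

lemma exists_of_contact (hc : ContDiffAt ℝ ∞ c 0) (hc' : ContDiffAt ℝ ∞ c' 0)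
    (hi : Injective (fderiv ℝ c' 0))
    (hR' : LinearMap.range (fderiv ℝ c' 0).toLinearMap = R) {φ : X → X} (hφ : IsGermDiffeo φ)
    (h : (fun x => c (φ x) - c' x) =o[𝓝 0] fun x => ‖x‖ ^ k) :
    ∃ f, IsTaylorDifference k R c c' f := by
  let e : X ≃L[ℝ] R := ((LinearEquiv.ofInjective (fderiv ℝ c' 0).toLinearMap hi).trans
    (LinearEquiv.ofEq _ _ hR')).toContinuousLinearEquiv
  have he (x : X) : (e x : V) = fderiv ℝ c' 0 x := rfl
  let q : V →L[ℝ] V ⧸ R := LinearMap.toContinuousLinearMap R.mkQ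
  have hcφ : ContDiffAt ℝ ∞ (fun x => c (φ x)) 0 :=
    ContDiffAt.comp (g := c) 0 (by rw [hφ.2.1]; exact hc) hφ.1
  have hG : ContDiffAt ℝ ∞ (fun x => q (c (φ x) - c' x)) 0 :=
    q.contDiff.contDiffAt.comp 0 (hcφ.sub hc')
  have := FiniteDimensional.complete ℝ (V ⧸ R)
  obtain ⟨f, hf⟩ := exists_symForm hG ((q.isBigO_comp _ _).trans_isLittleO h)
  refine ⟨pullback (e.symm : R →L[ℝ] X) f, φ, hφ, h, e, he, ?_⟩
  exact hf.congr_left fun x => by simp [pullback_apply, q]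

lemma refl (hR : LinearMap.range (fderiv ℝ c 0).toLinearMap = R) : IsTaylorDifference k R c c 0 := by
  refine ⟨fun x => x, IsGermDiffeo.id, by simp, (fderiv ℝ c 0).codRestrict R
    (fun x => by rw [← hR]; exact ⟨x, rfl⟩), fun x => rfl, by simp⟩

lemma trans (hk : 1 ≤ k) (hc' : DifferentiableAt ℝ c' 0) (hc'' : DifferentiableAt ℝ c'' 0)
    (h0 : c' 0 = c'' 0) (h : IsTaylorDifference k R c c' f) (h' : IsTaylorDifference k R c' c'' g) :
    IsTaylorDifference k R c c'' (f + g) := by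
  obtain ⟨φ, hφ, h1, T, hT, h2⟩ := h
  obtain ⟨ψ, hψ, h1', T', hT', h2'⟩ := h'
  refine ⟨fun x => φ (ψ x), hφ.comp hψ, ((hψ.isLittleO_comp h1).add h1').congr_left fun x => by abel,
    T', hT', ?_⟩
  have h3 := form_isLittleO hψ (fderiv_eq_of_isLittleO hc' hc'' hψ h0 hk h1') f hT hT'
  refine (((hψ.isLittleO_comp h2).add h2').add h3).congr_left fun x => ?_
  simp only [map_sub, Submodule.coe_add, add_apply]
  abel

lemma congr_left {c₁ : X → V} {ψ : X → X} (hψ : IsGermDiffeo ψ)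
    (hc : (fun x => c₁ (ψ x) - c x) =o[𝓝 0] fun x => ‖x‖ ^ (k + 1))
    (h : IsTaylorDifference k R c c' f) : IsTaylorDifference k R c₁ c' f := by
  obtain ⟨φ, hφ, h1, T, hT, h2⟩ := h
  have h3 := hφ.isLittleO_comp hc
  let q : V →L[ℝ] V ⧸ R := LinearMap.toContinuousLinearMap R.mkQ
  refine ⟨fun x => ψ (φ x), hψ.comp hφ, ?_, T, hT, ?_⟩
  · exact ((h3.trans_isBigO (norm_pow_isBigO k.le_succ)).add h1).congr_left fun x => by abel
  · refine (((q.isBigO_comp _ _).trans_isLittleO h3).add h2).congr_left fun x => ?_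
    simp only [q, LinearMap.coe_toContinuousLinearMap', map_sub]
    abel

lemma congr_right (hk : 1 ≤ k) (hc' : DifferentiableAt ℝ c' 0) (hc'' : DifferentiableAt ℝ c'' 0)
    (h0 : c' 0 = c'' 0) (hR : LinearMap.range (fderiv ℝ c'' 0).toLinearMap = R)
    {ψ : X → X} (hψ : IsGermDiffeo ψ)
    (hc : (fun x => c' (ψ x) - c'' x) =o[𝓝 0] fun x => ‖x‖ ^ (k + 1))
    (h : IsTaylorDifference k R c c' f) : IsTaylorDifference k R c c'' f := by
  have h1 : IsTaylorDifference k R c' c'' 0 := congr_left hψ hc (refl hR)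
  simpa using h.trans hk hc' hc'' h0 h1

lemma contact (hk : 1 ≤ k) (hc : ContDiffAt ℝ ∞ c 0) (hi : Injective (fderiv ℝ c 0))
    (hR : LinearMap.range (fderiv ℝ c 0).toLinearMap = R)
    (hc' : ContDiffAt ℝ ∞ c' 0) (h0 : c 0 = c' 0) (h : IsTaylorDifference k R c c' 0) :
    ∃ φ, IsGermDiffeo φ ∧ (fun x => c (φ x) - c' x) =o[𝓝 0] fun x => ‖x‖ ^ (k + 1) := by
  obtain ⟨φ, hφ, h1, T, hT, h2⟩ := h
  have h2' : (fun x => R.mkQ (c (φ x) - c' x)) =o[𝓝 0] fun x => ‖x‖ ^ (k + 1) :=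
    h2.congr_left fun x => by simp
  have hd := fderiv_eq_of_isLittleO (hc.differentiableAt (by simp))
    (hc'.differentiableAt (by simp)) hφ h0 hk h1
  obtain ⟨P0, hP0⟩ := LinearMap.exists_leftInverse_of_injective (fderiv ℝ c 0).toLinearMap
    (LinearMap.ker_eq_bot.2 hi)
  let P : V →L[ℝ] X := LinearMap.toContinuousLinearMap P0
  have hP (x : X) : P (fderiv ℝ c 0 x) = x := LinearMap.congr_fun hP0 x
  have deriv_comp {d : X → V} (hd : ContDiffAt ℝ ∞ d 0) :
      ContDiffAt ℝ ∞ (fun x => P (d x) - P (d 0)) 0 ∧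
      fderiv ℝ (fun x => P (d x) - P (d 0)) 0 = P.comp (fderiv ℝ d 0) := by
    refine ⟨(P.contDiff.contDiffAt.comp 0 hd).sub contDiffAt_const, ?_⟩
    exact ((P.hasFDerivAt.comp (0 : X) (hd.differentiableAt (by simp)).hasFDerivAt).sub_const
      _).fderiv
  have hu : IsGermDiffeo fun x => P (c x) - P (c 0) := by
    refine ⟨(deriv_comp hc).1, by simp, ?_⟩
    rw [(deriv_comp hc).2]
    have : P.comp (fderiv ℝ c 0) = ContinuousLinearMap.id ℝ X := by ext x; exact hP x
    rw [this]
    exact bijective_id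
  have hu' : IsGermDiffeo fun x => P (c' x) - P (c' 0) := by
    refine ⟨(deriv_comp hc').1, by simp, ?_⟩
    rw [(deriv_comp hc').2, ← hd]
    have : P.comp ((fderiv ℝ c 0).comp (fderiv ℝ φ 0)) = fderiv ℝ φ 0 := by ext x; exact hP _
    rw [this]
    exact hφ.2.2
  obtain ⟨ψ, hψ, hinv, -⟩ := hu.exists_inverse
  refine ⟨_, hψ.comp hu', ?_⟩
  set χ := fun x => ψ (P (c' x) - P (c' 0)) with hχ
  have hχg : IsGermDiffeo χ := hψ.comp hu'
  have e1 : ∀ᶠ x in 𝓝 (0 : X), P (c (χ x) - c' x) = 0 := by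
    filter_upwards [hu'.tendsto.eventually hinv] with x hx
    rw [h0] at hx
    simpa [sub_eq_zero] using hx
  have e2 : (fun x => (P (c (φ x)) - P (c 0)) - (P (c (χ x)) - P (c 0))) =o[𝓝 0]
      fun x => ‖x‖ ^ k := by
    refine ((P.isBigO_comp _ _).trans_isLittleO h1).congr' ?_ EventuallyEq.rfl
    filter_upwards [e1] with x hx
    rw [map_sub, sub_eq_zero] at hx
    rw [map_sub, hx]; abel
  have e3 : (fun x => φ x - χ x) =o[𝓝 0] fun x => ‖x‖ ^ k :=
    isLittleO_of_comp_sub hu.1 hu.2.2.injective hφ.tendsto hχg.tendsto e2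
  have e4 : (fun x => c (φ x) - c (χ x)) =o[𝓝 0] fun x => ‖x‖ ^ k := by
    have hs : HasStrictFDerivAt c (fderiv ℝ c 0) 0 := hc.hasStrictFDerivAt (by simp)
    have h2 : Tendsto (fun x => (φ x, χ x)) (𝓝 0) (𝓝 ((0 : X), (0 : X))) :=
      hφ.tendsto.prodMk_nhds hχg.tendsto
    exact (hs.isBigO_sub.comp_tendsto h2).trans_isLittleO e3
  have e5 := mkQ_sub_isLittleO (R := R) hc hi (fun x => by rw [← hR]; exact ⟨x, rfl⟩) hφ hχg e4
  have e6 : (fun x => R.mkQ (c (χ x) - c' x)) =o[𝓝 0] fun x => ‖x‖ ^ (k + 1) :=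
    (h2'.sub e5).congr_left fun x => by simp only [map_sub]; abel
  let q : V →L[ℝ] V ⧸ R := LinearMap.toContinuousLinearMap R.mkQ
  have hinj : Injective (P.prod q) := by
    rw [injective_iff_map_eq_zero]
    intro v hv
    have hv1 : P v = 0 := congrArg Prod.fst hv
    have hv2 : q v = 0 := congrArg Prod.snd hv
    have hv3 : v ∈ R := (Submodule.Quotient.mk_eq_zero R).1 hv2
    rw [← hR] at hv3
    obtain ⟨x, rfl⟩ := hv3
    have : x = 0 := (hP x).symm.trans hv1
    simp [this]
  obtain ⟨K, -, hK⟩ := LinearMap.exists_antilipschitzWith (P.prod q : V →ₗ[ℝ] X × (V ⧸ R))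
    (LinearMap.ker_eq_bot.2 hinj)
  have e7 : (fun x => (P (c (χ x) - c' x), q (c (χ x) - c' x))) =o[𝓝 0] fun x => ‖x‖ ^ (k + 1) := by
    refine IsLittleO.prod_left ?_ e6
    refine (isLittleO_zero _ _).congr' ?_ EventuallyEq.rfl
    filter_upwards [e1] with x hx
    rw [hx]
  refine IsBigO.trans_isLittleO (IsBigO.of_bound K (Eventually.of_forall fun x => ?_)) e7
  have := hK.le_mul_dist (c (χ x) - c' x) 0
  rw [map_zero, dist_zero_right, dist_zero_right] at this
  exact this

end IsTaylorDifference

end TaylorDifference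
section Jets

variable (n m : ℕ) (E : Type*) [TopologicalSpace E]
  [ChartedSpace (EuclideanSpace ℝ (Fin (n + m))) E]

/-- A germ of an `n`-dimensional submanifold of the `(n+m)`-dimensional manifold `E`, given by an
immersion near the origin of `ℝ^n`; only the behaviour near the origin matters. -/
structure SubmanifoldGerm where
  toFun : EuclideanSpace ℝ (Fin n) → E
  smooth : ContMDiffAt (𝓡 n) (𝓡 (n + m)) ∞ toFun 0
  immersive : Injective (mfderiv (𝓡 n) (𝓡 (n + m)) toFun 0)

variable {n m E}

namespace SubmanifoldGerm

/-- The immersion in the preferred chart of `E` at its base point. -/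
def coord (γ : SubmanifoldGerm n m E) (x : EuclideanSpace ℝ (Fin n)) :
    EuclideanSpace ℝ (Fin (n + m)) :=
  extChartAt (𝓡 (n + m)) (γ.toFun 0) (γ.toFun x)

/-- The tangent space of the submanifold at its base point. The tangent space of `E` at that
point is, by definition, the model space of `E`. -/
def tangent (γ : SubmanifoldGerm n m E) : Submodule ℝ (EuclideanSpace ℝ (Fin (n + m))) :=
  LinearMap.range (mfderiv (𝓡 n) (𝓡 (n + m)) γ.toFun 0).toLinearMap

/-- Two germs of submanifolds have contact of order `r` if they have the same base point and, after
a reparametrization, they agree there up to order `r`. -/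
def Contact (r : ℕ) (γ γ' : SubmanifoldGerm n m E) : Prop :=
  γ.toFun 0 = γ'.toFun 0 ∧
    ∃ φ : EuclideanSpace ℝ (Fin n) → EuclideanSpace ℝ (Fin n), IsGermDiffeo φ ∧
      (fun x => γ.coord (φ x) - γ'.coord x) =o[𝓝 0] fun x => ‖x‖ ^ r

lemma contDiffAt_coord (γ : SubmanifoldGerm n m E) : ContDiffAt ℝ ∞ γ.coord 0 := by
  have h := (contMDiffAt_iff.1 γ.smooth).2
  simp only [extChartAt_model_space_eq_id, modelWithCornersSelf_coe, range_id,
    contDiffWithinAt_univ] at h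
  exact h

lemma mfderiv_eq (γ : SubmanifoldGerm n m E) :
    mfderiv (𝓡 n) (𝓡 (n + m)) γ.toFun 0 = fderiv ℝ γ.coord 0 := by
  rw [(γ.smooth.mdifferentiableAt (by simp)).mfderiv]
  simp only [writtenInExtChartAt, extChartAt_model_space_eq_id, modelWithCornersSelf_coe, range_id,
    fderivWithin_univ]
  rfl

lemma tangent_eq (γ : SubmanifoldGerm n m E) :
    γ.tangent = LinearMap.range (fderiv ℝ γ.coord 0).toLinearMap := by
  rw [tangent, mfderiv_eq]; rfl

lemma differentiableAt_coord (γ : SubmanifoldGerm n m E) : DifferentiableAt ℝ γ.coord 0 :=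
  γ.contDiffAt_coord.differentiableAt (by simp)

lemma fderiv_injective (γ : SubmanifoldGerm n m E) : Injective (fderiv ℝ γ.coord 0) := by
  rw [← mfderiv_eq]; exact γ.immersive

lemma coord_zero_eq {γ γ' : SubmanifoldGerm n m E} (h : γ.toFun 0 = γ'.toFun 0) :
    γ.coord 0 = γ'.coord 0 := by simp [coord, h]

lemma contact_refl (r : ℕ) (γ : SubmanifoldGerm n m E) : Contact r γ γ :=
  ⟨rfl, fun x => x, IsGermDiffeo.id, by simp⟩

lemma contact_symm {r : ℕ} {γ γ' : SubmanifoldGerm n m E} (h : Contact r γ γ') :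
    Contact r γ' γ := by
  obtain ⟨h0, φ, hφ, h⟩ := h
  obtain ⟨ψ, hψ, h1, -⟩ := hφ.exists_inverse
  refine ⟨h0.symm, ψ, hψ, ?_⟩
  have h2 := (hψ.isLittleO_comp h).neg_left
  refine h2.congr' ?_ EventuallyEq.rfl
  filter_upwards [h1] with x hx
  simp [hx]

lemma contact_trans {r : ℕ} {γ γ' γ'' : SubmanifoldGerm n m E} (h : Contact r γ γ')
    (h' : Contact r γ' γ'') : Contact r γ γ'' := by
  obtain ⟨h0, φ, hφ, h⟩ := h
  obtain ⟨h0', ψ, hψ, h'⟩ := h'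
  refine ⟨h0.trans h0', fun x => φ (ψ x), hφ.comp hψ, ?_⟩
  exact ((hψ.isLittleO_comp h).add h').congr_left fun x => by abel

lemma Contact.mono {r s : ℕ} (hrs : r ≤ s) {γ γ' : SubmanifoldGerm n m E} (h : Contact s γ γ') :
    Contact r γ γ' := by
  obtain ⟨h0, φ, hφ, h⟩ := h
  exact ⟨h0, φ, hφ, h.trans_isBigO (norm_pow_isBigO hrs)⟩

lemma Contact.tangent_eq {r : ℕ} (hr : 1 ≤ r) {γ γ' : SubmanifoldGerm n m E}
    (h : Contact r γ γ') : γ.tangent = γ'.tangent := by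
  obtain ⟨h0, φ, hφ, h⟩ := h.mono hr
  simp only [pow_one] at h
  have h1 : HasFDerivAt (fun x => γ.coord (φ x)) ((fderiv ℝ γ.coord 0).comp (fderiv ℝ φ 0)) 0 := by
    have := γ.differentiableAt_coord.hasFDerivAt
    rw [← hφ.2.1] at this
    have := this.comp 0 hφ.differentiableAt.hasFDerivAt
    rwa [hφ.2.1] at this
  have h2 := h1.sub γ'.differentiableAt_coord.hasFDerivAt
  have h3 : HasFDerivAt (fun x => γ.coord (φ x) - γ'.coord x)
      (0 : EuclideanSpace ℝ (Fin n) →L[ℝ] EuclideanSpace ℝ (Fin (n + m))) 0 := by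
    rw [hasFDerivAt_iff_isLittleO_nhds_zero]
    simpa [hφ.2.1, coord_zero_eq h0] using h.of_norm_right
  have h4 := sub_eq_zero.1 (h2.unique h3)
  rw [SubmanifoldGerm.tangent_eq, SubmanifoldGerm.tangent_eq, ← h4]
  ext v
  constructor
  · rintro ⟨x, rfl⟩
    obtain ⟨y, rfl⟩ := hφ.2.2.surjective x
    exact ⟨y, rfl⟩
  · rintro ⟨y, rfl⟩
    exact ⟨fderiv ℝ φ 0 y, rfl⟩

end SubmanifoldGerm

variable (n m E) in
/-- Contact of order `r` as an equivalence relation. -/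
def contactSetoid (r : ℕ) : Setoid (SubmanifoldGerm n m E) where
  r := SubmanifoldGerm.Contact r
  iseqv := ⟨SubmanifoldGerm.contact_refl r, SubmanifoldGerm.contact_symm,
    SubmanifoldGerm.contact_trans⟩

variable (n m E) in
/-- The space `J^r(E, n)` of `r`-jets of `n`-dimensional submanifolds of `E`. -/
def Jet (r : ℕ) : Type _ := Quotient (contactSetoid n m E r)

namespace Jet

/-- The `r`-jet of a submanifold. -/
def mk (r : ℕ) (γ : SubmanifoldGerm n m E) : Jet n m E r := Quotient.mk (contactSetoid n m E r) γ

lemma mk_eq_iff {r : ℕ} {γ γ' : SubmanifoldGerm n m E} : mk r γ = mk r γ' ↔ γ.Contact r γ' :=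
  Quotient.eq (r := contactSetoid n m E r)

lemma mk_surjective (r : ℕ) (θ : Jet n m E r) : ∃ γ, mk r γ = θ := Quotient.exists_rep θ

/-- The projection `J^(r+1) → J^r`. -/
def restrict {r : ℕ} : Jet n m E (r + 1) → Jet n m E r :=
  Quotient.lift (mk r) fun _ _ h => mk_eq_iff.2 (SubmanifoldGerm.Contact.mono r.le_succ h)

variable {k : ℕ} [NeZero k]

/-- The plane `R ⊆ T_{θ₀}E` of a `k`-jet `θ` with `k ≥ 1`: the common tangent plane of the
submanifolds with jet `θ`. -/
def tangentPlane : Jet n m E k → Submodule ℝ (EuclideanSpace ℝ (Fin (n + m))) :=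
  Quotient.lift SubmanifoldGerm.tangent fun _ _ h => h.tangent_eq (NeZero.one_le)

/-- The normal space `N = T_{θ₀}E / R`. -/
abbrev NormalSpace (θ : Jet n m E k) : Type :=
  EuclideanSpace ℝ (Fin (n + m)) ⧸ θ.tangentPlane

/-- The fibre `J^{k+1}_θ` of `J^(k+1) → J^k` over `θ`. -/
def Fiber (θ : Jet n m E k) : Type _ := {θ' : Jet n m E (k + 1) // θ'.restrict = θ}

/-- The vector space `S^{k+1} R* ⊗ N`. -/
abbrev Form (θ : Jet n m E k) : Type :=
  SymForm (k + 1) θ.tangentPlane θ.NormalSpace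

variable {θ : Jet n m E k}

/-- The submanifold `γ` has the `(k+1)`-jet `x`. -/
def Fiber.Represents (γ : SubmanifoldGerm n m E) (x : Fiber θ) : Prop := mk (k + 1) γ = x.1

/-- The jet `x` arises from `y` by adding the homogeneous Taylor term `f` of order `k + 1`. -/
def Fiber.IsDifference (x y : Fiber θ) (f : Form θ) : Prop :=
  ∃ γ γ' : SubmanifoldGerm n m E, Represents γ x ∧ Represents γ' y ∧
    IsTaylorDifference k θ.tangentPlane γ.coord γ'.coord f

namespace Fiber

lemma exists_represents (x : Fiber θ) : ∃ γ, Represents γ x := mk_surjective _ x.1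

lemma Represents.mk_eq {γ : SubmanifoldGerm n m E} {x : Fiber θ} (h : Represents γ x) :
    mk k γ = θ := by
  rw [← x.2, ← h]; rfl

lemma Represents.range {γ : SubmanifoldGerm n m E} {x : Fiber θ} (h : Represents γ x) :
    LinearMap.range (fderiv ℝ γ.coord 0).toLinearMap = θ.tangentPlane := by
  rw [← γ.tangent_eq]
  have := h.mk_eq
  subst this
  rfl

lemma Represents.contact {γ γ' : SubmanifoldGerm n m E} {x : Fiber θ} (h : Represents γ x)
    (h' : Represents γ' x) : γ.Contact (k + 1) γ' := mk_eq_iff.1 (Eq.trans h h'.symm)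

lemma Represents.contact' {γ γ' : SubmanifoldGerm n m E} {x y : Fiber θ} (h : Represents γ x)
    (h' : Represents γ' y) : γ.Contact k γ' := mk_eq_iff.1 (h.mk_eq.trans h'.mk_eq.symm)

lemma Represents.coord_zero {γ γ' : SubmanifoldGerm n m E} {x y : Fiber θ} (h : Represents γ x)
    (h' : Represents γ' y) : γ.coord 0 = γ'.coord 0 :=
  SubmanifoldGerm.coord_zero_eq (h.contact' h').1

variable {x y z : Fiber θ} {f g : Form θ}

lemma IsDifference.taylor (h : IsDifference x y f) {γ γ' : SubmanifoldGerm n m E}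
    (hγ : Represents γ x) (hγ' : Represents γ' y) :
    IsTaylorDifference k θ.tangentPlane γ.coord γ'.coord f := by
  obtain ⟨γ₁, γ₁', h1, h1', h⟩ := h
  obtain ⟨-, φ, hφ, h2⟩ := hγ.contact h1
  obtain ⟨-, ψ, hψ, h3⟩ := h1'.contact hγ'
  exact (h.congr_left hφ h2).congr_right NeZero.one_le γ₁'.differentiableAt_coord
    γ'.differentiableAt_coord (h1'.coord_zero hγ') hγ'.range hψ h3

lemma IsDifference.unique (h : IsDifference x y f) (h' : IsDifference x y g) : f = g := by
  obtain ⟨γ, hγ⟩ := x.exists_represents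
  obtain ⟨γ', hγ'⟩ := y.exists_represents
  exact (h.taylor hγ hγ').unique γ.contDiffAt_coord γ.fderiv_injective hγ.range hγ'.range
    (h'.taylor hγ hγ')

lemma exists_isDifference (x y : Fiber θ) : ∃ f, IsDifference x y f := by
  obtain ⟨γ, hγ⟩ := x.exists_represents
  obtain ⟨γ', hγ'⟩ := y.exists_represents
  obtain ⟨-, φ, hφ, h⟩ := hγ.contact' hγ'
  obtain ⟨f, hf⟩ := IsTaylorDifference.exists_of_contact γ.contDiffAt_coord γ'.contDiffAt_coord
    γ'.fderiv_injective hγ'.range hφ h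
  exact ⟨f, γ, γ', hγ, hγ', hf⟩

lemma IsDifference.trans (h : IsDifference x y f) (h' : IsDifference y z g) :
    IsDifference x z (f + g) := by
  obtain ⟨γ, hγ⟩ := x.exists_represents
  obtain ⟨γ', hγ'⟩ := y.exists_represents
  obtain ⟨γ'', hγ''⟩ := z.exists_represents
  exact ⟨γ, γ'', hγ, hγ'', (h.taylor hγ hγ').trans NeZero.one_le γ'.differentiableAt_coord
    γ''.differentiableAt_coord (hγ'.coord_zero hγ'') (h'.taylor hγ' hγ'')⟩

lemma isDifference_refl (x : Fiber θ) : IsDifference x x 0 := by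
  obtain ⟨γ, hγ⟩ := x.exists_represents
  exact ⟨γ, γ, hγ, hγ, IsTaylorDifference.refl hγ.range⟩

lemma IsDifference.symm (h : IsDifference x y f) : IsDifference y x (-f) := by
  obtain ⟨g, hg⟩ := exists_isDifference y x
  have := (h.trans hg).unique (isDifference_refl x)
  rwa [← eq_neg_of_add_eq_zero_right this]

lemma IsDifference.eq (h : IsDifference x y 0) : x = y := by
  obtain ⟨γ, hγ⟩ := x.exists_represents
  obtain ⟨γ', hγ'⟩ := y.exists_represents
  obtain ⟨φ, hφ, h'⟩ := (h.taylor hγ hγ').contact NeZero.one_le γ.contDiffAt_coord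
    γ.fderiv_injective hγ.range γ'.contDiffAt_coord (hγ.coord_zero hγ')
  refine Subtype.ext ?_
  rw [← show mk _ γ = x.1 from hγ, ← show mk _ γ' = y.1 from hγ', mk_eq_iff]
  exact ⟨(hγ.contact' hγ').1, φ, hφ, h'⟩

variable [IsManifold (𝓡 (n + m)) ∞ E]

lemma exists_translate (f : Form θ) (y : Fiber θ) : ∃ x, IsDifference x y f := by
  obtain ⟨γ, hγ⟩ := y.exists_represents
  set V := EuclideanSpace ℝ (Fin (n + m))
  set X := EuclideanSpace ℝ (Fin n)
  let e := extChartAt (𝓡 (n + m)) (γ.toFun 0)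
  obtain ⟨s0, hs0⟩ := LinearMap.exists_rightInverse_of_surjective θ.tangentPlane.mkQ
    (Submodule.range_mkQ _)
  let s : θ.NormalSpace →L[ℝ] V := LinearMap.toContinuousLinearMap s0
  have hs (w : θ.NormalSpace) : θ.tangentPlane.mkQ (s w) = w := LinearMap.congr_fun hs0 w
  let T : X →L[ℝ] θ.tangentPlane := (fderiv ℝ γ.coord 0).codRestrict θ.tangentPlane
    fun x => by rw [← hγ.range]; exact ⟨x, rfl⟩
  let d : X → V := fun x => s (f.1 fun _ => T x)
  have hd : ContDiff ℝ ∞ d := by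
    have : ContDiff ℝ ∞ fun r : θ.tangentPlane => f.1 fun _ => r :=
      f.1.contDiff.comp (contDiff_pi.2 fun _ => contDiff_id)
    exact s.contDiff.comp (this.comp T.contDiff)
  have hdO : d =O[𝓝 0] fun x => ‖x‖ ^ (k + 1) := by
    refine (s.isBigO_comp _ _).trans ?_
    refine IsBigO.of_bound (‖f.1‖ * ‖T‖ ^ (k + 1)) (Eventually.of_forall fun x => ?_)
    refine (f.1.le_opNorm _).trans ?_
    simp only [Finset.prod_const, Finset.card_univ, Fintype.card_fin, norm_pow, norm_norm]
    rw [mul_assoc, ← mul_pow]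
    gcongr
    exact T.le_opNorm x
  have hdo : d =o[𝓝 0] fun x => ‖x‖ ^ k :=
    hdO.trans_isLittleO (isLittleO_norm_pow_norm_pow k.lt_succ_self)
  have hd0 : d 0 = 0 := by
    have h1 : (f.1 fun _ => T 0) = 0 := f.1.map_coord_zero 0 (map_zero T)
    change s (f.1 fun _ => T 0) = 0
    rw [h1, map_zero]
  have hdd : HasFDerivAt d (0 : X →L[ℝ] V) 0 := by
    rw [hasFDerivAt_iff_isLittleO_nhds_zero]
    have h1 : (fun x : X => ‖x‖ ^ k) =O[𝓝 0] fun x => ‖x‖ ^ 1 := norm_pow_isBigO NeZero.one_le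
    have := hdo.trans_isBigO h1
    simp only [pow_one] at this
    simpa [hd0] using this.of_norm_right
  let c : X → V := fun x => γ.coord x + d x
  have hc : ContDiffAt ℝ ∞ c 0 := γ.contDiffAt_coord.add hd.contDiffAt
  have hc' : fderiv ℝ c 0 = fderiv ℝ γ.coord 0 := by
    have := (γ.differentiableAt_coord.hasFDerivAt.add hdd).fderiv
    rwa [add_zero] at this
  have hc0 : c 0 = e (γ.toFun 0) := by simp [c, hd0, SubmanifoldGerm.coord, e]
  have ht : e.target ∈ 𝓝 (c 0) := by rw [hc0]; exact extChartAt_target_mem_nhds (γ.toFun 0)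
  have hbase : e.symm (c 0) = γ.toFun 0 := by rw [hc0]; exact extChartAt_to_inv (γ.toFun 0)
  have hco : (fun x => e (e.symm (c x))) =ᶠ[𝓝 0] c := by
    filter_upwards [hc.continuousAt.eventually ht] with x hx
    exact e.right_inv hx
  have hsmooth : ContMDiffAt (𝓡 n) (𝓡 (n + m)) ∞ (fun x => e.symm (c x)) 0 := by
    have h1 : ContMDiffAt (𝓡 (n + m)) (𝓡 (n + m)) ∞ e.symm (c 0) :=
      (contMDiffOn_extChartAt_symm (γ.toFun 0)).contMDiffAt ht
    exact h1.comp 0 hc.contMDiffAt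
  have hmf : mfderiv (𝓡 n) (𝓡 (n + m)) (fun x => e.symm (c x)) 0 = fderiv ℝ c 0 := by
    rw [(hsmooth.mdifferentiableAt (by simp)).mfderiv]
    simp only [writtenInExtChartAt, extChartAt_model_space_eq_id, modelWithCornersSelf_coe,
      range_id, fderivWithin_univ, hbase]
    exact hco.fderiv_eq
  let γ' : SubmanifoldGerm n m E := ⟨fun x => e.symm (c x), hsmooth, by
    rw [hmf, hc']; exact γ.fderiv_injective⟩
  have hγ' : γ'.coord =ᶠ[𝓝 0] c := by
    refine EventuallyEq.trans (Eventually.of_forall fun x => ?_) hco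
    change extChartAt (𝓡 (n + m)) (e.symm (c 0)) _ = _
    rw [hbase]
  have hdiff : (fun x => γ'.coord x - γ.coord x) =ᶠ[𝓝 0] d := by
    filter_upwards [hγ'] with x hx
    simp [hx, c]
  have hθ : (mk (k + 1) γ').restrict = θ := by
    rw [← hγ.mk_eq]
    exact mk_eq_iff.2 ⟨hbase, fun x => x, IsGermDiffeo.id, hdo.congr' hdiff.symm EventuallyEq.rfl⟩
  refine ⟨⟨mk (k + 1) γ', hθ⟩, γ', γ, rfl, hγ, fun x => x, IsGermDiffeo.id,
    hdo.congr' hdiff.symm EventuallyEq.rfl, T, fun x => rfl, ?_⟩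
  refine (isLittleO_zero _ _).congr' ?_ EventuallyEq.rfl
  filter_upwards [hdiff] with x hx
  rw [hx, hs, sub_self]

/-- `J^{k+1}_θ` is an affine space over `S^{k+1} R* ⊗ N`; the difference of two jets is the
difference of their Taylor terms of order `k + 1`. -/
instance : AddTorsor (Form θ) (Fiber θ) where
  vadd f y := (exists_translate f y).choose
  vsub x y := (exists_isDifference x y).choose
  zero_vadd y := (exists_translate 0 y).choose_spec.eq
  add_vadd f g y := by
    have h1 := (exists_translate (f + g) y).choose_spec
    have h2 := (exists_translate g y).choose_spec
    have h3 := (exists_translate f (exists_translate g y).choose).choose_spec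
    have h4 := h1.trans (h3.trans h2).symm
    rw [add_neg_cancel] at h4
    exact h4.eq
  nonempty := by
    obtain ⟨γ, hγ⟩ := mk_surjective k θ
    exact ⟨⟨mk (k + 1) γ, hγ⟩⟩
  vsub_vadd' x y := by
    have h1 := (exists_isDifference x y).choose_spec
    have h2 := (exists_translate (exists_isDifference x y).choose y).choose_spec
    have h3 := h2.trans h1.symm
    rw [add_neg_cancel] at h3
    exact h3.eq
  vadd_vsub' f x :=
    (exists_isDifference _ x).choose_spec.unique (exists_translate f x).choose_spec

lemma isDifference_vsub (x y : Fiber θ) : IsDifference x y (x -ᵥ y) :=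
  (exists_isDifference x y).choose_spec

instance : TopologicalSpace (Fiber θ) := (torsorAtlas _ _ _ (Fiber θ)).topologicalSpace
instance : ChartedSpace (Form θ) (Fiber θ) := (torsorAtlas _ _ _ (Fiber θ)).chartedSpace
instance : IsManifold 𝓘(ℝ, Form θ) ∞ (Fiber θ) := (torsorAtlas _ _ _ (Fiber θ)).isManifold

end Fiber
end Jet

end Jets

section Distributions

variable {H M : Type*} [NormedAddCommGroup H] [NormedSpace ℝ H] [TopologicalSpace M]
  [ChartedSpace H M] [IsManifold 𝓘(ℝ, H) 1 M]
  {B M₂ : Type*} {HB H₂ : Type*} [NormedAddCommGroup HB] [NormedSpace ℝ HB] [TopologicalSpace B]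
  [ChartedSpace HB B] [NormedAddCommGroup H₂] [NormedSpace ℝ H₂] [TopologicalSpace M₂]
  [ChartedSpace H₂ M₂]

variable (H M) in
/-- A field of tangent planes. -/
abbrev Distribution : Type _ := (x : M) → Submodule ℝ (TangentSpace 𝓘(ℝ, H) x)

/-- The vector field `X` is smooth at `x` and lies in `D` near `x`. -/
def IsLocalSection (D : Distribution H M) (x : M) (X : (y : M) → TangentSpace 𝓘(ℝ, H) y) : Prop :=
  ContMDiffAt 𝓘(ℝ, H) 𝓘(ℝ, H).tangent ∞ (fun y => (⟨y, X y⟩ : TangentBundle 𝓘(ℝ, H) M)) x ∧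
    ∀ᶠ y in 𝓝 x, X y ∈ D y

/-- `Q ⊆ D_x` is an integral element of `D`: the curvature form `D × D → TM / D` induced by the Lie
bracket of sections of `D` vanishes on `Q`. -/
def IsIntegralElement (D : Distribution H M) (x : M)
    (Q : Submodule ℝ (TangentSpace 𝓘(ℝ, H) x)) : Prop :=
  Q ≤ D x ∧ ∀ X Y : (y : M) → TangentSpace 𝓘(ℝ, H) y,
    IsLocalSection D x X → IsLocalSection D x Y → X x ∈ Q → Y x ∈ Q →
      VectorField.mlieBracket 𝓘(ℝ, H) X Y x ∈ D x

variable (HB) in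
/-- `Q` is transversal to the fibres of `π`: it meets the vertical tangent space only in `0`. -/
def IsHorizontal (π : M → B) (x : M) (Q : Submodule ℝ (TangentSpace 𝓘(ℝ, H) x)) : Prop :=
  Disjoint Q (LinearMap.ker (mfderiv 𝓘(ℝ, H) 𝓘(ℝ, HB) π x).toLinearMap)

variable (HB) in
/-- `Q` is an integral element of `D` at `x`, horizontal with respect to `π`, and of maximal
dimension among these. -/
def IsHorizontalMaximal (D : Distribution H M) (π : M → B) (x : M)
    (Q : Submodule ℝ (TangentSpace 𝓘(ℝ, H) x)) : Prop :=
  IsIntegralElement D x Q ∧ IsHorizontal HB π x Q ∧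
    ∀ Q' : Submodule ℝ (TangentSpace 𝓘(ℝ, H) x),
      IsIntegralElement D x Q' → IsHorizontal HB π x Q' → finrank ℝ Q' ≤ finrank ℝ Q

variable (H M) in
/-- A point of `M` with a tangent plane at this point. -/
abbrev Plane : Type _ := (x : M) × Submodule ℝ (TangentSpace 𝓘(ℝ, H) x)

/-- The planes `P t`, with `t ∈ ℝ^r`, form a smooth family: locally in `t` they have bases which
depend smoothly on `t`, as points of the tangent bundle. -/
def IsSmoothPlaneFamily {r : ℕ} (P : EuclideanSpace ℝ (Fin r) → Plane H M) : Prop :=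
  ∀ t₀, ∃ U ∈ 𝓝 t₀, ∃ (d : ℕ) (s : Fin d → (t : EuclideanSpace ℝ (Fin r)) →
      TangentSpace 𝓘(ℝ, H) (P t).1),
    (∀ i, ContMDiffOn (𝓡 r) 𝓘(ℝ, H).tangent ∞
      (fun t => (⟨(P t).1, s i t⟩ : TangentBundle 𝓘(ℝ, H) M)) U) ∧
    ∀ t ∈ U, LinearIndependent ℝ (fun i => s i t) ∧
      Submodule.span ℝ (range fun i => s i t) = (P t).2

variable (HB) in
/-- `(M₂, D₂)` is the prolongation of `(M, D)` with respect to the bundle `π : M → B` through the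
map `Φ`. The prolongation of `(M, D)` consists of the manifold of all `dim B`-dimensional
`π`-horizontal integral elements `S` of `D`, with the distribution that is the preimage, under the
differential of the projection to `M`, of the tautological planes `S`.
`Φ` identifies `M₂` with this manifold: it is bijective onto it (`injective`, `range_eq`) and the
smooth families of points of `M₂` are the smooth families of planes (`smooth_iff`). It identifies
`D₂` with the prolonged distribution (`lift`). -/
structure IsProlongation (D : Distribution H M) (π : M → B) (D₂ : Distribution H₂ M₂)
    (Φ : M₂ → Plane H M) : Prop where
  injective : Injective Φ
  range_eq : range Φ = {S | IsIntegralElement D S.1 S.2 ∧ IsHorizontal HB π S.1 S.2 ∧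
    finrank ℝ S.2 = finrank ℝ HB}
  smooth_iff : ∀ (r : ℕ) (g : EuclideanSpace ℝ (Fin r) → M₂),
    ContMDiff (𝓡 r) 𝓘(ℝ, H₂) ∞ g ↔
      ContMDiff (𝓡 r) 𝓘(ℝ, H) ∞ (fun t => (Φ (g t)).1) ∧ IsSmoothPlaneFamily fun t => Φ (g t)
  lift : ∀ φ, D₂ φ = (Φ φ).2.comap
    (mfderiv 𝓘(ℝ, H₂) 𝓘(ℝ, H) (fun ψ => (Φ ψ).1) φ).toLinearMap

end Distributions

section Reduction

variable {j l : ℕ} {R N : Type*} [NormedAddCommGroup R] [NormedSpace ℝ R] [FiniteDimensional ℝ R]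
  [NormedAddCommGroup N] [NormedSpace ℝ N] [FiniteDimensional ℝ N]
  {J : Type*} [AddTorsor (SymForm j R N) J] [TopologicalSpace J] [ChartedSpace (SymForm j R N) J]

/-- The vertical distribution `V^p = {0 ⊕ f : f ∈ μ_L^p}` on `Gr(R, l) × J`. The charts of the affine
space `J` are the translations, so that its tangent spaces are `S^j R* ⊗ N`. -/
def verticalDist (p : ℕ) (x : Gr l R × J) :
    Submodule ℝ (TangentSpace (𝓘(ℝ, GrModel l R).prod 𝓘(ℝ, SymForm j R N)) x) :=
  Submodule.prod (⊥ : Submodule ℝ (GrModel l R)) (vanishing p x.1.1)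

/-- The flag distribution `F^p`: the sum of `V^{p+1}` and of the vertical distribution of the
projection to `J`. -/
def flagDist (p : ℕ) (x : Gr l R × J) :
    Submodule ℝ (TangentSpace (𝓘(ℝ, GrModel l R).prod 𝓘(ℝ, SymForm j R N)) x) :=
  verticalDist (p + 1) x ⊔
    LinearMap.ker (mfderiv (𝓘(ℝ, GrModel l R).prod 𝓘(ℝ, SymForm j R N)) 𝓘(ℝ, SymForm j R N)
      (Prod.snd : Gr l R × J → J) x).toLinearMap

variable (j l R N J) in
/-- The reduction of `F^p` to the space of leaves of `V^p`: its plane at a leaf `φ` consists of the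
projections of the vectors of `F^p` at points of `φ`. -/
def reducedDist (p : ℕ) : Distribution (LeafModel j l R N p) (LeafSpace j l R N J p) := fun φ =>
  Submodule.span ℝ {v | ∃ x : Gr l R × J, ∃ w ∈ flagDist (j := j) (N := N) p x,
    (⟨leaf x, mfderiv (𝓘(ℝ, GrModel l R).prod 𝓘(ℝ, SymForm j R N)) 𝓘(ℝ, LeafModel j l R N p)
      (leaf : Gr l R × J → LeafSpace j l R N J p) x w⟩ :
        TangentBundle 𝓘(ℝ, LeafModel j l R N p) (LeafSpace j l R N J p)) = ⟨φ, v⟩}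

lemma vanishing_mono (p : ℕ) (L : Submodule ℝ R) :
    (vanishing p L : Submodule ℝ (SymForm j R N)) ≤ vanishing (p + 1) L :=
  fun _ hf v hv => hf v (p.le_succ.trans hv)

variable (j l R N J) in
/-- The projection `Π : M^q → M^{q-1}`, as every leaf of `V^p` lies in one of `V^{p+1}`. -/
def leafProj (p : ℕ) : LeafSpace j l R N J p → LeafSpace j l R N J (p + 1) :=
  Quotient.lift leaf fun _ _ h => leaf_eq_iff.2 ⟨h.1, vanishing_mono p _ h.2⟩

variable (j l R N J) in
/-- The projection of the leaf space to the Grassmannian. -/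
def toGr (p : ℕ) : LeafSpace j l R N J p → Gr l R :=
  Quotient.lift Prod.fst fun _ _ h => h.1

variable (j l R N J) in
/-- The plane `Q_φ`: the image of the reduced distribution at `φ` under the differential of `Π`. -/
def qPlane (p : ℕ) (φ : LeafSpace j l R N J p) :
    Submodule ℝ (TangentSpace 𝓘(ℝ, LeafModel j l R N (p + 1)) (leafProj j l R N J p φ)) :=
  (reducedDist j l R N J p φ).map (mfderiv 𝓘(ℝ, LeafModel j l R N p)
    𝓘(ℝ, LeafModel j l R N (p + 1)) (leafProj j l R N J p) φ).toLinearMap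

variable (j l R N J) in
/-- The map `φ ↦ Q_φ`, where the base point `Π φ` is recorded. -/
def qMap (p : ℕ) (φ : LeafSpace j l R N J p) :
    Plane (LeafModel j l R N (p + 1)) (LeafSpace j l R N J (p + 1)) :=
  ⟨leafProj j l R N J p φ, qPlane j l R N J p φ⟩

end Reduction

section Levels

variable {n m k : ℕ} [NeZero k] {E : Type*} [TopologicalSpace E]
  [ChartedSpace (EuclideanSpace ℝ (Fin (n + m))) E] [IsManifold (𝓡 (n + m)) ∞ E]

/-- The model space of the level with index `p` of the tower. -/
abbrev Jet.LevelModel (θ : Jet n m E k) (l p : ℕ) : Type :=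
  LeafModel (k + 1) l θ.tangentPlane θ.NormalSpace p

/-- The manifold `M^q` of the tower over the `k`-jet `θ`, where `p = k + 1 - q`. -/
abbrev Jet.Level (θ : Jet n m E k) (l p : ℕ) : Type _ :=
  LeafSpace (k + 1) l θ.tangentPlane θ.NormalSpace θ.Fiber p

/-- The distribution `F^{[q]}` on `M^q`, where `p = k + 1 - q`. -/
abbrev Jet.dist (θ : Jet n m E k) (l p : ℕ) : Distribution (θ.LevelModel l p) (θ.Level l p) :=
  reducedDist (k + 1) l θ.tangentPlane θ.NormalSpace θ.Fiber p

/-- The projection `M^q → M^{q-1}`, where `p = k + 1 - q`. -/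
abbrev Jet.proj (θ : Jet n m E k) (l p : ℕ) : θ.Level l p → θ.Level l (p + 1) :=
  leafProj (k + 1) l θ.tangentPlane θ.NormalSpace θ.Fiber p

/-- The projection `M^q → Gr(R, l)`, where `p = k + 1 - q`. -/
abbrev Jet.projGr (θ : Jet n m E k) (l p : ℕ) : θ.Level l p → Gr l θ.tangentPlane :=
  toGr (k + 1) l θ.tangentPlane θ.NormalSpace θ.Fiber p

/-- The plane `Q_φ` in the tangent space of `M^{q-1}` at the projection of `φ ∈ M^q`. -/
abbrev Jet.Q (θ : Jet n m E k) (l p : ℕ) (φ : θ.Level l p) :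
    Submodule ℝ (TangentSpace 𝓘(ℝ, θ.LevelModel l (p + 1)) (θ.proj l p φ)) :=
  qPlane (k + 1) l θ.tangentPlane θ.NormalSpace θ.Fiber p φ

/-- The map `φ ↦ Q_φ` from `M^q` to the planes in the tangent spaces of `M^{q-1}`. -/
abbrev Jet.QMap (θ : Jet n m E k) (l p : ℕ) (φ : θ.Level l p) :
    Plane (θ.LevelModel l (p + 1)) (θ.Level l (p + 1)) :=
  qMap (k + 1) l θ.tangentPlane θ.NormalSpace θ.Fiber p φ

end Levels

end PartialJets

end

open PartialJets

/-! Put p = k + 1 - q and j = k + 1. A frame of R gives coordinates (A, [f]) on M^q: the l-plane is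
the graph y = A x, and f, taken modulo μ^p, is the Taylor term of order j written in the coordinates
(x, y - A x), which straighten the plane. If the jet stays fixed while A moves with velocity B, then
f changes by the derivation D_B along the shear (x, y) ↦ (0, B x). This derivation maps μ^p to
μ^{p+1}. Hence in every such chart F^{[q]} is the kernel of one explicit form, `contactForm`: the
differential of f modulo μ^{p+1} minus D_{dA} f (`reducedDist_param`). The form depends only on f,
in an affine way, so that its derivative is constant.

By `isIntegralElement_map_iff`, integral elements are the subspaces of this kernel on which the
exterior derivative of the form vanishes. A vector of the kernel without A-component projects to
zero one level down, so the two notions of horizontality agree and horizontal elements have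
dimension at most dim Gr. Those of dimension dim Gr in M^{q-1} at (A, y) are the graphs of linear
maps B with B(C) = D_C y in the quotient by μ^{p+2} and with D_C B(C') = D_{C'} B(C) there. The
plane Q_φ is the graph of C ↦ D_C f (`qMap_param`), and it is integral because the derivations along
shears commute.

What remains is algebra of polynomials in (x, y). The operator D_C is the sum of C_a(x) ∂/∂y_a; it
raises the degree in x and lowers the degree in y. A class modulo μ^p which is zero modulo μ^{p+1}
is the component of bidegree (p, j - p), and for p < j it is recovered from all its derivatives D_C;
this is `LeafFiber.eq_zero_of_proj_of_deriv`, the injectivity of φ ↦ Q_φ. Conversely, a family B(C)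
satisfying the symmetry condition comes from a form (`exists_shearDeriv_sub_mem`): the condition
forces polarized values of B(C) to depend on C only through C(x), a trace divides them by a linear
factor in x, and Euler's identity in y integrates the quotient. The symmetry condition has content
only if B(C) has positive degree j - p - 1 in y, and this is where q ≥ 2 enters.

For the smooth structures, the linear map sending y to its projection and its derivatives is
injective. It therefore has a linear left inverse, and y depends smoothly on parameters as soon as
the base point and the plane do. -/

namespace PartialJets

/-! ### Parametrizations as diffeomorphisms onto open sets -/

section SmoothParam

variable {H M : Type*} [NormedAddCommGroup H] [NormedSpace ℝ H] [TopologicalSpace M]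
  [ChartedSpace H M]

/-- `P` is a diffeomorphism of the model space onto an open subset of `M`. -/
structure IsSmoothParam (P : H → M) : Prop where
  injective : Injective P
  isOpen_range : IsOpen (range P)
  smooth : ContMDiff 𝓘(ℝ, H) 𝓘(ℝ, H) ∞ P
  smooth_inv : ContMDiffOn 𝓘(ℝ, H) 𝓘(ℝ, H) ∞ (invFun P) (range P)

lemma ParamAtlas.isSmoothParam {ι M : Type*} (c : ParamAtlas ι H M) (i : ι) :
    @IsSmoothParam H M _ _ c.topologicalSpace c.chartedSpace (c.param i) := by
  let _ := c.topologicalSpace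
  let _ := c.chartedSpace
  have := c.isManifold
  let e := c.core.openPartialHomeomorph (c.chart i) (mem_range_self i)
  have he : e ∈ atlas H M := mem_iUnion₂.2 ⟨c.chart i, mem_range_self i, rfl⟩
  have he' : e ∈ IsManifold.maximalAtlas 𝓘(ℝ, H) ∞ M :=
    IsManifold.subset_maximalAtlas he
  have h1 : ContMDiffOn 𝓘(ℝ, H) 𝓘(ℝ, H) ∞ e.symm e.target := contMDiffOn_symm_of_mem_maximalAtlas he'
  have h2 : ContMDiffOn 𝓘(ℝ, H) 𝓘(ℝ, H) ∞ e e.source := contMDiffOn_of_mem_maximalAtlas he'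
  exact ⟨c.inj i, e.open_source, contMDiffOn_univ.1 h1, h2⟩

/-- With a single chart, the preferred chart at every point is the inverse of the parametrization,
so the parametrization reads as the identity in charts. This identifies the tangent spaces of an
affine space with its space of translations. -/
lemma ParamAtlas.mfderiv_param_eq {M : Type*} (c : ParamAtlas Unit H M) (h v : H) :
    let _ := c.topologicalSpace
    let _ := c.chartedSpace
    mfderiv 𝓘(ℝ, H) 𝓘(ℝ, H) (c.param ()) h v = v := by
  let _ := c.topologicalSpace
  let _ := c.chartedSpace
  have hs := (c.isSmoothParam ()).smooth
  change mfderiv 𝓘(ℝ, H) 𝓘(ℝ, H) (c.param ()) h v = v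
  have h1 : writtenInExtChartAt 𝓘(ℝ, H) 𝓘(ℝ, H) h (c.param ()) = fun x => x := by
    ext x
    exact leftInverse_invFun (c.inj ()) x
  rw [((hs h).mdifferentiableAt (by simp)).mfderiv, h1]
  simp only [modelWithCornersSelf_coe, range_id, fderivWithin_univ, fderiv_fun_id]
  rfl

namespace IsSmoothParam

variable {P : H → M} (hP : IsSmoothParam P)
include hP

lemma inv_apply (z : H) : invFun P (P z) = z := leftInverse_invFun hP.injective z

lemma apply_inv {x : M} (hx : x ∈ range P) : P (invFun P x) = x := invFun_eq hx

lemma range_mem_nhds (z : H) : range P ∈ 𝓝 (P z) := hP.isOpen_range.mem_nhds (mem_range_self z)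

lemma contMDiffAt_inv (z : H) : ContMDiffAt 𝓘(ℝ, H) 𝓘(ℝ, H) ∞ (invFun P) (P z) :=
  (hP.smooth_inv _ (mem_range_self z)).contMDiffAt (hP.range_mem_nhds z)

lemma mdifferentiableAt (z : H) : MDifferentiableAt 𝓘(ℝ, H) 𝓘(ℝ, H) P z :=
  (hP.smooth z).mdifferentiableAt (by simp)

lemma mfderiv_inv_mfderiv (z v : H) :
    mfderiv 𝓘(ℝ, H) 𝓘(ℝ, H) (invFun P) (P z) (mfderiv 𝓘(ℝ, H) 𝓘(ℝ, H) P z v) = v := by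
  have h1 := mfderiv_comp z ((hP.contMDiffAt_inv z).mdifferentiableAt (by simp))
    (hP.mdifferentiableAt z)
  have h2 : invFun P ∘ P = id := funext hP.inv_apply
  have h3 : mfderiv 𝓘(ℝ, H) 𝓘(ℝ, H) (invFun P ∘ P) z v = v := by
    rw [h2, mfderiv_id]; rfl
  rw [h1] at h3
  exact h3

lemma mfderiv_mfderiv_inv (z : H) (u : TangentSpace 𝓘(ℝ, H) (P z)) :
    mfderiv 𝓘(ℝ, H) 𝓘(ℝ, H) P z (mfderiv 𝓘(ℝ, H) 𝓘(ℝ, H) (invFun P) (P z) u) = u := by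
  have h0 : MDifferentiableAt 𝓘(ℝ, H) 𝓘(ℝ, H) P (invFun P (P z)) := hP.mdifferentiableAt _
  have h1 := mfderiv_comp (P z) h0 ((hP.contMDiffAt_inv z).mdifferentiableAt (by simp))
  have h2 : P ∘ invFun P =ᶠ[𝓝 (P z)] id := by
    filter_upwards [hP.range_mem_nhds z] with x hx using hP.apply_inv hx
  have h3 : (mfderiv 𝓘(ℝ, H) 𝓘(ℝ, H) (P ∘ invFun P) (P z) u : H) = u := by
    rw [h2.mfderiv_eq, mfderiv_id]; rfl
  rw [h1] at h3
  have h4 : (mfderiv 𝓘(ℝ, H) 𝓘(ℝ, H) P (invFun P (P z))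
    (mfderiv 𝓘(ℝ, H) 𝓘(ℝ, H) (invFun P) (P z) u) : H) = u := h3
  rw [hP.inv_apply] at h4
  exact h4

lemma isInvertible_mfderiv (z : H) : (mfderiv 𝓘(ℝ, H) 𝓘(ℝ, H) P z).IsInvertible :=
  ⟨ContinuousLinearEquiv.equivOfInverse (mfderiv 𝓘(ℝ, H) 𝓘(ℝ, H) P z)
    (mfderiv 𝓘(ℝ, H) 𝓘(ℝ, H) (invFun P) (P z)) (hP.mfderiv_inv_mfderiv z)
    (hP.mfderiv_mfderiv_inv z), rfl⟩

lemma mfderiv_injective (z : H) : Injective (mfderiv 𝓘(ℝ, H) 𝓘(ℝ, H) P z) :=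
  LeftInverse.injective (hP.mfderiv_inv_mfderiv z)

lemma mfderiv_surjective (z : H) : Surjective (mfderiv 𝓘(ℝ, H) 𝓘(ℝ, H) P z) :=
  RightInverse.surjective (hP.mfderiv_mfderiv_inv z)

lemma inverse_mfderiv_apply (z v : H) :
    (mfderiv 𝓘(ℝ, H) 𝓘(ℝ, H) P z).inverse (mfderiv 𝓘(ℝ, H) 𝓘(ℝ, H) P z v) = v := by
  obtain ⟨e, he⟩ := hP.isInvertible_mfderiv z
  rw [← he, ContinuousLinearMap.inverse_equiv]
  exact e.symm_apply_apply v

lemma mfderiv_inverse_apply (z : H) (u : TangentSpace 𝓘(ℝ, H) (P z)) :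
    mfderiv 𝓘(ℝ, H) 𝓘(ℝ, H) P z ((mfderiv 𝓘(ℝ, H) 𝓘(ℝ, H) P z).inverse u) = u := by
  obtain ⟨e, he⟩ := hP.isInvertible_mfderiv z
  rw [← he, ContinuousLinearMap.inverse_equiv]
  exact e.apply_symm_apply u

lemma isInvertible_mfderiv_inv (z : H) :
    (mfderiv 𝓘(ℝ, H) 𝓘(ℝ, H) (invFun P) (P z)).IsInvertible :=
  ⟨ContinuousLinearEquiv.equivOfInverse (mfderiv 𝓘(ℝ, H) 𝓘(ℝ, H) (invFun P) (P z))
    (mfderiv 𝓘(ℝ, H) 𝓘(ℝ, H) P z) (hP.mfderiv_mfderiv_inv z) (hP.mfderiv_inv_mfderiv z), rfl⟩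

lemma inverse_mfderiv_inv_apply (z v : H) :
    (mfderiv 𝓘(ℝ, H) 𝓘(ℝ, H) (invFun P) (P z)).inverse v = mfderiv 𝓘(ℝ, H) 𝓘(ℝ, H) P z v := by
  obtain ⟨e, he⟩ := hP.isInvertible_mfderiv_inv z
  have h1 : e (mfderiv 𝓘(ℝ, H) 𝓘(ℝ, H) P z v) = v := by
    have := hP.mfderiv_inv_mfderiv z v
    rw [← he] at this
    exact this
  rw [← he, ContinuousLinearMap.inverse_equiv]
  exact e.symm_apply_eq.2 h1.symm

end IsSmoothParam

end SmoothParam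

/-! ### Integral elements of the kernel of a vector-valued one-form -/

section Integral

variable {H M G : Type*} [NormedAddCommGroup H] [NormedSpace ℝ H] [CompleteSpace H]
  [TopologicalSpace M] [ChartedSpace H M] [IsManifold 𝓘(ℝ, H) ∞ M]
  [NormedAddCommGroup G] [NormedSpace ℝ G]

open VectorField

/-- For two vector fields annihilated by a vector-valued one-form `α`, the value of `α` at their
bracket is given by the exterior derivative of `α`. -/
lemma form_lieBracket {α : H → H →L[ℝ] G} {V W : H → H} {z : H} (hα : DifferentiableAt ℝ α z)
    (hV : DifferentiableAt ℝ V z) (hW : DifferentiableAt ℝ W z)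
    (hαV : ∀ᶠ y in 𝓝 z, α y (V y) = 0) (hαW : ∀ᶠ y in 𝓝 z, α y (W y) = 0) :
    α z (lieBracket ℝ V W z) = fderiv ℝ α z (W z) (V z) - fderiv ℝ α z (V z) (W z) := by
  -- Differentiating the identity α(U) = 0 moves the derivative from U to α.
  have key {U : H → H} (hU : DifferentiableAt ℝ U z) (h : ∀ᶠ y in 𝓝 z, α y (U y) = 0) (u : H) :
      α z (fderiv ℝ U z u) = - fderiv ℝ α z u (U z) := by
    have h1 := (hα.hasFDerivAt.clm_apply hU.hasFDerivAt).fderiv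
    have h2 : (fun y => α y (U y)) =ᶠ[𝓝 z] fun _ => 0 := h
    rw [h2.fderiv_eq] at h1
    have h3 := DFunLike.congr_fun h1 u
    simp at h3
    exact eq_neg_of_add_eq_zero_left h3.symm
  rw [lieBracket, map_sub, key hV hαV, key hW hαW]
  abel

variable {P : H → M} {D : Distribution H M} {α : H → H →L[ℝ] G}

lemma mem_iff_inverse_mem_ker (hP : IsSmoothParam P)
    (hD : ∀ z, D (P z) = (LinearMap.ker (α z).toLinearMap).map
      (mfderiv 𝓘(ℝ, H) 𝓘(ℝ, H) P z).toLinearMap) (z : H) (u : TangentSpace 𝓘(ℝ, H) (P z)) :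
    u ∈ D (P z) ↔ α z ((mfderiv 𝓘(ℝ, H) 𝓘(ℝ, H) P z).inverse u) = 0 := by
  rw [hD]
  constructor
  · rintro ⟨v, hv, rfl⟩
    have := hP.inverse_mfderiv_apply z v
    exact (congrArg (α z) this).trans hv
  · intro h
    exact ⟨_, h, hP.mfderiv_inverse_apply z u⟩

/-- Integral elements of a distribution which is the kernel of a one-form in the chart `P`. -/
theorem isIntegralElement_map_iff (hP : IsSmoothParam P) (hα : ContDiff ℝ ∞ α) {s : G →L[ℝ] H}
    (hs : ∀ z g, α z (s g) = g)
    (hD : ∀ z, D (P z) = (LinearMap.ker (α z).toLinearMap).map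
      (mfderiv 𝓘(ℝ, H) 𝓘(ℝ, H) P z).toLinearMap) (z : H) (S : Submodule ℝ H) :
    IsIntegralElement D (P z) (S.map (mfderiv 𝓘(ℝ, H) 𝓘(ℝ, H) P z).toLinearMap) ↔
      S ≤ LinearMap.ker (α z).toLinearMap ∧
        ∀ v ∈ S, ∀ w ∈ S, fderiv ℝ α z v w = fderiv ℝ α z w v := by
  have hαd : DifferentiableAt ℝ α z := hα.contDiffAt.differentiableAt (by simp)
  -- Pulling both fields back along `P` turns the manifold bracket into the bracket of vector fields
  -- on `H`, where the formula for α of a bracket applies.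
  have bracket {X Y : (y : M) → TangentSpace 𝓘(ℝ, H) y} (hX : IsLocalSection D (P z) X)
      (hY : IsLocalSection D (P z) Y) : mlieBracket 𝓘(ℝ, H) X Y (P z) ∈ D (P z) ↔
      fderiv ℝ α z (mpullback 𝓘(ℝ, H) 𝓘(ℝ, H) P X z) (mpullback 𝓘(ℝ, H) 𝓘(ℝ, H) P Y z) =
      fderiv ℝ α z (mpullback 𝓘(ℝ, H) 𝓘(ℝ, H) P Y z) (mpullback 𝓘(ℝ, H) 𝓘(ℝ, H) P X z) := by
    have two_le : minSmoothness ℝ 2 ≤ ∞ := by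
      rw [minSmoothness_of_isRCLikeNormedField]
      exact WithTop.coe_le_coe.2 (le_top : (2 : ℕ∞) ≤ ⊤)
    have : IsManifold 𝓘(ℝ, H) (minSmoothness ℝ 2) M :=
      IsManifold.of_le (n := ∞) two_le
    have h1 := mpullback_mlieBracket (hX.1.mdifferentiableAt (by simp))
      (hY.1.mdifferentiableAt (by simp)) (hP.smooth z) (n := ∞)
      two_le
    have hd {X : (y : M) → TangentSpace 𝓘(ℝ, H) y} (hX : IsLocalSection D (P z) X) :
        DifferentiableAt ℝ (mpullback 𝓘(ℝ, H) 𝓘(ℝ, H) P X : H → H) z ∧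
        ∀ᶠ y in 𝓝 z, α y (mpullback 𝓘(ℝ, H) 𝓘(ℝ, H) P X y) = 0 := by
      constructor
      · have := ContMDiffWithinAt.mpullback_vectorField_preimage (m := ∞) (n := ∞)
          (contMDiffWithinAt_univ.2 hX.1) (hP.smooth z) (hP.isInvertible_mfderiv z) le_rfl
        rw [preimage_univ, contMDiffWithinAt_univ, contMDiffAt_vectorSpace_iff_contDiffAt] at this
        exact this.differentiableAt (by simp)
      · filter_upwards [hP.smooth.continuous.continuousAt.eventually hX.2] with y hy
        exact (mem_iff_inverse_mem_ker hP hD y _).1 hy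
    rw [mem_iff_inverse_mem_ker hP hD, ← mpullback_apply, h1, ← mlieBracketWithin_univ,
      mlieBracketWithin_eq_lieBracketWithin]
    have h2 := form_lieBracket hαd (hd hX).1 (hd hY).1 (hd hX).2 (hd hY).2
    refine (Eq.congr_left ((congrArg (α z) (congrFun lieBracketWithin_univ z)).trans h2)).trans ?_
    rw [sub_eq_zero]
    exact eq_comm
  have hle : S.map (mfderiv 𝓘(ℝ, H) 𝓘(ℝ, H) P z).toLinearMap ≤ D (P z) ↔
      S ≤ LinearMap.ker (α z).toLinearMap := by
    rw [hD]
    exact Submodule.map_le_map_iff_of_injective (hP.mfderiv_injective z) _ _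
  rw [IsIntegralElement, hle]
  refine and_congr_right fun hS => ⟨fun h v hv w hw => ?_, fun h X Y hX hY hXS hYS => ?_⟩
  · have sect (v : H) (hv : v ∈ S) : ∃ X : (y : M) → TangentSpace 𝓘(ℝ, H) y,
        IsLocalSection D (P z) X ∧ X (P z) = mfderiv 𝓘(ℝ, H) 𝓘(ℝ, H) P z v := by
      -- The constant field v is corrected by the section s, so that α annihilates it everywhere. At
      -- z the correction is zero because v already lies in the kernel.
      let V : (y : H) → TangentSpace 𝓘(ℝ, H) y := fun y => (v - s (α y v) : H)
      have hV : ContDiff ℝ ∞ (fun y => v - s (α y v)) := by fun_prop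
      have hX (y : H) : mpullback 𝓘(ℝ, H) 𝓘(ℝ, H) (invFun P) V (P y) =
          mfderiv 𝓘(ℝ, H) 𝓘(ℝ, H) P y (v - s (α y v)) := by
        rw [mpullback_apply]
        refine (hP.inverse_mfderiv_inv_apply y _).trans ?_
        change mfderiv 𝓘(ℝ, H) 𝓘(ℝ, H) P y (v - s (α (invFun P (P y)) v)) = _
        rw [hP.inv_apply]
      refine ⟨mpullback 𝓘(ℝ, H) 𝓘(ℝ, H) (invFun P) V, ⟨?_, ?_⟩, ?_⟩
      · have hV' : ContMDiffAt 𝓘(ℝ, H) 𝓘(ℝ, H).tangent ∞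
            (fun y => (⟨y, V y⟩ : TangentBundle 𝓘(ℝ, H) H)) (invFun P (P z)) :=
          contMDiffAt_vectorSpace_iff_contDiffAt.2 hV.contDiffAt
        have := ContMDiffWithinAt.mpullback_vectorField_preimage (m := ∞) (n := ∞)
          (contMDiffWithinAt_univ.2 hV') (hP.contMDiffAt_inv z) (hP.isInvertible_mfderiv_inv z)
          le_rfl
        rwa [preimage_univ, contMDiffWithinAt_univ] at this
      · filter_upwards [hP.range_mem_nhds z]
        rintro _ ⟨y, rfl⟩
        rw [hX, hD]
        refine ⟨_, ?_, rfl⟩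
        change α y (v - s (α y v)) = 0
        rw [map_sub, hs, sub_self]
      · have : α z v = 0 := hS hv
        rw [hX, this, map_zero, sub_zero]
    obtain ⟨X, hX, hXv⟩ := sect v hv
    obtain ⟨Y, hY, hYw⟩ := sect w hw
    have h1 := (bracket hX hY).1 (h X Y hX hY (hXv ▸ ⟨v, hv, rfl⟩) (hYw ▸ ⟨w, hw, rfl⟩))
    rw [mpullback_apply, mpullback_apply, hXv, hYw] at h1
    have e1 := hP.inverse_mfderiv_apply z v
    have e2 := hP.inverse_mfderiv_apply z w
    rw [e1, e2] at h1
    exact h1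
  · rw [bracket hX hY]
    obtain ⟨v, hv, hXv⟩ := hXS
    obtain ⟨w, hw, hYw⟩ := hYS
    rw [mpullback_apply, mpullback_apply, ← hXv, ← hYw]
    have e1 := hP.inverse_mfderiv_apply z v
    have e2 := hP.inverse_mfderiv_apply z w
    have := h v hv w hw
    rw [← e1, ← e2] at this
    exact this

end Integral

/-! ### Derivations of symmetric forms along endomorphisms and shears -/

section Derivation

variable {j : ℕ} {R N : Type*} [NormedAddCommGroup R] [NormedSpace ℝ R]
  [NormedAddCommGroup N] [NormedSpace ℝ N]

/-- The action of an endomorphism of `R` on symmetric forms as a derivation. -/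
noncomputable def derive (T : R →L[ℝ] R) (f : SymForm j R N) : SymForm j R N :=
  ⟨∑ i, f.1.compContinuousLinearMap (update (fun _ => ContinuousLinearMap.id ℝ R) i T), by
    intro σ v
    simp only [sum_apply, ContinuousMultilinearMap.compContinuousLinearMap_apply]
    refine Fintype.sum_equiv σ _ _ fun i => ?_
    refine Eq.trans ?_ (f.2 σ _)
    congr 1
    ext k
    by_cases h : k = i
    · subst h; simp
    · simp [h]⟩

lemma derive_apply (T : R →L[ℝ] R) (f : SymForm j R N) (v : Fin j → R) :
    (derive T f).1 v = ∑ i, f.1 (update v i (T (v i))) := by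
  simp only [derive, sum_apply, ContinuousMultilinearMap.compContinuousLinearMap_apply]
  refine Finset.sum_congr rfl fun i _ => ?_
  congr 1
  ext k
  by_cases h : k = i
  · subst h; simp
  · simp [h]

lemma symForm_ext {f g : SymForm j R N} (h : ∀ v, f.1 v = g.1 v) : f = g :=
  Subtype.ext (ContinuousMultilinearMap.ext h)

/-- Both composites are double sums over the arguments. Substitutions in two different arguments
commute, and two substitutions in the same argument give zero because both products of the
endomorphisms vanish. -/
lemma derive_comm {S T : R →L[ℝ] R} (hST : ∀ r, S (T r) = 0) (hTS : ∀ r, T (S r) = 0)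
    (f : SymForm j R N) : derive S (derive T f) = derive T (derive S f) := by
  refine symForm_ext fun v => ?_
  simp only [derive_apply]
  rw [Finset.sum_comm]
  refine Finset.sum_congr rfl fun i _ => Finset.sum_congr rfl fun k _ => ?_
  by_cases h : k = i
  · subst h
    simp [hST, hTS]
  · rw [update_of_ne h, update_of_ne (Ne.symm h), update_comm h]

/-- The definition fixes the classical decidability instance; this form accepts any instance. -/
lemma mem_vanishing {p : ℕ} {L : Submodule ℝ R} {f : SymForm j R N} [DecidablePred (· ∈ L)] :
    f ∈ vanishing p L ↔
      ∀ v : Fin j → R, p ≤ (Finset.univ.filter fun i => v i ∈ L).card → f.1 v = 0 := by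
  refine forall_congr' fun v => ?_
  convert! Iff.rfl

lemma card_filter_update {p : ℕ} {L : Submodule ℝ R} [DecidablePred (· ∈ L)] {v : Fin j → R}
    (hv : p + 1 ≤ (Finset.univ.filter fun i => v i ∈ L).card) (i : Fin j) (u : R) :
    p ≤ (Finset.univ.filter fun k => update v i u k ∈ L).card := by
  have h1 : (Finset.univ.filter fun i => v i ∈ L).erase i ⊆
      Finset.univ.filter fun k => update v i u k ∈ L := by
    intro k hk
    obtain ⟨h2, h3⟩ := Finset.mem_erase.1 hk
    simpa [h2] using h3
  have h2 := Finset.pred_card_le_card_erase (a := i) (s := Finset.univ.filter fun i => v i ∈ L)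
  have h3 := Finset.card_le_card h1
  omega

/-- Each term of the derivation changes a single argument, so of p + 1 arguments in L at least p
stay there. This is the reason for the shift from μ^p to μ^{p+1} between successive levels of the
tower. -/
lemma derive_mem_vanishing {p : ℕ} {L : Submodule ℝ R} {f : SymForm j R N}
    (hf : f ∈ vanishing p L) (T : R →L[ℝ] R) : derive T f ∈ vanishing (p + 1) L := by
  classical
  rw [mem_vanishing] at hf ⊢
  intro v hv
  rw [derive_apply]
  exact Finset.sum_eq_zero fun i _ => hf _ (card_filter_update hv i _)

variable {l : ℕ}

/-- The endomorphism `(x, y) ↦ (0, A x)`. -/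
noncomputable def shear (A : GrModel l R) : Split l R →L[ℝ] Split l R :=
  (ContinuousLinearMap.inr ℝ _ _).comp (A.comp (ContinuousLinearMap.fst ℝ _ _))

lemma shear_apply (A : GrModel l R) (v : Split l R) : shear A v = (0, A v.1) := rfl

lemma shear_shear (A B : GrModel l R) (v : Split l R) : shear A (shear B v) = 0 := by
  simp [shear_apply]

/-- The derivative of forms on `ℝ^l × ℝ^(n-l)` in the direction of `(x, y) ↦ (0, A x)`. -/
noncomputable def shearDeriv :
    SymForm j (Split l R) N →ₗ[ℝ] GrModel l R →ₗ[ℝ] SymForm j (Split l R) N :=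
  LinearMap.mk₂ ℝ (fun f A => derive (shear A) f)
    (fun f g A => symForm_ext fun v => by simp [derive_apply, Finset.sum_add_distrib])
    (fun c f A => symForm_ext fun v => by simp [derive_apply, Finset.smul_sum])
    (fun f A B => symForm_ext fun v => by
      simp only [derive_apply, Submodule.coe_add, add_apply]
      rw [← Finset.sum_add_distrib]
      refine Finset.sum_congr rfl fun i _ => ?_
      rw [← ContinuousMultilinearMap.map_update_add]
      simp [shear_apply])
    (fun c f A => symForm_ext fun v => by
      simp only [derive_apply, Submodule.coe_smul, smul_apply]
      rw [Finset.smul_sum]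
      refine Finset.sum_congr rfl fun i _ => ?_
      rw [← ContinuousMultilinearMap.map_update_smul]
      simp [shear_apply])

lemma shearDeriv_apply (f : SymForm j (Split l R) N) (A : GrModel l R) (v : Fin j → Split l R) :
    (shearDeriv f A).1 v = ∑ i, f.1 (update v i (0, A (v i).1)) := derive_apply _ _ _

/-- The composite of two shears is zero. This commutation is what makes the planes Q_φ integral. -/
lemma shearDeriv_comm (f : SymForm j (Split l R) N) (A B : GrModel l R) :
    shearDeriv (shearDeriv f A) B = shearDeriv (shearDeriv f B) A :=
  derive_comm (shear_shear B A) (shear_shear A B) f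

lemma shearDeriv_mem {p : ℕ} {L : Submodule ℝ (Split l R)} {f : SymForm j (Split l R) N}
    (hf : f ∈ vanishing p L) (A : GrModel l R) : shearDeriv f A ∈ vanishing (p + 1) L :=
  derive_mem_vanishing hf _

end Derivation

/-- The form is affine in z, with linear part `-Λ`, hence smooth with constant derivative. Only the
shape π(dy) - δ(y)(dA) matters, so the spaces and maps are left arbitrary. -/
lemma contDiff_fderiv_graphForm {E F G : Type*} [NormedAddCommGroup E] [NormedSpace ℝ E]
    [NormedAddCommGroup F] [NormedSpace ℝ F] [NormedAddCommGroup G] [NormedSpace ℝ G]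
    (π : F →L[ℝ] G) (δ : F →L[ℝ] E →L[ℝ] G) :
    ContDiff ℝ ∞ (fun z : E × F => π.comp (ContinuousLinearMap.snd ℝ E F) -
      (δ z.2).comp (ContinuousLinearMap.fst ℝ E F)) ∧ ∀ z v w : E × F,
    fderiv ℝ (fun z : E × F => π.comp (ContinuousLinearMap.snd ℝ E F) -
      (δ z.2).comp (ContinuousLinearMap.fst ℝ E F)) z v w = - δ v.2 w.1 := by
  let Λ : E × F →L[ℝ] E × F →L[ℝ] G := ((ContinuousLinearMap.compL ℝ (E × F) E G).flip
    (ContinuousLinearMap.fst ℝ E F)).comp (δ.comp (ContinuousLinearMap.snd ℝ E F))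
  refine ⟨by fun_prop, fun z v w => ?_⟩
  have h1 : HasFDerivAt (fun z : E × F => π.comp (ContinuousLinearMap.snd ℝ E F) -
      (δ z.2).comp (ContinuousLinearMap.fst ℝ E F)) (-Λ) z := Λ.hasFDerivAt.const_sub _
  rw [h1.fderiv]
  rfl

/-! ### Projection and derivative on classes of forms; the contact form -/

section Fibers

variable {j l p : ℕ} {R N : Type*} [NormedAddCommGroup R] [NormedSpace ℝ R]
  [FiniteDimensional ℝ R] [NormedAddCommGroup N] [NormedSpace ℝ N] [FiniteDimensional ℝ N]

namespace LeafFiber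

/-- The projection of the fibres induced by `μ^p ⊆ μ^{p+1}`. -/
noncomputable def proj : LeafFiber j l R N p →ₗ[ℝ] LeafFiber j l R N (p + 1) :=
  Submodule.liftQ (vanishing p (baseDirection l R) : Submodule ℝ (SymForm j (Split l R) N))
    LeafFiber.mk fun _ hf => (Submodule.Quotient.mk_eq_zero
      (vanishing (p + 1) (baseDirection l R) : Submodule ℝ (SymForm j (Split l R) N))).2
      (vanishing_mono p _ hf)

@[simp] lemma proj_mk (f : SymForm j (Split l R) N) :
    proj (mk f : LeafFiber j l R N p) = mk f := rfl

lemma mk_eq_zero_iff {f : SymForm j (Split l R) N} :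
    (mk f : LeafFiber j l R N p) = 0 ↔ f ∈ vanishing p (baseDirection l R) := by
  rw [← map_zero LeafFiber.mk, mk_eq_iff, sub_zero]

lemma proj_surjective : Surjective (proj : LeafFiber j l R N p → LeafFiber j l R N (p + 1)) := by
  intro y
  obtain ⟨f, rfl⟩ := mk_surjective y
  exact ⟨mk f, rfl⟩

/-- The derivative in the direction of `(x, y) ↦ (0, A x)`, on classes of forms. -/
noncomputable def deriv :
    LeafFiber j l R N p →ₗ[ℝ] GrModel l R →ₗ[ℝ] LeafFiber j l R N (p + 1) :=
  Submodule.liftQ (vanishing p (baseDirection l R) : Submodule ℝ (SymForm j (Split l R) N))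
    ((LinearMap.compRight ℝ (LeafFiber.mk : _ →ₗ[ℝ] LeafFiber j l R N (p + 1))).comp shearDeriv)
    fun _ hf => by
      refine LinearMap.ext fun A => ?_
      exact mk_eq_zero_iff.2 (shearDeriv_mem hf A)

@[simp] lemma deriv_mk (f : SymForm j (Split l R) N) (A : GrModel l R) :
    deriv (mk f : LeafFiber j l R N p) A = mk (shearDeriv f A) := rfl

lemma proj_deriv (y : LeafFiber j l R N p) (A : GrModel l R) :
    proj (deriv y A) = deriv (proj y) A := by
  obtain ⟨f, rfl⟩ := mk_surjective y
  rfl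

lemma deriv_comm (y : LeafFiber j l R N p) (A B : GrModel l R) :
    deriv (deriv y A) B = deriv (deriv y B) A := by
  obtain ⟨f, rfl⟩ := mk_surjective y
  simp [shearDeriv_comm]

/-- The continuous version of `LeafFiber.proj`. -/
noncomputable def projL : LeafFiber j l R N p →L[ℝ] LeafFiber j l R N (p + 1) :=
  LinearMap.toContinuousLinearMap proj

/-- The continuous version of `LeafFiber.deriv`. -/
noncomputable def derivL : LeafFiber j l R N p →L[ℝ] GrModel l R →L[ℝ] LeafFiber j l R N (p + 1) :=
  deriv.toContinuousBilinearMap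

end LeafFiber

open LeafFiber

/-- The one-form on the model space which defines the reduced distribution. -/
noncomputable def contactForm (z : LeafModel j l R N p) :
    LeafModel j l R N p →L[ℝ] LeafFiber j l R N (p + 1) :=
  projL.comp (ContinuousLinearMap.snd ℝ (GrModel l R) (LeafFiber j l R N p)) -
    (derivL z.2).comp (ContinuousLinearMap.fst ℝ (GrModel l R) (LeafFiber j l R N p))

lemma contactForm_apply (z w : LeafModel j l R N p) :
    contactForm z w = proj w.2 - deriv z.2 w.1 := rfl

lemma mem_ker_contactForm {z w : LeafModel j l R N p} :
    w ∈ LinearMap.ker (contactForm z).toLinearMap ↔ proj w.2 = deriv z.2 w.1 := by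
  rw [LinearMap.mem_ker]
  exact sub_eq_zero

lemma contDiff_contactForm : ContDiff ℝ ∞
    (contactForm : LeafModel j l R N p → LeafModel j l R N p →L[ℝ] LeafFiber j l R N (p + 1)) :=
  (contDiff_fderiv_graphForm projL derivL).1

lemma fderiv_contactForm (z v w : LeafModel j l R N p) :
    fderiv ℝ contactForm z v w = - deriv v.2 w.1 :=
  (contDiff_fderiv_graphForm projL derivL).2 z v w

/-- On vectors with zero Grassmannian component the form is the surjective projection, whatever z
is. One linear right inverse therefore serves all points at once, as needed for extending vectors of
the kernel to sections. -/
lemma exists_section_contactForm :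
    ∃ s : LeafFiber j l R N (p + 1) →L[ℝ] LeafModel j l R N p,
      ∀ z g, contactForm z (s g) = g := by
  obtain ⟨σ, hσ⟩ := LinearMap.exists_rightInverse_of_surjective
    (proj : _ →ₗ[ℝ] LeafFiber j l R N (p + 1)) (LinearMap.range_eq_top.2 proj_surjective)
  refine ⟨(ContinuousLinearMap.inr ℝ _ _).comp (LinearMap.toContinuousLinearMap σ), fun z g => ?_⟩
  have := LinearMap.congr_fun hσ g
  simpa [contactForm_apply] using this

end Fibers

/-! ### Bihomogeneous components and recovery of a form from its derivatives -/

section Patterns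

variable {j l : ℕ} {R N : Type*} [NormedAddCommGroup R] [NormedSpace ℝ R]
  [NormedAddCommGroup N] [NormedSpace ℝ N]

/-- The transposition of the two places carries one family of arguments to the other. -/
lemma apply_update_eq {R : Type*} [NormedAddCommGroup R] [NormedSpace ℝ R] (f : SymForm j R N)
    {v : Fin j → R} {i i' : Fin j} (h : v i = v i') (u : R) :
    f.1 (update v i u) = f.1 (update v i' u) := by
  refine Eq.trans ?_ (f.2 (Equiv.swap i i') _)
  congr 1
  ext k
  rcases eq_or_ne k i with rfl | hk
  · simp
  · rcases eq_or_ne k i' with rfl | hk'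
    · rcases eq_or_ne k i with rfl | hi
      · simp
      · simp [hi, h, Ne.symm hi]
    · simp [Equiv.swap_apply_of_ne_of_ne hk hk', hk, hk']

lemma apply_update_swap {R : Type*} [NormedAddCommGroup R] [NormedSpace ℝ R] (f : SymForm j R N)
    (v : Fin j → R) {i i' : Fin j} (h : i ≠ i') (a b : R) :
    f.1 (update (update v i a) i' b) = f.1 (update (update v i b) i' a) := by
  refine Eq.trans ?_ (f.2 (Equiv.swap i i') _)
  congr 1
  ext k
  rcases eq_or_ne k i with rfl | hk
  · simp [h]
  · rcases eq_or_ne k i' with rfl | hk'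
    · simp [Ne.symm hk]
    · simp [Equiv.swap_apply_of_ne_of_ne hk hk', hk, hk']

/-- Symmetry of forms will make the first b terms of certain sums equal and the others zero. With C
= 1 this also counts the indices below b. -/
lemma sum_block {N : Type*} [AddCommGroup N] [Module ℝ N] {b : ℕ} (hb : b ≤ j) {F : Fin j → N} {C : N} (h1 : ∀ i : Fin j, i.1 < b → F i = C)
    (h2 : ∀ i : Fin j, b ≤ i.1 → F i = 0) : ∑ i, F i = (b : ℝ) • C := by
  have h : ∀ i : Fin j, F i = if i.1 < b then C else 0 := fun i => by
    split_ifs with hi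
    · exact h1 i hi
    · exact h2 i (not_lt.1 hi)
  simp_rw [h]
  rw [Fin.sum_univ_eq_sum_range (fun i => if i < b then C else 0) j, ← Finset.sum_filter,
    Finset.sum_const, Nat.cast_smul_eq_nsmul]
  congr 1
  rw [show (Finset.range j).filter (· < b) = Finset.range b by ext; simp; omega]
  simp

lemma mem_baseDirection {v : Split l R} : v ∈ baseDirection l R ↔ v.2 = 0 := Iff.rfl

/-- The family of arguments `(x, 0)` (`a` times) and `(0, y)` (`j - a` times). -/
def pattern (a : ℕ) (x : Fin l → ℝ) (y : Fin (finrank ℝ R - l) → ℝ) (i : Fin j) : Split l R :=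
  if i.1 < a then (x, 0) else (0, y)

lemma pattern_of_lt {a : ℕ} {i : Fin j} (h : i.1 < a) (x : Fin l → ℝ)
    (y : Fin (finrank ℝ R - l) → ℝ) : (pattern a x y i : Split l R) = (x, 0) := if_pos h

lemma pattern_of_le {a : ℕ} {i : Fin j} (h : a ≤ i.1) (x : Fin l → ℝ)
    (y : Fin (finrank ℝ R - l) → ℝ) : (pattern a x y i : Split l R) = (0, y) := if_neg h.not_gt

lemma apply_pattern_eq_zero {a : ℕ} (ha : a ≤ j) {f : SymForm j (Split l R) N}
    (hf : f ∈ vanishing a (baseDirection l R)) (x : Fin l → ℝ)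
    (y : Fin (finrank ℝ R - l) → ℝ) : f.1 (pattern a x y) = 0 := by
  classical
  refine mem_vanishing.1 hf _ ?_
  have h1 : (Finset.univ.filter fun i : Fin j => i.1 < a).card = a := by
    have h2 := sum_block (N := ℝ) (F := fun i : Fin j => if i.1 < a then 1 else 0) (C := 1) ha
      (fun i hi => if_pos hi) (fun i hi => if_neg hi.not_gt)
    rw [Finset.sum_boole] at h2
    simpa using h2
  refine h1.symm.le.trans (Finset.card_le_card fun i hi => ?_)
  have hi' : i.1 < a := by simpa using hi
  rw [Finset.mem_filter, pattern_of_lt hi']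
  exact ⟨Finset.mem_univ _, rfl⟩

/-- The component of bidegree `(a, j - a)` of a form on `ℝ^l × ℝ^(n-l)`. -/
noncomputable def bihomogeneous (a : ℕ) (f : SymForm j (Split l R) N) : SymForm j (Split l R) N :=
  ⟨∑ s ∈ Finset.powersetCard a (Finset.univ : Finset (Fin j)),
    f.1.compContinuousLinearMap fun i => if i ∈ s
      then (ContinuousLinearMap.inl ℝ _ _).comp (ContinuousLinearMap.fst ℝ _ _)
      else (ContinuousLinearMap.inr ℝ _ _).comp (ContinuousLinearMap.snd ℝ _ _), by
    intro σ v
    simp only [sum_apply, ContinuousMultilinearMap.compContinuousLinearMap_apply]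
    refine Finset.sum_equiv σ.finsetCongr (by simp [Finset.mem_powersetCard]) fun s _ => ?_
    refine Eq.trans ?_ (f.2 σ _)
    congr 1
    ext k : 1
    simp⟩

lemma bihomogeneous_apply (a : ℕ) (f : SymForm j (Split l R) N) (v : Fin j → Split l R) :
    (bihomogeneous a f).1 v = ∑ s ∈ Finset.powersetCard a (Finset.univ : Finset (Fin j)),
      f.1 fun i => if i ∈ s then ((v i).1, 0) else (0, (v i).2) := by
  simp only [bihomogeneous, sum_apply, ContinuousMultilinearMap.compContinuousLinearMap_apply]
  refine Finset.sum_congr rfl fun s _ => congrArg f.1 (funext fun i => ?_)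
  split_ifs <;> rfl

/-- A symmetric form is determined by its values on the diagonal. There each summand has `(r.1, 0)`
at the places of a set s of size a and `(0, r.2)` elsewhere, and a permutation moving s to the first
a places turns it into a value on a pattern. -/
lemma bihomogeneous_eq_zero {a : ℕ} {f : SymForm j (Split l R) N}
    (h : ∀ x y, f.1 (pattern a x y) = 0) (ha : a ≤ j) : bihomogeneous a f = 0 := by
  refine symForm_eq_zero _ fun r => ?_
  rw [bihomogeneous_apply]
  refine Finset.sum_eq_zero fun s hs => ?_
  rw [Finset.mem_powersetCard] at hs
  have hcard : Fintype.card {i // i ∈ s} = Fintype.card {i : Fin j // i.1 < a} := by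
    rw [Fintype.card_coe, hs.2, Fintype.card_subtype]
    have h2 := sum_block (N := ℝ) (F := fun i : Fin j => if i.1 < a then 1 else 0) (C := 1) ha
      (fun i hi => if_pos hi) (fun i hi => if_neg hi.not_gt)
    rw [Finset.sum_boole] at h2
    simpa using h2.symm
  let e := Fintype.equivOfCardEq hcard
  have key : (fun i => if i ∈ s then (r.1, 0) else (0, r.2)) =
      (pattern a r.1 r.2 : Fin j → Split l R) ∘ e.extendSubtype := by
    ext i : 1
    by_cases hi : i ∈ s
    · rw [if_pos hi]
      exact (pattern_of_lt (e.extendSubtype_mem i hi) _ _).symm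
    · rw [if_neg hi]
      exact (pattern_of_le (not_lt.1 (e.extendSubtype_not_mem i hi)) _ _).symm
  exact (congrArg f.1 key).trans ((f.2 _ _).trans (h r.1 r.2))

/-- A form which vanishes on `a + 1` arguments in `ℝ^l × 0` depends only on the components in
`0 × ℝ^(n-l)` of the other arguments, if `a` arguments lie in `ℝ^l × 0`. -/
lemma apply_eq_of_mem_vanishing {a : ℕ} {f : SymForm j (Split l R) N}
    (hf : f ∈ vanishing (a + 1) (baseDirection l R)) {s : Finset (Fin j)} (hs : a ≤ s.card)
    {v : Fin j → Split l R} (hv : ∀ i ∈ s, v i ∈ baseDirection l R) :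
    f.1 v = f.1 fun i => if i ∈ s then ((v i).1, 0) else (0, (v i).2) := by
  classical
  set v' : Fin j → Split l R := fun i => if i ∈ s then ((v i).1, 0) else (0, (v i).2) with hv'
  have h1 : ∀ i ∈ s, v' i = v i := fun i hi => by
    simp only [hv', hi, if_true]
    exact Prod.ext rfl (mem_baseDirection.1 (hv i hi)).symm
  -- The arguments are replaced one at a time. Only places outside s change, and there the discarded
  -- part is a further vector of the base direction, which together with the a arguments at s makes
  -- the form vanish.
  have key (t : Finset (Fin j)) : f.1 (t.piecewise v' v) = f.1 v := by
    induction t using Finset.induction_on with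
    | empty => simp
    | insert i t hi ih =>
      rw [Finset.piecewise_insert]
      by_cases his : i ∈ s
      · have : v' i = t.piecewise v' v i := by
          rw [h1 i his, Finset.piecewise_eq_of_notMem _ _ _ hi]
        rw [this, update_eq_self, ih]
      · have h2 : v' i = v i - ((v i).1, 0) := by
          simp only [hv', his, if_false]
          ext <;> simp
        have h3 : f.1 (update (t.piecewise v' v) i ((v i).1, 0)) = 0 := by
          refine mem_vanishing.1 hf _ ?_
          refine (Nat.add_le_add_right hs 1).trans ?_
          rw [← Finset.card_insert_of_notMem his]
          refine Finset.card_le_card fun k hk => ?_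
          rw [Finset.mem_filter]
          refine ⟨Finset.mem_univ _, ?_⟩
          rcases eq_or_ne k i with rfl | hki
          · rw [update_self]; rfl
          · have hks := Finset.mem_of_mem_insert_of_ne hk hki
            rw [update_of_ne hki]
            by_cases hkt : k ∈ t
            · rw [Finset.piecewise_eq_of_mem _ _ _ hkt, h1 k hks]; exact hv k hks
            · rw [Finset.piecewise_eq_of_notMem _ _ _ hkt]; exact hv k hks
        have h4 : v i = t.piecewise v' v i := (Finset.piecewise_eq_of_notMem _ _ _ hi).symm
        rw [h2, ContinuousMultilinearMap.map_update_sub, h3, sub_zero, h4, update_eq_self, ih]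
  have := key Finset.univ
  rw [Finset.piecewise_univ] at this
  exact this.symm

/-- A form in `μ^{a+1}` lies in `μ^a` if its term of bidegree `(a, j - a)` vanishes. -/
theorem mem_vanishing_of_pattern {a : ℕ} (ha : a ≤ j) {f : SymForm j (Split l R) N}
    (hf : f ∈ vanishing (a + 1) (baseDirection l R)) (h : ∀ x y, f.1 (pattern a x y) = 0) :
    f ∈ vanishing a (baseDirection l R) := by
  classical
  refine mem_vanishing.2 fun v hv => ?_
  obtain ⟨s, hsv, hs⟩ := Finset.exists_subset_card_eq hv
  have hsv' : ∀ i ∈ s, v i ∈ baseDirection l R := fun i hi => (Finset.mem_filter.1 (hsv hi)).2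
  rw [apply_eq_of_mem_vanishing hf hs.ge hsv']
  have h0 := congrArg (fun g : SymForm j (Split l R) N => g.1 fun i =>
    if i ∈ s then ((v i).1, 0) else (0, (v i).2)) (bihomogeneous_eq_zero h ha)
  simp only [bihomogeneous_apply] at h0
  -- In the component of bidegree (a, j - a), evaluated at these arguments, only s itself
  -- contributes: another set of size a omits some place of s, where the second component is zero.
  rw [Finset.sum_eq_single s] at h0
  · refine Eq.trans (congrArg f.1 (funext fun i => ?_)) h0
    split_ifs <;> rfl
  · intro t ht hts
    rw [Finset.mem_powersetCard] at ht
    obtain ⟨i, his, hit⟩ : ∃ i ∈ s, i ∉ t := by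
      by_contra! hst
      exact hts (Finset.eq_of_subset_of_card_le hst (by omega)).symm
    refine f.1.map_coord_zero i ?_
    simp [his, hit]
  · intro hs'
    exact absurd (Finset.mem_powersetCard.2 ⟨Finset.subset_univ _, hs⟩) hs'

lemma update_pattern_succ {a : ℕ} (ha : a < j) (x : Fin l → ℝ) (y : Fin (finrank ℝ R - l) → ℝ)
    (u : Split l R) :
    update (pattern (a + 1) x y : Fin j → Split l R) ⟨a, ha⟩ u = update (pattern a x y) ⟨a, ha⟩ u := by
  ext i : 1
  rcases eq_or_ne i ⟨a, ha⟩ with rfl | hi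
  · simp
  · have hi' : i.1 ≠ a := fun h => hi (Fin.ext h)
    rw [update_of_ne hi, update_of_ne hi]
    rcases lt_or_gt_of_ne hi' with hlt | hlt
    · rw [pattern_of_lt hlt, pattern_of_lt (by omega)]
    · rw [pattern_of_le hlt.le, pattern_of_le (by omega)]

lemma update_pattern_self {a : ℕ} (ha : a < j) (x : Fin l → ℝ) (y : Fin (finrank ℝ R - l) → ℝ) :
    update (pattern a x y : Fin j → Split l R) ⟨a, ha⟩ (0, y) = pattern a x y := by
  have : (0, y) = (pattern a x y ⟨a, ha⟩ : Split l R) :=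
    (pattern_of_le (i := ⟨a, ha⟩) le_rfl x y).symm
  rw [this, update_eq_self]

/-- The a arguments (x, 0) contribute equal terms by symmetry. The arguments (0, y) contribute
nothing, since the shear kills them. -/
lemma shearDeriv_pattern {a : ℕ} (ha : a ≤ j) (f : SymForm j (Split l R) N) (A : GrModel l R)
    (x : Fin l → ℝ) (y : Fin (finrank ℝ R - l) → ℝ) {i : Fin j} (hi : i.1 < a) :
    (shearDeriv f A).1 (pattern a x y) =
      (a : ℝ) • f.1 (update (pattern a x y) i (0, A x)) := by
  rw [shearDeriv_apply]
  refine sum_block ha (fun k hk => ?_) fun k hk => ?_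
  · rw [pattern_of_lt hk]
    exact apply_update_eq f (by rw [pattern_of_lt hk, pattern_of_lt hi]) _
  · rw [pattern_of_le hk]
    exact f.1.map_coord_zero k (by simp)

lemma exists_apply_eq {x : Fin l → ℝ} (hx : x ≠ 0) (y : Fin (finrank ℝ R - l) → ℝ) :
    ∃ A : GrModel l R, A x = y := by
  obtain ⟨i, hi⟩ := Function.ne_iff.1 hx
  refine ⟨((x i)⁻¹ • ContinuousLinearMap.proj (R := ℝ) (φ := fun _ : Fin l => ℝ) i).smulRight y, ?_⟩
  have : x i ≠ 0 := hi
  simp [this]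

/-- A form is determined modulo `μ^a` by its class modulo `μ^{a+1}` and the classes of its
derivatives. -/
theorem mem_vanishing_of_shearDeriv (hl : 1 ≤ l) {a : ℕ} (ha : a + 1 ≤ j)
    {f : SymForm j (Split l R) N} (hf : f ∈ vanishing (a + 1) (baseDirection l R))
    (h : ∀ A, shearDeriv f A ∈ vanishing (a + 1) (baseDirection l R)) :
    f ∈ vanishing a (baseDirection l R) := by
  refine mem_vanishing_of_pattern (by omega) hf fun x y => ?_
  -- For x ≠ 0 choose A with A x = y. On a + 1 copies of x the derivative is then a + 1 times the
  -- value of f on a copies of x and j - a copies of y.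
  have key (x : Fin l → ℝ) (hx : x ≠ 0) : f.1 (pattern a x y) = 0 := by
    obtain ⟨A, hA⟩ := exists_apply_eq (R := R) hx y
    have h1 := apply_pattern_eq_zero ha (h A) x y
    rw [shearDeriv_pattern ha f A x y (i := ⟨a, ha⟩) (by simp)] at h1
    have h2 := (smul_eq_zero.1 h1).resolve_left (by exact_mod_cast a.succ_ne_zero)
    rwa [hA, update_pattern_succ, update_pattern_self] at h2
  -- If x = 0, then either a = 0 and the pattern does not contain x, so that x may be replaced by a
  -- nonzero vector (here l ≥ 1 is used), or a > 0 and the form has a zero argument.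
  by_cases hx : x = 0
  · subst hx
    rcases Nat.eq_zero_or_pos a with rfl | hpos
    · rw [← key (fun _ => 1) fun h => one_ne_zero (congrFun h ⟨0, hl⟩)]
      congr 1
    · exact f.1.map_coord_zero ⟨0, by omega⟩ (pattern_of_lt hpos _ _)
  · exact key x hx

end Patterns

/-! ### Closed families of forms: dependence on A x and division by a linear factor -/

section Exactness

variable {j l p : ℕ} {R N : Type*} [NormedAddCommGroup R] [NormedSpace ℝ R]
  [NormedAddCommGroup N] [NormedSpace ℝ N]

/-- The value of a form on `x` (`p + 1` times), `z`, and `y` (`j - p - 2` times), with `x` in the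
first and `y`, `z` in the second factor of `ℝ^l × ℝ^(n-l)`. -/
noncomputable def mixed (hp : p + 2 ≤ j) (f : SymForm j (Split l R) N) (x : Fin l → ℝ)
    (z y : Fin (finrank ℝ R - l) → ℝ) : N :=
  f.1 (update (pattern (p + 1) x y) ⟨p + 1, hp⟩ (0, z))

/-- The value of a form on `u`, `x` (`p` times), `z`, and `y` (`j - p - 2` times), with `u`, `x` in
the first and `y`, `z` in the second factor of `ℝ^l × ℝ^(n-l)`. -/
noncomputable def mixedPolar (hp : p + 2 ≤ j) (f : SymForm j (Split l R) N) (u x : Fin l → ℝ)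
    (z y : Fin (finrank ℝ R - l) → ℝ) : N :=
  f.1 (update (update (pattern (p + 1) x y) ⟨p + 1, hp⟩ (0, z)) ⟨0, by omega⟩ (u, 0))

variable (hp : p + 2 ≤ j) (f g : SymForm j (Split l R) N) (u x : Fin l → ℝ)
  (z y : Fin (finrank ℝ R - l) → ℝ) (c : ℝ)

lemma mixed_smul_right : mixed hp f x (c • z) y = c • mixed hp f x z y := by
  have : ((0 : Fin l → ℝ), c • z) = c • (0, z) := by simp
  rw [mixed, this, ContinuousMultilinearMap.map_update_smul]
  rfl

lemma mixed_zero_left : mixed hp f 0 z y = 0 := by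
  refine f.1.map_coord_zero ⟨0, by omega⟩ ?_
  rw [update_of_ne (by simp [Fin.ext_iff])]
  exact pattern_of_lt (by simp) _ _

lemma mixed_zero_right : mixed hp f x 0 y = 0 :=
  f.1.map_coord_zero ⟨p + 1, hp⟩ (by simp)

lemma mixed_self : mixed hp f x y y = f.1 (pattern (p + 1) x y) := by
  rw [mixed, update_pattern_self]

lemma mixedPolar_self : mixedPolar hp f x x z y = mixed hp f x z y := by
  have h : (x, 0) = update (pattern (p + 1) x y : Fin j → Split l R) ⟨p + 1, hp⟩ (0, z)
      ⟨0, by omega⟩ := by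
    rw [update_of_ne (by simp [Fin.ext_iff])]
    exact (pattern_of_lt (by simp) _ _).symm
  rw [mixedPolar, mixed, h, update_eq_self]

lemma mixedPolar_sum_smul {ι : Type*} [Fintype ι] (a : ι → ℝ) (e : ι → Fin l → ℝ) :
    ∑ i, a i • mixedPolar hp f (e i) x z y = mixedPolar hp f (∑ i, a i • e i) x z y := by
  let Φ := (f.1.toContinuousLinearMap
    (update (pattern (p + 1) x y) ⟨p + 1, hp⟩ (0, z)) ⟨0, by omega⟩).comp
      (ContinuousLinearMap.inl ℝ (Fin l → ℝ) (Fin (finrank ℝ R - l) → ℝ))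
  have h (w : Fin l → ℝ) : mixedPolar hp f w x z y = Φ w := rfl
  simp only [h, map_sum, map_smul]

/-- The vector x fills the first p + 1 places, so the product rule gives p + 1 terms, equal by
symmetry. -/
lemma hasDerivAt_mixed : HasDerivAt (fun t : ℝ => mixed hp f (x + t • u) z y)
    ((p + 1 : ℝ) • mixedPolar hp f u x z y) 0 := by
  set v : Fin j → Split l R := update (pattern (p + 1) x y) ⟨p + 1, hp⟩ (0, z) with hv
  let d : Fin j → Split l R := fun i => if i.1 < p + 1 then (u, 0) else 0
  have h1 : HasDerivAt (fun t : ℝ => v + t • d) d 0 := by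
    simpa using ((hasDerivAt_id (0 : ℝ)).smul_const d).const_add v
  have h2 : HasFDerivAt f.1 (f.1.linearDeriv (v + (0 : ℝ) • d)) (v + (0 : ℝ) • d) :=
    f.1.hasFDerivAt _
  have h3 := h2.comp_hasDerivAt (0 : ℝ) h1
  rw [zero_smul, add_zero, ContinuousMultilinearMap.linearDeriv_apply] at h3
  have h4 : ∑ i, f.1 (update v i (d i)) = ((p + 1 : ℕ) : ℝ) • mixedPolar hp f u x z y := by
    refine sum_block (by omega) (fun i hi => ?_) fun i hi => ?_
    · have e (k : Fin j) (hk : k.1 < p + 1) : v k = (x, 0) := by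
        rw [hv, update_of_ne (by rw [Ne, Fin.ext_iff]; exact hk.ne)]
        exact pattern_of_lt hk _ _
      rw [show d i = (u, 0) from if_pos hi]
      exact apply_update_eq f (by rw [e i hi, e ⟨0, by omega⟩ (by simp)]) _
    · rw [show d i = 0 from if_neg hi.not_gt]
      exact f.1.map_coord_zero i (by simp)
  rw [h4] at h3
  push_cast at h3
  refine h3.congr_of_eventuallyEq (Eventually.of_forall fun t => congrArg f.1 (funext fun i => ?_))
  simp only [Pi.add_apply, Pi.smul_apply, hv, d]
  rcases eq_or_ne i ⟨p + 1, hp⟩ with rfl | hi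
  · simp
  · rw [update_of_ne hi, update_of_ne hi]
    by_cases h : i.1 < p + 1
    · rw [pattern_of_lt h, pattern_of_lt h, if_pos h]; ext <;> simp
    · rw [pattern_of_le (not_lt.1 h), pattern_of_le (not_lt.1 h), if_neg h]; simp

/-- The map `x ↦ ξ(x) z`. -/
noncomputable def rankOne (ξ : (Fin l → ℝ) →L[ℝ] ℝ) (z : Fin (finrank ℝ R - l) → ℝ) :
    GrModel l R := ξ.smulRight z

lemma rankOne_apply (ξ : (Fin l → ℝ) →L[ℝ] ℝ) : (rankOne ξ z : GrModel l R) x = ξ x • z := rfl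

/-- The `i`-th coordinate of `ℝ^l`. -/
def coordinate (i : Fin l) : (Fin l → ℝ) →L[ℝ] ℝ :=
  ContinuousLinearMap.proj (R := ℝ) (φ := fun _ : Fin l => ℝ) i

lemma sum_smul_rankOne (ξ : (Fin l → ℝ) →L[ℝ] ℝ) :
    ∑ i, ξ (Pi.single i 1) • (rankOne (coordinate i) z : GrModel l R) = rankOne ξ z := by
  ext1 w
  simp only [sum_apply, smul_apply, rankOne_apply, smul_smul, ← Finset.sum_smul]
  congr 1
  conv_rhs => rw [pi_eq_sum_univ' w, map_sum]
  refine Finset.sum_congr rfl fun i _ => ?_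
  rw [map_smul, smul_eq_mul, mul_comm]
  rfl

variable {β : GrModel l R →ₗ[ℝ] SymForm j (Split l R) N}
  (hc : ∀ A B, shearDeriv (β A) B - shearDeriv (β B) A ∈ vanishing (p + 2) (baseDirection l R))
include hc

/-- This is the closedness condition evaluated on p + 2 copies of x and j - p - 2 copies of y; both
derivatives carry the same factor p + 2. -/
lemma mixed_comm (A B : GrModel l R) :
    mixed hp (β A) x (B x) y = mixed hp (β B) x (A x) y := by
  have h1 := apply_pattern_eq_zero hp (hc A B) x y
  have h2 := shearDeriv_pattern hp (β A) B x y (i := ⟨p + 1, hp⟩) (by simp)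
  have h3 := shearDeriv_pattern hp (β B) A x y (i := ⟨p + 1, hp⟩) (by simp)
  have h4 : (shearDeriv (β A) B).1 (pattern (p + 2) x y) -
    (shearDeriv (β B) A).1 (pattern (p + 2) x y) = 0 := h1
  rw [h2, h3, ← smul_sub, update_pattern_succ, update_pattern_succ] at h4
  exact sub_eq_zero.1 ((smul_eq_zero.1 h4).resolve_left (by positivity))

/-- For x ≠ 0 one can write z = B x, and the symmetry in A and B replaces z by A x = 0. Consequently
the value for β A depends on A only through A x. -/
lemma mixed_eq_zero {A : GrModel l R} (hA : A x = 0) : mixed hp (β A) x z y = 0 := by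
  by_cases hx : x = 0
  · rw [hx, mixed_zero_left]
  · obtain ⟨B, rfl⟩ := exists_apply_eq (R := R) hx z
    rw [mixed_comm hp x y hc, hA, mixed_zero_right]

/-- The combination ξ(x) η⊗v - η(x) ξ⊗v kills x. The relation says that the value for η⊗v is
divisible by η(x), with a quotient independent of η. -/
lemma mixed_rankOne_comm (ξ η : (Fin l → ℝ) →L[ℝ] ℝ) (v : Fin (finrank ℝ R - l) → ℝ) :
    ξ x • mixed hp (β (rankOne η v)) x z y = η x • mixed hp (β (rankOne ξ v)) x z y := by
  have h := mixed_eq_zero hp x z y hc (A := ξ x • rankOne η v - η x • rankOne ξ v) (by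
    simp [rankOne_apply, smul_smul, mul_comm])
  rw [map_sub, map_smul, map_smul] at h
  exact sub_eq_zero.1 h

/-- The symmetry relation for ξ⊗v and ξ⊗z has the common factor ξ(x). Where this factor is zero,
both sides vanish since the maps kill x. -/
lemma mixed_rankOne_swap (ξ : (Fin l → ℝ) →L[ℝ] ℝ) (v : Fin (finrank ℝ R - l) → ℝ) :
    mixed hp (β (rankOne ξ v)) x z y = mixed hp (β (rankOne ξ z)) x v y := by
  by_cases h : ξ x = 0
  · rw [mixed_eq_zero hp x z y hc (by rw [rankOne_apply, h, zero_smul]),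
      mixed_eq_zero hp x v y hc (by rw [rankOne_apply, h, zero_smul])]
  · have h1 := mixed_comm hp x y hc (rankOne ξ v) (rankOne ξ z)
    rw [rankOne_apply, rankOne_apply, mixed_smul_right, mixed_smul_right] at h1
    exact smul_right_injective N h h1

/-- The exchange of v and z holds for all x, so it may be differentiated in the direction u; the
factor p + 1 cancels. -/
lemma mixedPolar_rankOne_swap (ξ : (Fin l → ℝ) →L[ℝ] ℝ) (v : Fin (finrank ℝ R - l) → ℝ) :
    mixedPolar hp (β (rankOne ξ v)) u x z y = mixedPolar hp (β (rankOne ξ z)) u x v y := by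
  have h1 := hasDerivAt_mixed hp (β (rankOne ξ v)) u x z y
  simp_rw [fun t : ℝ => mixed_rankOne_swap hp (x + t • u) z y hc ξ v] at h1
  have h2 := h1.unique (hasDerivAt_mixed hp (β (rankOne ξ z)) u x v y)
  exact smul_right_injective N (show (p + 1 : ℝ) ≠ 0 by positivity) h2

/-- This carries out the division by η(x). Write m_η for the value with η⊗v and m_i for the one with
the i-th coordinate in place of η. Differentiate x_i m_η = η(x) m_i in the direction e_i and sum
over i. On the left, Euler's identity for degree p + 1 in x gives (l + p + 1) m_η. On the right, the
terms η(e_i) m_i add up to m_η, and the rest is η(x) times the trace. -/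
lemma mixed_rankOne_eq_sum (η : (Fin l → ℝ) →L[ℝ] ℝ) (v : Fin (finrank ℝ R - l) → ℝ) :
    (l + p : ℝ) • mixed hp (β (rankOne η v)) x z y =
      η x • (p + 1 : ℝ) • ∑ i, mixedPolar hp (β (rankOne (coordinate i) v)) (Pi.single i 1) x z y := by
  have key (i : Fin l) : mixed hp (β (rankOne η v)) x z y +
      (p + 1 : ℝ) • x i • mixedPolar hp (β (rankOne η v)) (Pi.single i 1) x z y =
      η (Pi.single i 1) • mixed hp (β (rankOne (coordinate i) v)) x z y +
      η x • (p + 1 : ℝ) • mixedPolar hp (β (rankOne (coordinate i) v)) (Pi.single i 1) x z y := by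
    have hlin (ξ : (Fin l → ℝ) →L[ℝ] ℝ) : HasDerivAt
        (fun t : ℝ => ξ (x + t • Pi.single i 1)) (ξ (Pi.single i 1)) 0 := by
      have := ((hasDerivAt_id (0 : ℝ)).mul_const (ξ (Pi.single i 1))).const_add (ξ x)
      simpa using this
    have h1 := (hlin (coordinate i)).smul
      (hasDerivAt_mixed hp (β (rankOne η v)) (Pi.single i 1) x z y)
    have h2 := (hlin η).smul
      (hasDerivAt_mixed hp (β (rankOne (coordinate i) v)) (Pi.single i 1) x z y)
    have h4 := h1.unique (h2.congr_of_eventuallyEq (Eventually.of_forall fun t =>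
      mixed_rankOne_comm hp (x + t • Pi.single i 1) z y hc (coordinate i) η v))
    simp only [zero_smul, add_zero, coordinate, ContinuousLinearMap.proj_apply, Pi.single_eq_same,
      one_smul] at h4
    rw [add_comm, smul_comm (p + 1 : ℝ), add_comm (η _ • _)]
    exact h4
  have hsum := Finset.sum_congr (rfl : (Finset.univ : Finset (Fin l)) = _) fun i _ => key i
  rw [Finset.sum_add_distrib, Finset.sum_add_distrib, ← Finset.smul_sum, ← Finset.smul_sum,
    ← Finset.smul_sum, mixedPolar_sum_smul] at hsum
  have hx : ∑ i, x i • (Pi.single i 1 : Fin l → ℝ) = x := (pi_eq_sum_univ' x).symm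
  have hη : ∑ i, η (Pi.single i 1) • mixed hp (β (rankOne (coordinate i) v)) x z y =
      mixed hp (β (rankOne η v)) x z y := by
    rw [← sum_smul_rankOne v η, map_sum]
    simp only [map_smul, mixed, AddSubmonoidClass.coe_finsetSum, sum_apply, Submodule.coe_smul,
      smul_apply]
  rw [hx, mixedPolar_self, hη] at hsum
  simp only [Finset.sum_const, Finset.card_univ, Fintype.card_fin,
    ← Nat.cast_smul_eq_nsmul ℝ] at hsum
  rw [← sub_eq_iff_eq_add'] at hsum
  rw [← hsum]
  module

/-- Only A x matters, so for x ≠ 0 the map A may be replaced by ξ⊗(A x) with ξ(x) = 1, which is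
covered by the rank-one case. -/
lemma mixed_eq_sum (A : GrModel l R) :
    (l + p : ℝ) • mixed hp (β A) x z y = (p + 1 : ℝ) •
      ∑ i, mixedPolar hp (β (rankOne (coordinate i) (A x))) (Pi.single i 1) x z y := by
  by_cases hx : x = 0
  · subst hx
    rw [mixed_zero_left, map_zero, smul_zero]
    have h (i : Fin l) : (rankOne (coordinate i) 0 : GrModel l R) = 0 := by
      ext1 w; simp [rankOne_apply]
    simp [h, mixedPolar]
  · obtain ⟨i, hi⟩ := Function.ne_iff.1 hx
    have hi' : x i ≠ 0 := hi
    let ξ : (Fin l → ℝ) →L[ℝ] ℝ := (x i)⁻¹ • coordinate i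
    have hξ : ξ x = 1 := by simp [ξ, coordinate, hi']
    have h1 := mixed_eq_zero hp x z y hc (A := A - rankOne ξ (A x)) (by
      rw [sub_apply, rankOne_apply, hξ, one_smul, sub_self])
    rw [map_sub] at h1
    have h2 : mixed hp (β A) x z y = mixed hp (β (rankOne ξ (A x))) x z y := sub_eq_zero.1 h1
    rw [h2, mixed_rankOne_eq_sum hp x z y hc, hξ, one_smul]

end Exactness

/-! ### The explicit primitive of a closed family -/

section Primitive

variable {j l p : ℕ} {R N : Type*} [NormedAddCommGroup R] [NormedSpace ℝ R]
  [NormedAddCommGroup N] [NormedSpace ℝ N]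

/-- The endomorphism `(x, y) ↦ (y_a e_i, 0)`. -/
noncomputable def coshear (i : Fin l) (a : Fin (finrank ℝ R - l)) : Split l R →L[ℝ] Split l R :=
  ((ContinuousLinearMap.proj (R := ℝ) (φ := fun _ : Fin (finrank ℝ R - l) => ℝ) a).comp
    (ContinuousLinearMap.snd ℝ _ _)).smulRight (Pi.single i 1, 0)

lemma coshear_apply (i : Fin l) (a : Fin (finrank ℝ R - l)) (v : Split l R) :
    coshear i a v = v.2 a • (Pi.single i 1, 0) := rfl

/-- Up to a constant factor, a form whose derivatives are the forms `β A`. -/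
noncomputable def primitive (β : GrModel l R →ₗ[ℝ] SymForm j (Split l R) N) :
    SymForm j (Split l R) N :=
  ∑ i, ∑ a, derive (coshear i a) (β (rankOne (coordinate i) (Pi.single a 1)))

lemma sum_smul_rankOne_single (ξ : (Fin l → ℝ) →L[ℝ] ℝ) (z : Fin (finrank ℝ R - l) → ℝ) :
    ∑ a, z a • (rankOne ξ (Pi.single a 1) : GrModel l R) = rankOne ξ z := by
  ext1 w
  simp only [sum_apply, smul_apply, rankOne_apply]
  conv_rhs => rw [pi_eq_sum_univ' z, Finset.smul_sum]
  exact Finset.sum_congr rfl fun a _ => smul_comm _ _ _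

lemma primitive_apply (β : GrModel l R →ₗ[ℝ] SymForm j (Split l R) N) (v : Fin j → Split l R) :
    (primitive β).1 v = ∑ k, ∑ i,
      (β (rankOne (coordinate i) (v k).2)).1 (update v k (Pi.single i 1, 0)) := by
  rw [Finset.sum_comm]
  simp only [primitive, AddSubmonoidClass.coe_finsetSum, sum_apply, derive_apply]
  refine Finset.sum_congr rfl fun i _ => ?_
  rw [Finset.sum_comm]
  refine Finset.sum_congr rfl fun k _ => ?_
  rw [← sum_smul_rankOne_single (coordinate i) (v k).2, map_sum]
  simp only [AddSubmonoidClass.coe_finsetSum, sum_apply, map_smul, Submodule.coe_smul, smul_apply]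
  refine Finset.sum_congr rfl fun a _ => ?_
  rw [coshear_apply, ContinuousMultilinearMap.map_update_smul]

lemma rankOne_zero (ξ : (Fin l → ℝ) →L[ℝ] ℝ) : (rankOne ξ 0 : GrModel l R) = 0 := by
  ext1 w; simp [rankOne_apply]

/-- The maps (x, y) ↦ (y_a e_i, 0) kill the base direction, so only arguments outside it are
substituted. The substituted vector lies in the base direction, which raises the number of such
arguments from p to p + 1. -/
lemma primitive_mem {β : GrModel l R →ₗ[ℝ] SymForm j (Split l R) N}
    (hβ : ∀ A, β A ∈ vanishing (p + 1) (baseDirection l R)) :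
    primitive β ∈ vanishing p (baseDirection l R) := by
  classical
  refine mem_vanishing.2 fun v hv => ?_
  rw [primitive_apply]
  refine Finset.sum_eq_zero fun k _ => Finset.sum_eq_zero fun i _ => ?_
  by_cases hk : v k ∈ baseDirection l R
  · rw [mem_baseDirection.1 hk, rankOne_zero, map_zero]
    rfl
  · refine mem_vanishing.1 (hβ _) _ ?_
    have hk' : k ∉ Finset.univ.filter fun i => v i ∈ baseDirection l R := by simp [hk]
    refine (Nat.add_le_add_right hv 1).trans ?_
    rw [← Finset.card_insert_of_notMem hk']
    refine Finset.card_le_card fun m hm => ?_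
    rw [Finset.mem_filter]
    refine ⟨Finset.mem_univ _, ?_⟩
    rcases eq_or_ne m k with rfl | hmk
    · rw [update_self]; rfl
    · rw [update_of_ne hmk]
      exact (Finset.mem_filter.1 (Finset.mem_of_mem_insert_of_ne hm hmk)).2

/-- The p remaining arguments (x, 0) contribute nothing. The argument (0, z) and the j - p - 1
arguments (0, y) all contribute the same trace: for a place holding y, the primitive inserts y into
the rank-one map and leaves z as an argument, and the closedness condition allows the two to be
exchanged. -/
lemma primitive_pattern (hp : p + 2 ≤ j) {β : GrModel l R →ₗ[ℝ] SymForm j (Split l R) N}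
    (hc : ∀ A B, shearDeriv (β A) B - shearDeriv (β B) A ∈ vanishing (p + 2) (baseDirection l R))
    (x : Fin l → ℝ) (z y : Fin (finrank ℝ R - l) → ℝ) :
    (primitive β).1 (update (pattern (p + 1) x y) ⟨0, by omega⟩ (0, z)) = (j - p : ℝ) •
      ∑ i, mixedPolar hp (β (rankOne (coordinate i) z)) (Pi.single i 1) x y y := by
  rw [primitive_apply]
  set C := ∑ i, mixedPolar hp (β (rankOne (coordinate i) z)) (Pi.single i 1) x y y with hC
  set w : Fin j → Split l R := update (pattern (p + 1) x y) ⟨0, by omega⟩ (0, z) with hw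
  set F : Fin j → N := fun k => ∑ i,
    (β (rankOne (coordinate i) (w k).2)).1 (update w k (Pi.single i 1, 0)) with hF
  have h0 : F ⟨0, by omega⟩ = C := by
    refine Finset.sum_congr rfl fun i _ => ?_
    rw [mixedPolar, update_pattern_self, hw, update_self, update_idem]
  have h1 (k : Fin j) (hk0 : k.1 ≠ 0) (hk : k.1 < p + 1) : F k = 0 := by
    refine Finset.sum_eq_zero fun i _ => ?_
    have : (w k).2 = 0 := by
      rw [hw, update_of_ne (by rwa [Ne, Fin.ext_iff]), pattern_of_lt hk]
    rw [this, rankOne_zero, map_zero]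
    rfl
  have h2 (k : Fin j) (hk : p + 1 ≤ k.1) : F k = C := by
    refine Finset.sum_congr rfl fun i _ => ?_
    have hk0 : (⟨0, by omega⟩ : Fin j) ≠ k := by
      rw [Ne, Fin.ext_iff]
      change ¬0 = k.1
      omega
    have : (w k).2 = y := by rw [hw, update_of_ne hk0.symm, pattern_of_le hk]
    rw [this, hw, apply_update_swap _ _ hk0, ← mixedPolar_rankOne_swap hp _ x z y hc]
    have hne : (⟨p + 1, hp⟩ : Fin j) ≠ ⟨0, by omega⟩ := by rw [Ne, Fin.ext_iff]; simp
    rw [mixedPolar, update_comm hne]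
    refine apply_update_eq _ ?_ _
    rw [update_of_ne hk0.symm, update_of_ne (by rw [Ne, Fin.ext_iff]; simp), pattern_of_le hk,
      pattern_of_le (i := ⟨p + 1, hp⟩) le_rfl]
  -- Adding C at the p places where F vanishes makes all j terms equal to C. The sum of these added
  -- terms is then computed as (p + 1) C - C.
  have hs : ∑ k, (F k + (if k = ⟨0, by omega⟩ then 0 else if k.1 < p + 1 then C else 0)) =
      (j : ℝ) • C := by
    refine sum_block le_rfl (fun k _ => ?_) fun k hk => absurd k.2 (not_lt.2 hk)
    split_ifs with e1 e2
    · rw [e1, h0, add_zero]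
    · rw [h1 k (fun h => e1 (Fin.ext h)) e2, zero_add]
    · rw [h2 k (not_lt.1 e2), add_zero]
  have hs' : ∑ k : Fin j, ((if k = ⟨0, by omega⟩ then 0 else if k.1 < p + 1 then C else 0) +
      if k = ⟨0, by omega⟩ then C else 0) = ((p + 1 : ℕ) : ℝ) • C := by
    refine sum_block (by omega) (fun k hk => ?_) fun k hk => ?_
    · split_ifs <;> simp
    · have : k ≠ ⟨0, by omega⟩ := by rw [Ne, Fin.ext_iff]; simp; omega
      rw [if_neg this, if_neg this, if_neg hk.not_gt, add_zero]
  rw [Finset.sum_add_distrib] at hs hs'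
  rw [Finset.sum_ite_eq' Finset.univ _ fun _ => C, if_pos (Finset.mem_univ _)] at hs'
  rw [eq_sub_of_add_eq hs, eq_sub_of_add_eq hs']
  push_cast
  module

/-- A closed family of forms of bidegree `(p + 1, j - p - 1)`, with `j - p - 1 ≥ 1`, consists of the
derivatives of a form of bidegree `(p, j - p)`. -/
theorem exists_shearDeriv_sub_mem (hl : 1 ≤ l) (hp : p + 2 ≤ j)
    {β : GrModel l R →ₗ[ℝ] SymForm j (Split l R) N}
    (hβ : ∀ A, β A ∈ vanishing (p + 2) (baseDirection l R))
    (hc : ∀ A B, shearDeriv (β A) B - shearDeriv (β B) A ∈ vanishing (p + 2) (baseDirection l R)) :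
    ∃ g ∈ (vanishing (p + 1) (baseDirection l R) : Submodule ℝ (SymForm j (Split l R) N)),
      ∀ A, shearDeriv g A - β A ∈ vanishing (p + 1) (baseDirection l R) := by
  have hl0 : (l + p : ℝ) ≠ 0 := by
    have : (1 : ℝ) ≤ l := by exact_mod_cast hl
    positivity
  have hj0 : (j - p : ℝ) ≠ 0 := by
    have : (p + 2 : ℝ) ≤ j := by exact_mod_cast hp
    linarith
  have hmem := primitive_mem hβ
  -- On p + 1 copies of x, the derivative of the primitive along A is (p + 1)(j - p) times a trace,
  -- and p + 1 times this trace is l + p times the value of β A. The two inverses remove the factors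
  -- j - p and l + p.
  refine ⟨((j - p : ℝ)⁻¹ * (l + p : ℝ)⁻¹) • primitive β, Submodule.smul_mem _ _ hmem, fun A => ?_⟩
  refine mem_vanishing_of_pattern (by omega)
    (Submodule.sub_mem _ (shearDeriv_mem (Submodule.smul_mem _ _ hmem) A) (hβ A)) fun x y => ?_
  have h1 := mixed_eq_sum hp x y y hc A
  have h2 := primitive_pattern hp hc x (A x) y
  have h3 := shearDeriv_pattern (a := p + 1) (by omega) (primitive β) A x y
    (i := ⟨0, by omega⟩) (by simp)
  rw [h2, smul_comm] at h3
  push_cast at h3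
  rw [← h1, mixed_self] at h3
  rw [map_smul]
  simp only [LinearMap.smul_apply, Submodule.coe_sub, Submodule.coe_smul, sub_apply, smul_apply]
  rw [h3, smul_smul, smul_smul, sub_eq_zero]
  convert one_smul ℝ _ using 2
  field_simp

end Primitive

/-! ### Injectivity and exactness for classes of forms -/

section Fibers

variable {j l p : ℕ} {R N : Type*} [NormedAddCommGroup R] [NormedSpace ℝ R]
  [FiniteDimensional ℝ R] [NormedAddCommGroup N] [NormedSpace ℝ N] [FiniteDimensional ℝ N]

namespace LeafFiber

theorem eq_zero_of_proj_of_deriv (hl : 1 ≤ l) (hp : p + 1 ≤ j) {y : LeafFiber j l R N p}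
    (h1 : proj y = 0) (h2 : ∀ A, deriv y A = 0) : y = 0 := by
  obtain ⟨f, rfl⟩ := mk_surjective y
  exact mk_eq_zero_iff.2 (mem_vanishing_of_shearDeriv hl hp (mk_eq_zero_iff.1 h1) fun A =>
    mk_eq_zero_iff.1 (h2 A))

/-- After subtracting the derivatives of an arbitrary lift `y₀` of y, the family projects to zero
and is still closed, because derivatives along shears commute. A linear choice of representatives
makes it a family of forms; its primitive corrects `y₀` without changing the projection. -/
theorem exists_proj_deriv_eq (hl : 1 ≤ l) (hp : p + 2 ≤ j)
    (B : GrModel l R →ₗ[ℝ] LeafFiber j l R N (p + 1)) (y : LeafFiber j l R N (p + 1))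
    (h1 : ∀ A, proj (B A) = deriv y A) (h2 : ∀ A A', deriv (B A) A' = deriv (B A') A) :
    ∃ z : LeafFiber j l R N p, proj z = y ∧ ∀ A, deriv z A = B A := by
  obtain ⟨y₀, rfl⟩ := proj_surjective y
  obtain ⟨σ, hσ⟩ := LinearMap.exists_rightInverse_of_surjective
    (LeafFiber.mk : _ →ₗ[ℝ] LeafFiber j l R N (p + 1))
    (LinearMap.range_eq_top.2 LeafFiber.mk_surjective)
  let β := σ.comp (B - deriv y₀)
  have hβ (A : GrModel l R) : (mk (β A) : LeafFiber j l R N (p + 1)) = B A - deriv y₀ A :=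
    LinearMap.congr_fun hσ _
  obtain ⟨g, hg, hgβ⟩ := exists_shearDeriv_sub_mem hl hp (β := β) (fun A => by
    rw [← mk_eq_zero_iff, ← proj_mk, hβ, map_sub, h1, proj_deriv, sub_self]) fun A A' => by
    rw [← mk_eq_zero_iff, map_sub, ← deriv_mk, ← deriv_mk, hβ, hβ, map_sub, map_sub,
      LinearMap.sub_apply, LinearMap.sub_apply, h2, deriv_comm, sub_self]
  refine ⟨y₀ + mk g, ?_, fun A => ?_⟩
  · rw [map_add, proj_mk, mk_eq_zero_iff.2 hg, add_zero]
  · rw [map_add, LinearMap.add_apply, deriv_mk, mk_eq_iff.2 (hgβ A), hβ]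
    abel

end LeafFiber

end Fibers

/-! ### Maps and tangent vectors read in parametrizations -/

section Naturality

variable {H M : Type*} [NormedAddCommGroup H] [NormedSpace ℝ H] [TopologicalSpace M]
  [ChartedSpace H M] {H' M' : Type*} [NormedAddCommGroup H'] [NormedSpace ℝ H']
  [TopologicalSpace M'] [ChartedSpace H' M']
  {E₁ H₁ M₁ : Type*} [NormedAddCommGroup E₁] [NormedSpace ℝ E₁] [TopologicalSpace H₁]
  [TopologicalSpace M₁] [ChartedSpace H₁ M₁] {I : ModelWithCorners ℝ E₁ H₁}

lemma IsSmoothParam.contMDiffAt_of_comp {P : H → M} (hP : IsSmoothParam P) {f : M → M₁} {z : H}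
    (h : ContMDiffAt 𝓘(ℝ, H) I ∞ (fun w => f (P w)) z) : ContMDiffAt 𝓘(ℝ, H) I ∞ f (P z) := by
  have h1 : ContMDiffAt 𝓘(ℝ, H) I ∞ (fun w => f (P w)) (invFun P (P z)) := by
    rwa [hP.inv_apply]
  refine (h1.comp (P z) (hP.contMDiffAt_inv z)).congr_of_eventuallyEq ?_
  filter_upwards [hP.range_mem_nhds z] with x hx
  simp only [comp_apply, hP.apply_inv hx]

/-- The chain rule for a map which is `F` in the charts `P` and `P'`. -/
lemma mfderiv_apply_of_comp_eq {P : H → M₁} {P' : H' → M'} {f : M₁ → M'} {F : H → H'} {z : H}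
    (hP : MDifferentiableAt 𝓘(ℝ, H) I P z) (hf : MDifferentiableAt I 𝓘(ℝ, H') f (P z))
    (hP' : MDifferentiableAt 𝓘(ℝ, H') 𝓘(ℝ, H') P' (F z)) (hF : DifferentiableAt ℝ F z)
    (h : ∀ w, f (P w) = P' (F w)) (v : H) :
    (mfderiv I 𝓘(ℝ, H') f (P z) (mfderiv 𝓘(ℝ, H) I P z v) : H') =
      mfderiv 𝓘(ℝ, H') 𝓘(ℝ, H') P' (F z) (fderiv ℝ F z v) := by
  have h1 := mfderiv_comp z hf hP
  have h2 := mfderiv_comp z hP' hF.mdifferentiableAt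
  have h3 : (mfderiv 𝓘(ℝ, H) 𝓘(ℝ, H') (f ∘ P) z v : H') =
      mfderiv 𝓘(ℝ, H) 𝓘(ℝ, H') (P' ∘ F) z v :=
    congrArg (fun g : H → M' => (mfderiv 𝓘(ℝ, H) 𝓘(ℝ, H') g z v : H')) (funext h)
  rw [h1, h2, mfderiv_eq_fderiv] at h3
  exact h3

/-- Every tangent space is by definition the model space, so vectors at points that are only
propositionally equal can be compared there without transport. -/
lemma tangentBundle_mk_eq_iff {x y : M} {u : TangentSpace 𝓘(ℝ, H) x}
    {v : TangentSpace 𝓘(ℝ, H) y} :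
    (⟨x, u⟩ : TangentBundle 𝓘(ℝ, H) M) = ⟨y, v⟩ ↔ x = y ∧ (u : H) = v := by
  constructor
  · intro h
    cases h
    exact ⟨rfl, rfl⟩
  · rintro ⟨rfl, h⟩
    have : u = v := h
    rw [this]

end Naturality

/-! ### The projection to the leaf space in adapted coordinates -/

section LeafCharts

variable {j l p : ℕ} {R N : Type*} [NormedAddCommGroup R] [NormedSpace ℝ R]
  [FiniteDimensional ℝ R] [NormedAddCommGroup N] [NormedSpace ℝ N] [FiniteDimensional ℝ N]
  {J : Type*} [AddTorsor (SymForm j R N) J]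

lemma Gr.isSmoothParam (b : Frame l R) : IsSmoothParam (Gr.param b) :=
  Gr.paramAtlas.isSmoothParam b

lemma LeafSpace.isSmoothParam (b : Frame l R) :
    IsSmoothParam (LeafSpace.param b : LeafModel j l R N p → LeafSpace j l R N J p) :=
  (LeafSpace.paramAtlas j l R N J p).isSmoothParam b

lemma LeafSpace.param_mk (b : Frame l R) (A : GrModel l R) (f : SymForm j (Split l R) N) :
    (LeafSpace.param b (A, LeafFiber.mk f) : LeafSpace j l R N J p) =
      leaf (Gr.param b A, pullback (b.adapted A : R →L[ℝ] Split l R) f +ᵥ origin j R N J) := by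
  rw [param, leaf_eq_iff]
  refine ⟨rfl, ?_⟩
  simp only [vadd_vsub_vadd_cancel_right]
  exact (pullback_mem_vanishing p (b.adapted A) (_ - f) (L := baseDirection l R)
    (fun r => Iff.rfl)).2 (LeafFiber.mk_eq_iff.1 (LeafFiber.mk_rep _))

lemma leafProj_param (b : Frame l R) (z : LeafModel j l R N p) :
    leafProj j l R N J p (LeafSpace.param b z) = LeafSpace.param b (z.1, LeafFiber.proj z.2) := by
  obtain ⟨A, y⟩ := z
  obtain ⟨f, rfl⟩ := LeafFiber.mk_surjective y
  rw [LeafFiber.proj_mk, LeafSpace.param_mk, LeafSpace.param_mk]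
  rfl

lemma toGr_param (b : Frame l R) (z : LeafModel j l R N p) :
    toGr j l R N J p (LeafSpace.param b z) = Gr.param b z.1 := rfl

/-- The map which the projection to the leaf space induces in the charts given by a frame. -/
noncomputable def leafCoord (b : Frame l R) (a : GrModel l R × SymForm j R N) :
    LeafModel j l R N p :=
  (a.1, LeafFiber.mk (pullback ((b.adapted a.1).symm : Split l R →L[ℝ] R) a.2))

lemma leaf_param (b : Frame l R) (a : GrModel l R × SymForm j R N) :
    (leaf (Gr.param b a.1, a.2 +ᵥ origin j R N J) : LeafSpace j l R N J p) =
      LeafSpace.param b (leafCoord b a) := by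
  rw [leafCoord, LeafSpace.param_mk]
  congr 3
  exact symForm_ext fun v => by simp [pullback_apply]

/-- This factorization separates the fixed frame b from the shear, so that A enters a pulled-back
form only through id + shear A. -/
lemma adapted_symm (b : Frame l R) (A : GrModel l R) :
    ((b.adapted A).symm : Split l R →L[ℝ] R) =
      (b.symm : Split l R →L[ℝ] R).comp (ContinuousLinearMap.id ℝ _ + shear A) := by
  refine ContinuousLinearMap.ext fun v => ?_
  have : (v.1, v.2 + A v.1) = v + (0, A v.1) := by ext <;> simp
  simp [Frame.adapted_symm_apply, shear_apply, this]

lemma pullback_adapted_symm (b : Frame l R) (A : GrModel l R) (f : SymForm j R N) :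
    pullback ((b.adapted A).symm : Split l R →L[ℝ] R) f =
      pullback (ContinuousLinearMap.id ℝ _ + shear A)
        (pullback (b.symm : Split l R →L[ℝ] R) f) := by
  rw [adapted_symm]
  rfl

variable (j N) in
/-- The pullback of forms by a linear map, as a linear map. -/
def pullbackₗ {R R' : Type*} [NormedAddCommGroup R] [NormedSpace ℝ R] [NormedAddCommGroup R']
    [NormedSpace ℝ R'] (T : R' →L[ℝ] R) : SymForm j R N →ₗ[ℝ] SymForm j R' N where
  toFun := pullback T
  map_add' _ _ := rfl
  map_smul' _ _ := rfl

lemma shear_add_smul (A B : GrModel l R) (t : ℝ) : shear (A + t • B) = shear A + t • shear B := by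
  ext <;> simp [shear_apply]

lemma contDiff_shear : ContDiff ℝ ∞ (shear : GrModel l R → Split l R →L[ℝ] Split l R) := by
  unfold shear
  fun_prop

lemma contDiff_leafCoord (b : Frame l R) :
    ContDiff ℝ ∞ (leafCoord b : GrModel l R × SymForm j R N → LeafModel j l R N p) := by
  unfold leafCoord
  simp_rw [pullback_adapted_symm]
  refine contDiff_fst.prodMk (contDiffOn_univ.1 (contDiff_mk_pullback ?_ ?_))
  · exact (contDiff_const.add (contDiff_shear.comp contDiff_fst)).contDiffOn
  · exact ((contDiff_of_linear (E := SymForm j R N) (F := SymForm j (Split l R) N)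
      (pullbackₗ j N (b.symm : Split l R →L[ℝ] R))).comp contDiff_snd).contDiffOn

/-- The product rule gives one term for g and, for each argument of f, a term with `shear B` in that
argument. Since shear A ∘ shear B = 0, the latter terms form the shear derivative of the already
pulled-back form. -/
lemma hasDerivAt_mk_pullback (A B : GrModel l R) (f g : SymForm j (Split l R) N) :
    HasDerivAt (fun t : ℝ => (LeafFiber.mk (pullback (ContinuousLinearMap.id ℝ _ +
      shear (A + t • B)) (f + t • g)) : LeafFiber j l R N p))
      (LeafFiber.mk (pullback (ContinuousLinearMap.id ℝ _ + shear A) g) +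
        LeafFiber.mk (shearDeriv (pullback (ContinuousLinearMap.id ℝ _ + shear A) f) B)) 0 := by
  -- A linear left inverse of the inclusion of symmetric forms extends the class map to all
  -- multilinear maps, where composition with linear maps is a differentiable operation.
  obtain ⟨P, hP⟩ := LinearMap.exists_leftInverse_of_injective
    (SymForm j (Split l R) N).subtype (Submodule.ker_subtype _)
  have hP' (f : SymForm j (Split l R) N) : P f.1 = f := LinearMap.congr_fun hP f
  let Q : ContinuousMultilinearMap ℝ (fun _ : Fin j => Split l R) N →L[ℝ]
      LeafFiber j l R N p := LinearMap.toContinuousLinearMap (LeafFiber.mk.comp P)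
  have hQ (f : SymForm j (Split l R) N) : Q f.1 = LeafFiber.mk f :=
    congrArg LeafFiber.mk (hP' f)
  let C := ContinuousMultilinearMap.compContinuousLinearMapContinuousMultilinear ℝ
    (fun _ : Fin j => Split l R) (fun _ : Fin j => Split l R) N
  let T : ℝ → Fin j → Split l R →L[ℝ] Split l R := fun t _ =>
    ContinuousLinearMap.id ℝ _ + shear (A + t • B)
  have hT : HasDerivAt T (fun _ => shear B) 0 := by
    refine hasDerivAt_pi.2 fun i => ?_
    simp only [T, shear_add_smul]
    simpa using (((hasDerivAt_id (0 : ℝ)).smul_const (shear B)).const_add (shear A)).const_add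
      (ContinuousLinearMap.id ℝ (Split l R))
  have hC := (C.hasFDerivAt (T 0)).comp_hasDerivAt (0 : ℝ) hT
  have hf : HasDerivAt (fun t : ℝ => f.1 + t • g.1) g.1 0 := by
    simpa using ((hasDerivAt_id (0 : ℝ)).smul_const g.1).const_add f.1
  have h1 := Q.hasFDerivAt.comp_hasDerivAt (0 : ℝ) (hC.clm_apply hf)
  have hT0 : T 0 = fun _ => ContinuousLinearMap.id ℝ _ + shear A := by simp [T]
  convert! h1 using 1
  · ext t
    exact (hQ _).symm
  · rw [map_add, add_comm]
    congr 1
    · rw [← hQ]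
      refine congrArg Q (ContinuousMultilinearMap.ext fun v => ?_)
      rw [shearDeriv_apply, ContinuousMultilinearMap.linearDeriv_apply, sum_apply, sum_apply]
      refine Finset.sum_congr rfl fun i _ => ?_
      rw [pullback_apply, zero_smul, add_zero]
      change _ = f.1 fun k => update (T 0) i (shear B) k (v k)
      refine congrArg f.1 (funext fun k => ?_)
      rcases eq_or_ne k i with rfl | hk
      · simp [shear_apply]
      · simp [hk, hT0]
    · rw [← hQ]
      refine congrArg Q (ContinuousMultilinearMap.ext fun v => ?_)
      rw [pullback_apply]
      change _ = g.1 fun k => T 0 k (v k)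
      rw [hT0]

lemma fderiv_leafCoord (b : Frame l R) (a u : GrModel l R × SymForm j R N) :
    fderiv ℝ (leafCoord b : _ → LeafModel j l R N p) a u =
      (u.1, LeafFiber.mk (pullback ((b.adapted a.1).symm : Split l R →L[ℝ] R) u.2) +
        LeafFiber.mk
          (shearDeriv (pullback ((b.adapted a.1).symm : Split l R →L[ℝ] R) a.2) u.1)) := by
  have h1 : HasDerivAt (fun t : ℝ => a + t • u) u 0 := by
    simpa using ((hasDerivAt_id (0 : ℝ)).smul_const u).const_add a
  have h2 : HasFDerivAt (leafCoord b : _ → LeafModel j l R N p) (fderiv ℝ (leafCoord b) a)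
      (a + (0 : ℝ) • u) := by
    rw [zero_smul, add_zero]
    exact ((contDiff_leafCoord b).contDiffAt.differentiableAt (by simp)).hasFDerivAt
  have h3 := h2.comp_hasDerivAt (0 : ℝ) h1
  have h4 := ((hasDerivAt_id (0 : ℝ)).smul_const u.1).const_add a.1
  have h5 := h4.prodMk (hasDerivAt_mk_pullback (p := p) a.1 u.1
    (pullback (b.symm : Split l R →L[ℝ] R) a.2) (pullback (b.symm : Split l R →L[ℝ] R) u.2))
  have h6 : (leafCoord b : _ → LeafModel j l R N p) ∘ (fun t : ℝ => a + t • u) = fun t : ℝ =>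
      (a.1 + id t • u.1, LeafFiber.mk (pullback (ContinuousLinearMap.id ℝ _ +
        shear (a.1 + t • u.1)) (pullback (b.symm : Split l R →L[ℝ] R) a.2 +
          t • pullback (b.symm : Split l R →L[ℝ] R) u.2))) := by
    ext t : 1
    simp only [comp_apply, leafCoord, pullback_adapted_symm]
    rfl
  rw [h6] at h3
  have h7 := h3.unique h5
  rw [one_smul] at h7
  rw [h7, pullback_adapted_symm, pullback_adapted_symm]

end LeafCharts

/-! ### The reduced distribution as the kernel of the contact form -/

section ReducedDist

variable {j l p : ℕ} {R N : Type*} [NormedAddCommGroup R] [NormedSpace ℝ R]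
  [FiniteDimensional ℝ R] [NormedAddCommGroup N] [NormedSpace ℝ N] [FiniteDimensional ℝ N]
  {J : Type*} [AddTorsor (SymForm j R N) J] [TopologicalSpace J] [ChartedSpace (SymForm j R N) J]

variable (j R N J) in
/-- The smooth structure of `J` is that of an affine space, with the translations as charts. -/
structure IsAffineManifold : Prop where
  isSmoothParam : IsSmoothParam fun f : SymForm j R N => f +ᵥ origin j R N J
  mfderiv_eq : ∀ f v : SymForm j R N, (mfderiv 𝓘(ℝ, SymForm j R N) 𝓘(ℝ, SymForm j R N)
    (fun f : SymForm j R N => f +ᵥ origin j R N J) f v : SymForm j R N) = v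

/-- The kernel of the differential of the projection to J is the whole Grassmannian factor, so only
the second component is constrained. -/
lemma mem_flagDist {x : Gr l R × J}
    {w : TangentSpace (𝓘(ℝ, GrModel l R).prod 𝓘(ℝ, SymForm j R N)) x} :
    w ∈ flagDist (j := j) (N := N) p x ↔
      (w : GrModel l R × SymForm j R N).2 ∈ vanishing (p + 1) x.1.1 := by
  have hker : LinearMap.ker (mfderiv (𝓘(ℝ, GrModel l R).prod 𝓘(ℝ, SymForm j R N))
      𝓘(ℝ, SymForm j R N) (Prod.snd : Gr l R × J → J) x).toLinearMap =
      LinearMap.ker (LinearMap.snd ℝ (GrModel l R) (SymForm j R N)) := by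
    rw [mfderiv_snd]
    rfl
  rw [flagDist, hker]
  constructor
  · intro h
    obtain ⟨u, hu, v, hv, rfl⟩ := Submodule.mem_sup.1 h
    have hv' : (v : GrModel l R × SymForm j R N).2 = 0 := hv
    have hu' : (u : GrModel l R × SymForm j R N).2 ∈ vanishing (p + 1) x.1.1 := hu.2
    change (u : GrModel l R × SymForm j R N).2 + (v : GrModel l R × SymForm j R N).2 ∈ _
    rwa [hv', add_zero]
  · intro h
    refine Submodule.mem_sup.2 ⟨((0, (w : GrModel l R × SymForm j R N).2) :
      GrModel l R × SymForm j R N), ⟨rfl, h⟩,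
      (((w : GrModel l R × SymForm j R N).1, 0) : GrModel l R × SymForm j R N), rfl, ?_⟩
    exact Prod.ext (zero_add _) (add_zero _)

/-- The parametrization of `Gr(R, l) × J` given by a frame. -/
noncomputable def prodParam (b : Frame l R) (a : GrModel l R × SymForm j R N) : Gr l R × J :=
  (Gr.param b a.1, a.2 +ᵥ origin j R N J)

lemma mdifferentiableAt_prodParam (hJ : IsAffineManifold j R N J) (b : Frame l R)
    (a : GrModel l R × SymForm j R N) :
    MDifferentiableAt 𝓘(ℝ, GrModel l R × SymForm j R N)
      (𝓘(ℝ, GrModel l R).prod 𝓘(ℝ, SymForm j R N)) (prodParam b : _ → Gr l R × J) a :=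
  ((((Gr.isSmoothParam b).smooth.comp contDiff_fst.contMDiff).prodMk
    (hJ.isSmoothParam.smooth.comp contDiff_snd.contMDiff)) a).mdifferentiableAt (by simp)

lemma mfderiv_prodParam (hJ : IsAffineManifold j R N J) (b : Frame l R)
    (a u : GrModel l R × SymForm j R N) :
    (mfderiv 𝓘(ℝ, GrModel l R × SymForm j R N)
      (𝓘(ℝ, GrModel l R).prod 𝓘(ℝ, SymForm j R N)) (prodParam b : _ → Gr l R × J) a u :
        GrModel l R × SymForm j R N) =
      (mfderiv 𝓘(ℝ, GrModel l R) 𝓘(ℝ, GrModel l R) (Gr.param b) a.1 u.1, u.2) := by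
  have h1 : MDifferentiableAt 𝓘(ℝ, GrModel l R × SymForm j R N) 𝓘(ℝ, GrModel l R)
      (Gr.param b ∘ Prod.fst) a :=
    ((Gr.isSmoothParam b).mdifferentiableAt _).comp a differentiableAt_fst.mdifferentiableAt
  have h2 : MDifferentiableAt 𝓘(ℝ, GrModel l R × SymForm j R N) 𝓘(ℝ, SymForm j R N)
      ((fun f : SymForm j R N => f +ᵥ origin j R N J) ∘ Prod.snd) a :=
    (hJ.isSmoothParam.mdifferentiableAt _).comp a differentiableAt_snd.mdifferentiableAt
  have h3 := mfderiv_prodMk h1 h2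
  have h4 := mfderiv_comp a ((Gr.isSmoothParam b).mdifferentiableAt a.1)
    (differentiableAt_fst (𝕜 := ℝ) (E := GrModel l R) (F := SymForm j R N)).mdifferentiableAt
  have h5 := mfderiv_comp a (hJ.isSmoothParam.mdifferentiableAt a.2)
    (differentiableAt_snd (𝕜 := ℝ) (E := GrModel l R) (F := SymForm j R N)).mdifferentiableAt
  rw [h4, h5, mfderiv_eq_fderiv, mfderiv_eq_fderiv, fderiv_fst, fderiv_snd] at h3
  refine (DFunLike.congr_fun h3 u).trans ?_
  exact Prod.ext rfl (hJ.mfderiv_eq _ _)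

lemma mdifferentiableAt_leaf (hJ : IsAffineManifold j R N J) (b : Frame l R)
    (a : GrModel l R × SymForm j R N) :
    MDifferentiableAt (𝓘(ℝ, GrModel l R).prod 𝓘(ℝ, SymForm j R N)) 𝓘(ℝ, LeafModel j l R N p)
      (leaf : Gr l R × J → LeafSpace j l R N J p) (prodParam b a) := by
  have h1 : ContMDiffAt (𝓘(ℝ, GrModel l R).prod 𝓘(ℝ, SymForm j R N)) 𝓘(ℝ, GrModel l R) ∞
      (fun x : Gr l R × J => invFun (Gr.param b) x.1) (prodParam b a) :=
    ContMDiffAt.comp (prodParam b a : Gr l R × J) ((Gr.isSmoothParam b).contMDiffAt_inv a.1)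
      contMDiffAt_fst
  have h2 : ContMDiffAt (𝓘(ℝ, GrModel l R).prod 𝓘(ℝ, SymForm j R N)) 𝓘(ℝ, SymForm j R N) ∞
      (fun x : Gr l R × J => invFun (fun f : SymForm j R N => f +ᵥ origin j R N J) x.2)
        (prodParam b a) :=
    ContMDiffAt.comp (prodParam b a : Gr l R × J) (hJ.isSmoothParam.contMDiffAt_inv a.2)
      contMDiffAt_snd
  have h3 := (LeafSpace.isSmoothParam (J := J) (p := p) b).smooth.contMDiffAt.comp _
    ((contDiff_leafCoord (N := N) (p := p) (j := j) b).contMDiff.contMDiffAt.comp _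
      (h1.prodMk_space h2))
  refine (h3.congr_of_eventuallyEq ?_).mdifferentiableAt (by simp)
  have h4 : ∀ᶠ x : Gr l R × J in 𝓝 (prodParam b a), x.1 ∈ range (Gr.param b) :=
    continuous_fst.continuousAt.eventually ((Gr.isSmoothParam b).range_mem_nhds a.1)
  filter_upwards [h4] with x hx
  have h5 := leaf_param (p := p) (J := J) b (invFun (Gr.param b) x.1,
    invFun (fun f : SymForm j R N => f +ᵥ origin j R N J) x.2)
  simp only [comp_apply]
  rw [← h5, (Gr.isSmoothParam b).apply_inv hx]
  exact congrArg (fun θ => leaf (x.1, θ))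
    (hJ.isSmoothParam.apply_inv ⟨x.2 -ᵥ origin j R N J, vsub_vadd _ _⟩).symm

lemma mfderiv_leaf (hJ : IsAffineManifold j R N J) (b : Frame l R)
    (a u : GrModel l R × SymForm j R N) :
    (mfderiv (𝓘(ℝ, GrModel l R).prod 𝓘(ℝ, SymForm j R N)) 𝓘(ℝ, LeafModel j l R N p)
      (leaf : Gr l R × J → LeafSpace j l R N J p) (prodParam b a)
      (mfderiv 𝓘(ℝ, GrModel l R × SymForm j R N)
        (𝓘(ℝ, GrModel l R).prod 𝓘(ℝ, SymForm j R N)) (prodParam b : _ → Gr l R × J) a u) :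
          LeafModel j l R N p) =
      mfderiv 𝓘(ℝ, LeafModel j l R N p) 𝓘(ℝ, LeafModel j l R N p)
        (LeafSpace.param b : _ → LeafSpace j l R N J p) (leafCoord b a)
        (fderiv ℝ (leafCoord b) a u) :=
  mfderiv_apply_of_comp_eq (mdifferentiableAt_prodParam hJ b a) (mdifferentiableAt_leaf hJ b a)
    ((LeafSpace.isSmoothParam b).mdifferentiableAt _)
    ((contDiff_leafCoord b).contDiffAt.differentiableAt (by simp)) (leaf_param b) u

lemma pullback_symm_mem (b : Frame l R) (A : GrModel l R) {f : SymForm j R N} :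
    pullback ((b.adapted A).symm : Split l R →L[ℝ] R) f ∈ vanishing p (baseDirection l R) ↔
      f ∈ vanishing p (Gr.param b A).1 := by
  refine pullback_mem_vanishing p (b.adapted A).symm f (L := (Gr.param b A).1) fun v => ?_
  rw [Gr.mem_param, Frame.adapted_symm_apply]
  simp [mem_baseDirection]

/-- A vector of F^p has its second component in μ^{p+1}, which disappears after the projection to
classes modulo μ^{p+1}. Only the derivative term caused by the motion of the l-plane survives, and
this is the equation of the kernel. -/
lemma reducedDist_param_le (hJ : IsAffineManifold j R N J) (b : Frame l R)
    (z : LeafModel j l R N p) :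
    reducedDist j l R N J p (LeafSpace.param b z) ≤
      (LinearMap.ker (contactForm z).toLinearMap).map
        (mfderiv 𝓘(ℝ, LeafModel j l R N p) 𝓘(ℝ, LeafModel j l R N p)
          (LeafSpace.param b : _ → LeafSpace j l R N J p) z).toLinearMap := by
  refine Submodule.span_le.2 ?_
  rintro v ⟨x, w, hw, hv⟩
  obtain ⟨hx, hv⟩ := tangentBundle_mk_eq_iff.1 hv
  obtain ⟨a, rfl⟩ : ∃ a, (prodParam b a : Gr l R × J) = x :=
    ⟨(z.1, x.2 -ᵥ origin j R N J), Prod.ext ((congrArg (toGr j l R N J p) hx).symm)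
      (vsub_vadd x.2 (origin j R N J))⟩
  obtain rfl : leafCoord b a = z :=
    (LeafSpace.isSmoothParam (J := J) b).injective ((leaf_param b a).symm.trans hx)
  have hw2 := mem_flagDist.1 hw
  obtain ⟨A', hA'⟩ := (Gr.isSmoothParam b).mfderiv_surjective a.1
    (w : GrModel l R × SymForm j R N).1
  have hwu : (mfderiv 𝓘(ℝ, GrModel l R × SymForm j R N)
      (𝓘(ℝ, GrModel l R).prod 𝓘(ℝ, SymForm j R N)) (prodParam b : _ → Gr l R × J) a
        ((A', (w : GrModel l R × SymForm j R N).2) : GrModel l R × SymForm j R N) :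
        GrModel l R × SymForm j R N) = w :=
    (mfderiv_prodParam hJ b a _).trans (Prod.ext hA' rfl)
  have h1 := mfderiv_leaf (p := p) hJ b a (A', (w : GrModel l R × SymForm j R N).2)
  refine ⟨fderiv ℝ (leafCoord b) a (A', (w : GrModel l R × SymForm j R N).2), ?_, ?_⟩
  · refine mem_ker_contactForm.2 ?_
    have h2 := LeafFiber.mk_eq_zero_iff.2 ((pullback_symm_mem b a.1).2 hw2)
    rw [fderiv_leafCoord]
    simp only [map_add, LeafFiber.proj_mk, h2, zero_add]
    exact (LeafFiber.deriv_mk _ _).symm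
  · refine Eq.trans h1.symm (Eq.trans ?_ hv)
    exact congrArg (fun u : GrModel l R × SymForm j R N =>
      (mfderiv (𝓘(ℝ, GrModel l R).prod 𝓘(ℝ, SymForm j R N)) 𝓘(ℝ, LeafModel j l R N p)
      (leaf : Gr l R × J → LeafSpace j l R N J p) (prodParam b a) u : LeafModel j l R N p)) hwu

lemma mfderiv_leafCoord_mem (hJ : IsAffineManifold j R N J) (b : Frame l R)
    {a u : GrModel l R × SymForm j R N} (h : u.2 ∈ vanishing (p + 1) (Gr.param b a.1).1) :
    mfderiv 𝓘(ℝ, LeafModel j l R N p) 𝓘(ℝ, LeafModel j l R N p)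
        (LeafSpace.param b : _ → LeafSpace j l R N J p) (leafCoord b a)
        (fderiv ℝ (leafCoord b) a u) ∈
      reducedDist j l R N J p (LeafSpace.param b (leafCoord b a)) := by
  refine Submodule.subset_span ⟨prodParam b a, mfderiv 𝓘(ℝ, GrModel l R × SymForm j R N)
    (𝓘(ℝ, GrModel l R).prod 𝓘(ℝ, SymForm j R N)) (prodParam b : _ → Gr l R × J) a u,
    mem_flagDist.2 ?_, tangentBundle_mk_eq_iff.2 ⟨leaf_param b a, mfderiv_leaf hJ b a u⟩⟩
  have := mfderiv_prodParam hJ b a u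
  exact (congrArg (· ∈ vanishing (p + 1) (Gr.param b a.1).1) (congrArg Prod.snd this)).mpr h

/-- With representatives f and g of the classes, the kernel equation says that g minus the shear
derivative of f lies in μ^{p+1}. This difference is the second component of a suitable vector of
F^p. -/
lemma exists_leafCoord_eq (b : Frame l R) {z w : LeafModel j l R N p}
    (hw : w ∈ LinearMap.ker (contactForm z).toLinearMap) :
    ∃ a u : GrModel l R × SymForm j R N, u.2 ∈ vanishing (p + 1) (Gr.param b a.1).1 ∧
      leafCoord b a = z ∧ fderiv ℝ (leafCoord b : _ → LeafModel j l R N p) a u = w := by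
  obtain ⟨A, y⟩ := z
  obtain ⟨A', y'⟩ := w
  obtain ⟨f, rfl⟩ := LeafFiber.mk_surjective y
  obtain ⟨g, rfl⟩ := LeafFiber.mk_surjective y'
  have hg := mem_ker_contactForm.1 hw
  simp only [LeafFiber.proj_mk, LeafFiber.deriv_mk] at hg
  have hT (f : SymForm j (Split l R) N) : pullback ((b.adapted A).symm : Split l R →L[ℝ] R)
      (pullback (b.adapted A : R →L[ℝ] Split l R) f) = f :=
    symForm_ext fun v => by simp [pullback_apply]
  refine ⟨(A, pullback (b.adapted A : R →L[ℝ] Split l R) f),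
    (A', pullback (b.adapted A : R →L[ℝ] Split l R) (g - shearDeriv f A')), ?_, ?_, ?_⟩
  · exact (pullback_symm_mem b A).1 ((hT _).symm ▸ LeafFiber.mk_eq_iff.1 hg)
  · rw [leafCoord, hT]
  · rw [fderiv_leafCoord, hT, hT, map_sub, sub_add_cancel]

/-- In the charts of the leaf space, the reduced distribution is the kernel of the form
`contactForm`. -/
theorem reducedDist_param (hJ : IsAffineManifold j R N J) (b : Frame l R)
    (z : LeafModel j l R N p) :
    reducedDist j l R N J p (LeafSpace.param b z) =
      (LinearMap.ker (contactForm z).toLinearMap).map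
        (mfderiv 𝓘(ℝ, LeafModel j l R N p) 𝓘(ℝ, LeafModel j l R N p)
          (LeafSpace.param b : _ → LeafSpace j l R N J p) z).toLinearMap := by
  refine le_antisymm (reducedDist_param_le hJ b z) ?_
  rintro _ ⟨w, hw, rfl⟩
  obtain ⟨a, u, hu, rfl, rfl⟩ := exists_leafCoord_eq b hw
  exact mfderiv_leafCoord_mem hJ b hu

end ReducedDist

/-! ### Projections, horizontality, integral elements and Q in charts -/

section ChartFormulas

variable {j l p : ℕ} {R N : Type*} [NormedAddCommGroup R] [NormedSpace ℝ R]
  [FiniteDimensional ℝ R] [NormedAddCommGroup N] [NormedSpace ℝ N] [FiniteDimensional ℝ N]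
  {J : Type*} [AddTorsor (SymForm j R N) J]

variable (J) in
/-- The differential of a parametrization of the leaf space. -/
noncomputable abbrev LeafSpace.dparam (b : Frame l R) (z : LeafModel j l R N p) :
    LeafModel j l R N p →ₗ[ℝ]
      TangentSpace 𝓘(ℝ, LeafModel j l R N p) (LeafSpace.param b z : LeafSpace j l R N J p) :=
  (mfderiv 𝓘(ℝ, LeafModel j l R N p) 𝓘(ℝ, LeafModel j l R N p)
    (LeafSpace.param b : _ → LeafSpace j l R N J p) z).toLinearMap

variable (J) in
/-- The plane at a point of the leaf space which a parametrization makes of a subspace of the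
model space. -/
noncomputable def LeafSpace.plane (b : Frame l R) (z : LeafModel j l R N p)
    (S : Submodule ℝ (LeafModel j l R N p)) :
    Plane (LeafModel j l R N p) (LeafSpace j l R N J p) :=
  ⟨LeafSpace.param b z, S.map (LeafSpace.dparam J b z)⟩

lemma LeafSpace.exists_param_eq (φ : LeafSpace j l R N J p) :
    ∃ (b : Frame l R) (z : LeafModel j l R N p), LeafSpace.param b z = φ :=
  LeafSpace.exists_param φ

lemma contMDiff_leafProj : ContMDiff 𝓘(ℝ, LeafModel j l R N p) 𝓘(ℝ, LeafModel j l R N (p + 1)) ∞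
    (leafProj j l R N J p) := by
  intro φ
  obtain ⟨b, z, rfl⟩ := φ.exists_param_eq
  refine (LeafSpace.isSmoothParam b).contMDiffAt_of_comp ?_
  simp only [leafProj_param]
  have h : ContDiff ℝ ∞ fun w : LeafModel j l R N p => (w.1, LeafFiber.projL w.2) := by fun_prop
  exact (LeafSpace.isSmoothParam b).smooth.contMDiffAt.comp z h.contMDiff.contMDiffAt

lemma contMDiff_toGr : ContMDiff 𝓘(ℝ, LeafModel j l R N p) 𝓘(ℝ, GrModel l R) ∞
    (toGr j l R N J p) := by
  intro φ
  obtain ⟨b, z, rfl⟩ := φ.exists_param_eq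
  refine (LeafSpace.isSmoothParam b).contMDiffAt_of_comp ?_
  exact (Gr.isSmoothParam b).smooth.contMDiffAt.comp z contDiff_fst.contMDiff.contMDiffAt

lemma mfderiv_leafProj (b : Frame l R) (z w : LeafModel j l R N p) :
    (mfderiv 𝓘(ℝ, LeafModel j l R N p) 𝓘(ℝ, LeafModel j l R N (p + 1)) (leafProj j l R N J p)
      (LeafSpace.param b z) (LeafSpace.dparam J b z w) : LeafModel j l R N (p + 1)) =
      LeafSpace.dparam J b (z.1, LeafFiber.proj z.2) (w.1, LeafFiber.proj w.2) := by
  have hF : HasFDerivAt (fun w : LeafModel j l R N p => (w.1, LeafFiber.projL w.2))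
      ((ContinuousLinearMap.fst ℝ (GrModel l R) (LeafFiber j l R N p)).prod
        (LeafFiber.projL.comp (ContinuousLinearMap.snd ℝ _ _))) z :=
    hasFDerivAt_fst.prodMk (LeafFiber.projL.hasFDerivAt.comp z hasFDerivAt_snd)
  have h := mfderiv_apply_of_comp_eq ((LeafSpace.isSmoothParam (J := J) b).mdifferentiableAt z)
    ((contMDiff_leafProj _).mdifferentiableAt (by simp))
    ((LeafSpace.isSmoothParam (J := J) b).mdifferentiableAt _) hF.differentiableAt
    (leafProj_param b) w
  rw [hF.fderiv] at h
  exact h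

lemma mfderiv_toGr (b : Frame l R) (z w : LeafModel j l R N p) :
    (mfderiv 𝓘(ℝ, LeafModel j l R N p) 𝓘(ℝ, GrModel l R) (toGr j l R N J p)
      (LeafSpace.param b z) (LeafSpace.dparam J b z w) : GrModel l R) =
      mfderiv 𝓘(ℝ, GrModel l R) 𝓘(ℝ, GrModel l R) (Gr.param b) z.1 w.1 := by
  have hF : HasFDerivAt (fun w : LeafModel j l R N p => w.1)
      (ContinuousLinearMap.fst ℝ (GrModel l R) (LeafFiber j l R N p)) z := hasFDerivAt_fst
  have h := mfderiv_apply_of_comp_eq ((LeafSpace.isSmoothParam (J := J) b).mdifferentiableAt z)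
    ((contMDiff_toGr _).mdifferentiableAt (by simp))
    ((Gr.isSmoothParam b).mdifferentiableAt _) hF.differentiableAt
    (toGr_param b) w
  rw [hF.fderiv] at h
  exact h

lemma LeafSpace.dparam_injective (b : Frame l R) (z : LeafModel j l R N p) :
    Injective (LeafSpace.dparam J b z) :=
  (LeafSpace.isSmoothParam b).mfderiv_injective z

lemma LeafSpace.exists_map_dparam (b : Frame l R) (z : LeafModel j l R N p)
    (S : Submodule ℝ (TangentSpace 𝓘(ℝ, LeafModel j l R N p)
      (LeafSpace.param b z : LeafSpace j l R N J p))) :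
    ∃ S' : Submodule ℝ (LeafModel j l R N p), S'.map (LeafSpace.dparam J b z) = S :=
  ⟨S.comap (LeafSpace.dparam J b z), Submodule.map_comap_eq_of_surjective
    ((LeafSpace.isSmoothParam b).mfderiv_surjective z) S⟩

/-- Pulling a plane back through the invertible differential of a parametrization reduces statements
about planes to linear algebra in the model space. -/
lemma LeafSpace.exists_plane_eq (S : Plane (LeafModel j l R N p) (LeafSpace j l R N J p)) :
    ∃ b z S', LeafSpace.plane J b z S' = S := by
  obtain ⟨φ, S⟩ := S
  obtain ⟨b, z, rfl⟩ := φ.exists_param_eq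
  obtain ⟨S', rfl⟩ := LeafSpace.exists_map_dparam b z S
  exact ⟨b, z, S', rfl⟩

lemma finrank_plane (b : Frame l R) (z : LeafModel j l R N p)
    (S : Submodule ℝ (LeafModel j l R N p)) :
    finrank ℝ (LeafSpace.plane J b z S).2 = finrank ℝ S :=
  (Submodule.equivMapOfInjective _ (LeafSpace.dparam_injective b z) S).finrank_eq.symm

lemma mfderiv_leafProj_eq_zero_iff (b : Frame l R) (z w : LeafModel j l R N p) :
    mfderiv 𝓘(ℝ, LeafModel j l R N p) 𝓘(ℝ, LeafModel j l R N (p + 1)) (leafProj j l R N J p)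
      (LeafSpace.param b z) (LeafSpace.dparam J b z w) = 0 ↔
      w.1 = 0 ∧ LeafFiber.proj w.2 = 0 := by
  have h1 : LeafSpace.dparam J b (z.1, LeafFiber.proj z.2) (w.1, LeafFiber.proj w.2) = 0 ↔
      (w.1, LeafFiber.proj w.2) = (0 : LeafModel j l R N (p + 1)) :=
    map_eq_zero_iff _ (LeafSpace.dparam_injective b _)
  rw [Prod.mk_eq_zero] at h1
  rw [← h1]
  exact Eq.congr_left (mfderiv_leafProj (J := J) b z w)

lemma isHorizontal_leafProj_plane (b : Frame l R) (z : LeafModel j l R N p)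
    (S : Submodule ℝ (LeafModel j l R N p)) :
    IsHorizontal (LeafModel j l R N (p + 1)) (leafProj j l R N J p) (LeafSpace.plane J b z S).1
        (LeafSpace.plane J b z S).2 ↔
      ∀ w ∈ S, w.1 = 0 → LeafFiber.proj w.2 = 0 → w = 0 := by
  have key := mfderiv_leafProj_eq_zero_iff (J := J) b z
  rw [IsHorizontal, Submodule.disjoint_def]
  constructor
  · intro h w hw h1 h2
    exact (map_eq_zero_iff _ (LeafSpace.dparam_injective (J := J) b z)).1
      (h _ ⟨w, hw, rfl⟩ ((key w).2 ⟨h1, h2⟩))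
  · rintro h _ ⟨w, hw, rfl⟩ h1
    obtain ⟨h2, h3⟩ := (key w).1 h1
    exact (map_eq_zero_iff _ (LeafSpace.dparam_injective (J := J) b z)).2 (h w hw h2 h3)

lemma isHorizontal_toGr_plane (b : Frame l R) (z : LeafModel j l R N p)
    (S : Submodule ℝ (LeafModel j l R N p)) :
    IsHorizontal (GrModel l R) (toGr j l R N J p) (LeafSpace.plane J b z S).1
        (LeafSpace.plane J b z S).2 ↔
      ∀ w ∈ S, w.1 = 0 → w = 0 := by
  have key (w : LeafModel j l R N p) : mfderiv 𝓘(ℝ, LeafModel j l R N p)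
      𝓘(ℝ, GrModel l R) (toGr j l R N J p)
      (LeafSpace.param b z) (LeafSpace.dparam J b z w) = 0 ↔ w.1 = 0 := by
    have h1 : mfderiv 𝓘(ℝ, GrModel l R) 𝓘(ℝ, GrModel l R) (Gr.param b) z.1 w.1 = 0 ↔ w.1 = 0 :=
      map_eq_zero_iff _ ((Gr.isSmoothParam b).mfderiv_injective _)
    rw [← h1]
    exact Eq.congr_left (mfderiv_toGr (J := J) b z w)
  rw [IsHorizontal, Submodule.disjoint_def]
  constructor
  · intro h w hw h1
    exact (map_eq_zero_iff _ (LeafSpace.dparam_injective (J := J) b z)).1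
      (h _ ⟨w, hw, rfl⟩ ((key w).2 h1))
  · rintro h _ ⟨w, hw, rfl⟩ h1
    exact (map_eq_zero_iff _ (LeafSpace.dparam_injective (J := J) b z)).2 (h w hw ((key w).1 h1))

/-- Both tangent spaces are the model space, so membership can be compared there and no
heterogeneous equality of subspaces is needed. -/
lemma plane_ext {H M : Type*} [NormedAddCommGroup H] [NormedSpace ℝ H] [TopologicalSpace M]
    [ChartedSpace H M] {x y : M} {S : Submodule ℝ (TangentSpace 𝓘(ℝ, H) x)}
    {S' : Submodule ℝ (TangentSpace 𝓘(ℝ, H) y)} (h : x = y)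
    (hS : ∀ v : H, (v : TangentSpace 𝓘(ℝ, H) x) ∈ S ↔
      (v : TangentSpace 𝓘(ℝ, H) y) ∈ S') : (⟨x, S⟩ : Plane H M) = ⟨y, S'⟩ := by
  subst h
  obtain rfl : S = S' := Submodule.ext hS
  rfl

variable [TopologicalSpace J] [ChartedSpace (SymForm j R N) J] (hJ : IsAffineManifold j R N J)
include hJ

lemma plane_le_reducedDist_iff (b : Frame l R) (z : LeafModel j l R N p)
    (S : Submodule ℝ (LeafModel j l R N p)) :
    (LeafSpace.plane J b z S).2 ≤ reducedDist j l R N J p (LeafSpace.plane J b z S).1 ↔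
      ∀ w ∈ S, LeafFiber.proj w.2 = LeafFiber.deriv z.2 w.1 := by
  have h1 : S.map (LeafSpace.dparam J b z) ≤ reducedDist j l R N J p (LeafSpace.param b z) ↔
      S ≤ LinearMap.ker (contactForm z).toLinearMap := by
    rw [reducedDist_param hJ]
    exact Submodule.map_le_map_iff_of_injective (LeafSpace.dparam_injective b z) _ _
  exact h1.trans (forall₂_congr fun w _ => mem_ker_contactForm)

/-- Integral elements of the reduced distribution in the charts of the leaf space. -/
lemma isIntegralElement_plane (b : Frame l R) (z : LeafModel j l R N p)
    (S : Submodule ℝ (LeafModel j l R N p)) :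
    IsIntegralElement (reducedDist j l R N J p) (LeafSpace.plane J b z S).1
        (LeafSpace.plane J b z S).2 ↔
      (∀ w ∈ S, LeafFiber.proj w.2 = LeafFiber.deriv z.2 w.1) ∧
        ∀ v ∈ S, ∀ w ∈ S, LeafFiber.deriv v.2 w.1 = LeafFiber.deriv w.2 v.1 := by
  have : CompleteSpace (LeafModel j l R N p) := FiniteDimensional.complete ℝ _
  obtain ⟨s, hs⟩ := exists_section_contactForm (j := j) (l := l) (R := R) (N := N) (p := p)
  have h := isIntegralElement_map_iff (LeafSpace.isSmoothParam (J := J) b) contDiff_contactForm hs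
    (reducedDist_param hJ b) z S
  refine Iff.trans h (and_congr (forall₂_congr fun w _ => mem_ker_contactForm) ?_)
  refine forall₂_congr fun v _ => forall₂_congr fun w _ => ?_
  rw [fderiv_contactForm, fderiv_contactForm, neg_inj]

/-- In the charts of the leaf space, `Q_φ` is the graph of the derivative of `φ`. -/
lemma qMap_param (b : Frame l R) (z : LeafModel j l R N p) :
    qMap j l R N J p (LeafSpace.param b z) = LeafSpace.plane J b (z.1, LeafFiber.proj z.2)
      (LinearMap.graph (LeafFiber.deriv z.2)) := by
  refine plane_ext (leafProj_param b z) fun v => ?_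
  have key := mfderiv_leafProj (J := J) b z
  have h1 : (v : TangentSpace 𝓘(ℝ, LeafModel j l R N (p + 1))
      (leafProj j l R N J p (LeafSpace.param b z))) ∈
        qPlane j l R N J p (LeafSpace.param b z) ↔
      ∃ w : LeafModel j l R N p, LeafFiber.proj w.2 = LeafFiber.deriv z.2 w.1 ∧
        (LeafSpace.dparam J b (z.1, LeafFiber.proj z.2) (w.1, LeafFiber.proj w.2) :
          LeafModel j l R N (p + 1)) = v := by
    rw [qPlane, reducedDist_param hJ]
    constructor
    · rintro ⟨_, ⟨w, hw, rfl⟩, rfl⟩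
      exact ⟨w, mem_ker_contactForm.1 hw, (key w).symm⟩
    · rintro ⟨w, hw, rfl⟩
      exact ⟨_, ⟨w, mem_ker_contactForm.2 hw, rfl⟩, key w⟩
  refine h1.trans ⟨?_, ?_⟩
  · rintro ⟨w, hw, rfl⟩
    exact ⟨(w.1, LeafFiber.proj w.2), (LinearMap.mem_graph_iff _ _).2 hw, rfl⟩
  -- The second component of a vector of the graph lifts through the surjective projection. The
  -- lifted vector satisfies the kernel equation and is mapped to the given one.
  · rintro ⟨⟨A, y⟩, hw, rfl⟩
    obtain ⟨y', rfl⟩ := LeafFiber.proj_surjective y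
    exact ⟨(A, y'), (LinearMap.mem_graph_iff _ _).1 hw, rfl⟩

end ChartFormulas

/-! ### The affine smooth structure on the fibre of jets -/

section Affine

variable {n m k : ℕ} [NeZero k] {E : Type*} [TopologicalSpace E]
  [ChartedSpace (EuclideanSpace ℝ (Fin (n + m))) E] [IsManifold (𝓡 (n + m)) ∞ E]

lemma Jet.isAffineManifold_fiber (θ : Jet n m E k) :
    IsAffineManifold (k + 1) θ.tangentPlane θ.NormalSpace θ.Fiber :=
  ⟨(torsorAtlas (k + 1) θ.tangentPlane θ.NormalSpace θ.Fiber).isSmoothParam (),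
    (torsorAtlas (k + 1) θ.tangentPlane θ.NormalSpace θ.Fiber).mfderiv_param_eq⟩

end Affine

/-! ### Horizontal integral elements and the planes Q -/

section IntegralElements

variable {j l p : ℕ} {R N : Type*} [NormedAddCommGroup R] [NormedSpace ℝ R]
  [FiniteDimensional ℝ R] [NormedAddCommGroup N] [NormedSpace ℝ N] [FiniteDimensional ℝ N]
  {J : Type*} [AddTorsor (SymForm j R N) J]

lemma finrank_le_of_fst_injOn {E F : Type*} [AddCommGroup E] [Module ℝ E] [AddCommGroup F]
    [Module ℝ F] [FiniteDimensional ℝ E] {S : Submodule ℝ (E × F)}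
    (h : ∀ w ∈ S, w.1 = 0 → w = 0) : finrank ℝ S ≤ finrank ℝ E := by
  refine LinearMap.finrank_le_finrank_of_injective (f := (LinearMap.fst ℝ E F).comp S.subtype) ?_
  rw [injective_iff_map_eq_zero]
  exact fun w hw => Subtype.ext (h w.1 w.2 hw)

/-- The first projection is injective on S, and by equality of dimensions it is an isomorphism onto
E. The second component, as a function of the first, is the required map. -/
lemma exists_eq_graph_of_finrank_eq {E F : Type*} [AddCommGroup E] [Module ℝ E] [AddCommGroup F]
    [Module ℝ F] [FiniteDimensional ℝ E] [FiniteDimensional ℝ F] {S : Submodule ℝ (E × F)}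
    (h : ∀ w ∈ S, w.1 = 0 → w = 0) (hS : finrank ℝ S = finrank ℝ E) :
    ∃ B : E →ₗ[ℝ] F, S = B.graph := by
  have hinj : Injective ((LinearMap.fst ℝ E F).comp S.subtype) := by
    rw [injective_iff_map_eq_zero]
    exact fun w hw => Subtype.ext (h w.1 w.2 hw)
  let e := LinearEquiv.ofInjectiveOfFinrankEq _ hinj hS
  refine ⟨(LinearMap.snd ℝ E F).comp (S.subtype.comp e.symm.toLinearMap), Submodule.ext fun w => ?_⟩
  rw [LinearMap.mem_graph_iff]
  have h1 (w : E) : (e.symm w).1.1 = w := e.apply_symm_apply w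
  constructor
  · intro hw
    have h2 : e.symm w.1 = ⟨w, hw⟩ := e.symm_apply_eq.2 rfl
    change w.2 = (e.symm w.1).1.2
    rw [h2]
  · intro hw
    have h2 : w = (e.symm w.1).1 := Prod.ext (h1 _).symm hw
    rw [h2]
    exact (e.symm w.1).2

lemma finrank_graph {E F : Type*} [AddCommGroup E] [Module ℝ E] [AddCommGroup F]
    [Module ℝ F] (B : E →ₗ[ℝ] F) : finrank ℝ B.graph = finrank ℝ E := by
  rw [LinearMap.graph_eq_range_prod]
  exact LinearMap.finrank_range_of_inj fun x y h => congrArg Prod.fst h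

lemma graph_injective {E F : Type*} [AddCommGroup E] [Module ℝ E] [AddCommGroup F]
    [Module ℝ F] : Injective (LinearMap.graph : (E →ₗ[ℝ] F) → Submodule ℝ (E × F)) := by
  intro B B' h
  ext x
  exact (LinearMap.mem_graph_iff _ (x, B x)).1 (h ▸ (LinearMap.mem_graph_iff _ _).2 rfl)

lemma LeafSpace.plane_injective {b : Frame l R} {z z' : LeafModel j l R N p}
    {S S' : Submodule ℝ (LeafModel j l R N p)}
    (h : LeafSpace.plane J b z S = LeafSpace.plane J b z' S') : z = z' ∧ S = S' := by
  obtain ⟨h1, h2⟩ := Sigma.mk.inj_iff.1 h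
  obtain rfl := LeafSpace.param_injective b h1
  exact ⟨rfl, Submodule.map_injective_of_injective (LeafSpace.dparam_injective b z) (eq_of_heq h2)⟩

/-- Whether a point lies in the chart of b depends only on its l-plane, so one frame works
simultaneously on all levels of the tower. -/
lemma LeafSpace.mem_range_param_iff (b : Frame l R) (φ : LeafSpace j l R N J p) :
    φ ∈ range (LeafSpace.param b) ↔ toGr j l R N J p φ ∈ range (Gr.param b) := by
  obtain ⟨b', z, rfl⟩ := φ.exists_param_eq
  exact Set.ext_iff.1 (LeafSpace.overlap_eq b' b) z

variable [TopologicalSpace J] [ChartedSpace (SymForm j R N) J] (hJ : IsAffineManifold j R N J)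
include hJ

/-- For a vector of the distribution, the projection of its fibre component is the derivative along
its Grassmannian component. If the latter is zero, the vector is killed by the projection to the
next level as well. -/
theorem isHorizontal_leafProj_iff (x : LeafSpace j l R N J p)
    (S : Submodule ℝ (TangentSpace 𝓘(ℝ, LeafModel j l R N p) x))
    (hS : S ≤ reducedDist j l R N J p x) :
    IsHorizontal (LeafModel j l R N (p + 1)) (leafProj j l R N J p) x S ↔
      IsHorizontal (GrModel l R) (toGr j l R N J p) x S := by
  have key (P : Plane (LeafModel j l R N p) (LeafSpace j l R N J p))
      (hP : P.2 ≤ reducedDist j l R N J p P.1) :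
      IsHorizontal (LeafModel j l R N (p + 1)) (leafProj j l R N J p) P.1 P.2 ↔
        IsHorizontal (GrModel l R) (toGr j l R N J p) P.1 P.2 := by
    obtain ⟨b, z, S, rfl⟩ := LeafSpace.exists_plane_eq P
    rw [isHorizontal_leafProj_plane, isHorizontal_toGr_plane]
    refine forall₂_congr fun w hw => forall_congr' fun h1 => ?_
    have := (plane_le_reducedDist_iff hJ b z S).1 hP w hw
    rw [h1, map_zero] at this
    exact forall_prop_of_true this
  exact key ⟨x, S⟩ hS

lemma finrank_le_of_isHorizontal (x : LeafSpace j l R N J p)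
    (S : Submodule ℝ (TangentSpace 𝓘(ℝ, LeafModel j l R N p) x))
    (hS : S ≤ reducedDist j l R N J p x)
    (h : IsHorizontal (LeafModel j l R N (p + 1)) (leafProj j l R N J p) x S) :
    finrank ℝ S ≤ finrank ℝ (GrModel l R) := by
  rw [isHorizontal_leafProj_iff hJ x S hS] at h
  have key (P : Plane (LeafModel j l R N p) (LeafSpace j l R N J p))
      (hP : IsHorizontal (GrModel l R) (toGr j l R N J p) P.1 P.2) :
      finrank ℝ P.2 ≤ finrank ℝ (GrModel l R) := by
    obtain ⟨b, z, S, rfl⟩ := LeafSpace.exists_plane_eq P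
    rw [finrank_plane]
    exact finrank_le_of_fst_injOn ((isHorizontal_toGr_plane b z S).1 hP)
  exact key ⟨x, S⟩ h

lemma finrank_qMap (φ : LeafSpace j l R N J p) :
    finrank ℝ (qMap j l R N J p φ).2 = finrank ℝ (GrModel l R) := by
  obtain ⟨b, z, rfl⟩ := φ.exists_param_eq
  rw [qMap_param hJ, finrank_plane, finrank_graph]

/-- For the graph of the derivative of a class, the kernel equation says that projection and
derivative commute, and the symmetry condition says that two derivatives along shears commute. -/
lemma isIntegralElement_qMap (φ : LeafSpace j l R N J p) :
    IsIntegralElement (reducedDist j l R N J (p + 1)) (qMap j l R N J p φ).1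
      (qMap j l R N J p φ).2 := by
  obtain ⟨b, z, rfl⟩ := φ.exists_param_eq
  rw [qMap_param hJ, isIntegralElement_plane hJ]
  constructor
  · intro w hw
    rw [(LinearMap.mem_graph_iff _ _).1 hw, LeafFiber.proj_deriv]
  · intro v hv w hw
    rw [(LinearMap.mem_graph_iff _ _).1 hv, (LinearMap.mem_graph_iff _ _).1 hw,
      LeafFiber.deriv_comm]

lemma isHorizontal_toGr_qMap (φ : LeafSpace j l R N J p) :
    IsHorizontal (GrModel l R) (toGr j l R N J (p + 1)) (qMap j l R N J p φ).1
      (qMap j l R N J p φ).2 := by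
  obtain ⟨b, z, rfl⟩ := φ.exists_param_eq
  rw [qMap_param hJ, isHorizontal_toGr_plane]
  intro w hw h1
  have h2 := (LinearMap.mem_graph_iff _ _).1 hw
  rw [h1, map_zero] at h2
  exact Prod.ext h1 h2

theorem isHorizontalMaximal_qMap (φ : LeafSpace j l R N J p) :
    IsHorizontalMaximal (LeafModel j l R N (p + 2)) (reducedDist j l R N J (p + 1))
      (leafProj j l R N J (p + 1)) (qMap j l R N J p φ).1 (qMap j l R N J p φ).2 := by
  have h := isIntegralElement_qMap hJ φ
  refine ⟨h, (isHorizontal_leafProj_iff hJ _ _ h.1).2 (isHorizontal_toGr_qMap hJ φ),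
    fun Q hQ hQ' => ?_⟩
  rw [finrank_qMap hJ]
  exact finrank_le_of_isHorizontal hJ _ Q hQ.1 hQ'

/-- Equal planes have the same base point, hence the two points lie in a common chart. There the
classes have the same projection and the same derivatives. -/
theorem qMap_injective (hl : 1 ≤ l) (hp : p + 1 ≤ j) : Injective (qMap j l R N J p) := by
  intro φ ψ h
  obtain ⟨b, z, rfl⟩ := φ.exists_param_eq
  obtain ⟨z', rfl⟩ : ψ ∈ range (LeafSpace.param b) := by
    rw [LeafSpace.mem_range_param_iff]
    have h1 : leafProj j l R N J p (LeafSpace.param b z) = leafProj j l R N J p ψ :=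
      congrArg Sigma.fst h
    have h2 : leafProj j l R N J p ψ ∈ range (LeafSpace.param b) :=
      ⟨_, (leafProj_param b z).symm.trans h1⟩
    rw [LeafSpace.mem_range_param_iff] at h2
    obtain ⟨x, rfl⟩ := Quotient.exists_rep ψ
    exact h2
  rw [qMap_param hJ, qMap_param hJ] at h
  obtain ⟨h1, h2⟩ := LeafSpace.plane_injective h
  obtain ⟨h3, h4⟩ := Prod.mk_inj.1 h1
  have h5 := graph_injective h2
  have h6 : z.2 - z'.2 = 0 := by
    refine LeafFiber.eq_zero_of_proj_of_deriv hl hp ?_ fun A => ?_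
    · rw [map_sub, h4, sub_self]
    · rw [map_sub, h5, sub_self]
      rfl
  rw [Prod.ext h3 (sub_eq_zero.1 h6)]

/-- A horizontal plane of full dimension is the graph of a linear map B in a chart. Integrality of
the graph is exactly the hypothesis of the exactness theorem, which supplies the point φ. -/
theorem exists_qMap_eq (hl : 1 ≤ l) (hp : p + 2 ≤ j)
    {S : Plane (LeafModel j l R N (p + 1)) (LeafSpace j l R N J (p + 1))}
    (h1 : IsIntegralElement (reducedDist j l R N J (p + 1)) S.1 S.2)
    (h2 : IsHorizontal (GrModel l R) (toGr j l R N J (p + 1)) S.1 S.2)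
    (h3 : finrank ℝ S.2 = finrank ℝ (GrModel l R)) : ∃ φ, qMap j l R N J p φ = S := by
  obtain ⟨b, ⟨A, y⟩, S, rfl⟩ := LeafSpace.exists_plane_eq S
  rw [isHorizontal_toGr_plane] at h2
  rw [finrank_plane] at h3
  obtain ⟨B, rfl⟩ := exists_eq_graph_of_finrank_eq h2 h3
  rw [isIntegralElement_plane hJ] at h1
  have hB (A : GrModel l R) : (A, B A) ∈ B.graph := (LinearMap.mem_graph_iff _ _).2 rfl
  obtain ⟨z, rfl, hz⟩ := LeafFiber.exists_proj_deriv_eq hl hp B y (fun A => h1.1 _ (hB A))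
    fun A A' => h1.2 _ (hB A) _ (hB A')
  refine ⟨LeafSpace.param b (A, z), (qMap_param hJ b (A, z)).trans ?_⟩
  rw [LinearMap.ext hz]

lemma leafProj_surjective : Surjective (leafProj j l R N J p) := by
  intro φ
  obtain ⟨x, rfl⟩ := Quotient.exists_rep φ
  exact ⟨leaf x, rfl⟩

/-- Some Q_φ exists over every point, so the largest dimension is that of the Grassmannian. This
makes every horizontal maximal element one of full dimension. -/
theorem exists_qMap_eq_of_isHorizontalMaximal (hl : 1 ≤ l) (hp : p + 2 ≤ j)
    (x : LeafSpace j l R N J (p + 1))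
    (S : Submodule ℝ (TangentSpace 𝓘(ℝ, LeafModel j l R N (p + 1)) x))
    (hS : IsHorizontalMaximal (LeafModel j l R N (p + 2)) (reducedDist j l R N J (p + 1))
      (leafProj j l R N J (p + 1)) x S) :
    ∃ φ, leafProj j l R N J p φ = x ∧ qMap j l R N J p φ = ⟨x, S⟩ := by
  obtain ⟨φ, rfl⟩ := leafProj_surjective hJ x
  have h := isHorizontalMaximal_qMap hJ φ
  have h1 := (finrank_qMap hJ φ).symm.trans_le (hS.2.2 _ h.1 h.2.1)
  have h2 := finrank_le_of_isHorizontal hJ _ S hS.1.1 hS.2.1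
  obtain ⟨ψ, hψ⟩ := exists_qMap_eq hJ hl hp (S := ⟨leafProj j l R N J p φ, S⟩) hS.1
    ((isHorizontal_leafProj_iff hJ _ _ hS.1.1).1 hS.2.1) (le_antisymm h2 h1)
  exact ⟨ψ, congrArg Sigma.fst hψ, hψ⟩

/-- Taking the image and then the preimage adds only the kernel of the differential of the
projection. On this kernel both terms of the contact form vanish, so it already lies in the
distribution. -/
theorem reducedDist_eq_comap (φ : LeafSpace j l R N J p) :
    reducedDist j l R N J p φ = (qPlane j l R N J p φ).comap
      (mfderiv 𝓘(ℝ, LeafModel j l R N p) 𝓘(ℝ, LeafModel j l R N (p + 1))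
        (leafProj j l R N J p) φ).toLinearMap := by
  rw [qPlane, Submodule.comap_map_eq, eq_comm, sup_eq_left]
  obtain ⟨b, z, rfl⟩ := φ.exists_param_eq
  intro v hv
  obtain ⟨w, rfl⟩ := (LeafSpace.isSmoothParam b).mfderiv_surjective z v
  obtain ⟨h1, h2⟩ := (mfderiv_leafProj_eq_zero_iff b z w).1 hv
  rw [reducedDist_param hJ]
  refine ⟨w, mem_ker_contactForm.2 ?_, rfl⟩
  rw [h1, h2, map_zero]

end IntegralElements

/-! ### Smooth dependence of linear maps and tangent vectors on parameters -/

section SmoothFamilies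

variable {X E F G : Type*} [NormedAddCommGroup X] [NormedSpace ℝ X] [NormedAddCommGroup E]
  [NormedSpace ℝ E] [NormedAddCommGroup F] [NormedSpace ℝ F] [NormedAddCommGroup G]
  [NormedSpace ℝ G]

/-- A family of linear maps is smooth if its values on a smoothly varying basis are. -/
lemma contDiffAt_clm_of_basis [FiniteDimensional ℝ E] {ι : Type*} [Fintype ι]
    {T : X → E →L[ℝ] F} {a : ι → X → E} {t₀ : X} (ha : ∀ i, ContDiffAt ℝ ∞ (a i) t₀)
    (hT : ∀ i, ContDiffAt ℝ ∞ (fun t => T t (a i t)) t₀)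
    (hli : LinearIndependent ℝ fun i => a i t₀)
    (hspan : ⊤ ≤ Submodule.span ℝ (range fun i => a i t₀)) : ContDiffAt ℝ ∞ T t₀ := by
  -- `A t` sends the standard basis to the vectors a_i(t), and `C t` sends it to their images under
  -- T. Hence T = C ∘ A⁻¹ near t₀, where A is invertible and inversion is smooth.
  let A : X → (ι → ℝ) →L[ℝ] E := fun t =>
    ∑ i, (ContinuousLinearMap.proj (R := ℝ) (φ := fun _ : ι => ℝ) i).smulRight (a i t)
  let C : X → (ι → ℝ) →L[ℝ] F := fun t =>
    ∑ i, (ContinuousLinearMap.proj (R := ℝ) (φ := fun _ : ι => ℝ) i).smulRight (T t (a i t))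
  have hA : ContDiffAt ℝ ∞ A t₀ := ContDiffAt.sum fun i _ =>
    (ContinuousLinearMap.smulRightL ℝ (ι → ℝ) E (ContinuousLinearMap.proj i)).contDiff.contDiffAt.comp
      t₀ (ha i)
  have hC : ContDiffAt ℝ ∞ C t₀ := ContDiffAt.sum fun i _ =>
    (ContinuousLinearMap.smulRightL ℝ (ι → ℝ) F (ContinuousLinearMap.proj i)).contDiff.contDiffAt.comp
      t₀ (hT i)
  have hTA (t : X) : (T t).comp (A t) = C t := by
    ext c
    simp [A, C]
  let e := (Basis.mk hli hspan).equivFun.symm.toContinuousLinearEquiv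
  have he : (e : (ι → ℝ) →L[ℝ] E) = A t₀ := by
    ext c
    simp [e, A, Basis.equivFun_symm_apply]
  have hinv : ContDiffAt ℝ ∞ ContinuousLinearMap.inverse (A t₀) := by
    rw [← he]
    exact contDiffAt_map_inverse e
  have : CompleteSpace (ι → ℝ) := inferInstance
  have hnhds : ∀ᶠ t in 𝓝 t₀, (A t).IsInvertible := by
    refine hA.continuousAt.eventually ?_
    rw [← he]
    exact e.nhds
  refine (hC.clm_comp (hinv.comp t₀ hA)).congr_of_eventuallyEq ?_
  filter_upwards [hnhds] with t ht
  rw [← hTA, comp_apply, ContinuousLinearMap.comp_assoc, ht.self_comp_inverse,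
    ContinuousLinearMap.comp_id]

/-- An injective linear map has a linear left inverse, which is smooth because the target is
finite-dimensional. -/
lemma contDiffAt_of_injective_linear [FiniteDimensional ℝ F] {T : E →ₗ[ℝ] F} (hT : Injective T)
    {y : X → E} {t₀ : X} (h : ContDiffAt ℝ ∞ (fun t => T (y t)) t₀) : ContDiffAt ℝ ∞ y t₀ := by
  obtain ⟨L, hL⟩ := LinearMap.exists_leftInverse_of_injective T (LinearMap.ker_eq_bot.2 hT)
  have h1 (t : X) : LinearMap.toContinuousLinearMap L (T (y t)) = y t := LinearMap.congr_fun hL _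
  have h2 := (LinearMap.toContinuousLinearMap L).contDiff.contDiffAt.comp t₀ h
  exact h2.congr_of_eventuallyEq (Eventually.of_forall fun t => (h1 t).symm)

variable {H M : Type*} [NormedAddCommGroup H] [NormedSpace ℝ H] [TopologicalSpace M]
  [ChartedSpace H M] [IsManifold 𝓘(ℝ, H) ∞ M] {P : H → M} (hP : IsSmoothParam P)
include hP

lemma IsSmoothParam.contMDiffAt_tangent {ζ w : X → H} {t₀ : X} (hζ : ContDiffAt ℝ ∞ ζ t₀)
    (hw : ContDiffAt ℝ ∞ w t₀) :
    ContMDiffAt 𝓘(ℝ, X) 𝓘(ℝ, H).tangent ∞ (fun t =>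
      (⟨P (ζ t), mfderiv 𝓘(ℝ, H) 𝓘(ℝ, H) P (ζ t) (w t)⟩ : TangentBundle 𝓘(ℝ, H) M)) t₀ := by
  have h1 : ContMDiffAt 𝓘(ℝ, X) 𝓘(ℝ, H).tangent ∞
      (fun t => (⟨ζ t, w t⟩ : TangentBundle 𝓘(ℝ, H) H)) t₀ := by
    refine Bundle.contMDiffAt_totalSpace.2 ⟨hζ.contMDiffAt, ?_⟩
    convert! hw.contMDiffAt with t
    simp
  exact ((hP.smooth.contMDiff_tangentMap (m := ∞) le_rfl) _).comp t₀ h1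

/-- The tangent map of the inverse chart is smooth. It is taken within the open range of `P`, where
it agrees with the full differential. -/
lemma IsSmoothParam.contDiffAt_of_tangent {x : X → M} {s : (t : X) → TangentSpace 𝓘(ℝ, H) (x t)}
    {t₀ : X} (h : ContMDiffAt 𝓘(ℝ, X) 𝓘(ℝ, H).tangent ∞
      (fun t => (⟨x t, s t⟩ : TangentBundle 𝓘(ℝ, H) M)) t₀) (hx : x t₀ ∈ range P) :
    ContDiffAt ℝ ∞ (fun t => (mfderiv 𝓘(ℝ, H) 𝓘(ℝ, H) (invFun P) (x t) (s t) : H)) t₀ := by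
  have h1 := hP.smooth_inv.contMDiffOn_tangentMapWithin (m := ∞) le_rfl hP.isOpen_range.uniqueMDiffOn
  have hxc : ContinuousAt x t₀ :=
    (FiberBundle.continuous_proj H (TangentSpace 𝓘(ℝ, H) : M → Type _)).continuousAt.comp
      h.continuousAt
  have hU : ∀ᶠ t in 𝓝 t₀, x t ∈ range P := hxc.eventually (hP.isOpen_range.mem_nhds hx)
  have hopen : IsOpen (Bundle.TotalSpace.proj ⁻¹' range P : Set (TangentBundle 𝓘(ℝ, H) M)) :=
    hP.isOpen_range.preimage (FiberBundle.continuous_proj H (TangentSpace 𝓘(ℝ, H) : M → Type _))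
  have h2 := (h1.contMDiffAt (x := ⟨x t₀, s t₀⟩) (hopen.mem_nhds hx)).comp t₀ h
  have h3 := ((contMDiff_snd_tangentBundle_modelSpace H 𝓘(ℝ, H) (n := ∞)).contMDiffAt.comp t₀
    h2).contDiffAt
  refine h3.congr_of_eventuallyEq ?_
  filter_upwards [hU] with t ht
  have h4 : mfderivWithin 𝓘(ℝ, H) 𝓘(ℝ, H) (invFun P) (range P) (x t) =
      mfderiv 𝓘(ℝ, H) 𝓘(ℝ, H) (invFun P) (x t) :=
    mfderivWithin_of_mem_nhds (hP.isOpen_range.mem_nhds ht)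
  exact (DFunLike.congr_fun h4 (s t)).symm

end SmoothFamilies

/-! ### Smooth families of planes and the prolongation -/

section Prolongation

variable {j l p : ℕ} {R N : Type*} [NormedAddCommGroup R] [NormedSpace ℝ R]
  [FiniteDimensional ℝ R] [NormedAddCommGroup N] [NormedSpace ℝ N] [FiniteDimensional ℝ N]
  {J : Type*} [AddTorsor (SymForm j R N) J]

/-- The plane Q is kept as a variable with an equation, so that this applies to families whose base
points lie in the chart only up to a propositional equality. -/
lemma isBasis_plane_iff {ι : Type*} {b : Frame l R} {z : LeafModel j l R N p}
    {S : Submodule ℝ (LeafModel j l R N p)}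
    {Q : Plane (LeafModel j l R N p) (LeafSpace j l R N J p)} (hQ : Q = LeafSpace.plane J b z S)
    {w : ι → LeafModel j l R N p} {s : ι → TangentSpace 𝓘(ℝ, LeafModel j l R N p) Q.1}
    (hs : ∀ i, (s i : LeafModel j l R N p) = LeafSpace.dparam J b z (w i)) :
    (LinearIndependent ℝ s ∧ Submodule.span ℝ (range s) = Q.2) ↔
      LinearIndependent ℝ w ∧ Submodule.span ℝ (range w) = S := by
  have hinj := LeafSpace.dparam_injective (J := J) b z
  have key (s : ι → TangentSpace 𝓘(ℝ, LeafModel j l R N p)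
      (LeafSpace.param b z : LeafSpace j l R N J p)) (hs : s = LeafSpace.dparam J b z ∘ w) :
      (LinearIndependent ℝ s ∧
        Submodule.span ℝ (range s) = S.map (LeafSpace.dparam J b z)) ↔
      LinearIndependent ℝ w ∧ Submodule.span ℝ (range w) = S := by
    rw [hs, range_comp, ← Submodule.map_span]
    exact and_congr (LinearMap.linearIndependent_iff_of_injOn _ hinj.injOn)
      (Submodule.map_injective_of_injective hinj).eq_iff
  subst hQ
  exact key s (funext hs)

lemma dparam_mfderiv_inv {b : Frame l R} {z : LeafModel j l R N p} {x : LeafSpace j l R N J p}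
    (hx : x = LeafSpace.param b z) (u : TangentSpace 𝓘(ℝ, LeafModel j l R N p) x) :
    (u : LeafModel j l R N p) = LeafSpace.dparam J b z
      (mfderiv 𝓘(ℝ, LeafModel j l R N p) 𝓘(ℝ, LeafModel j l R N p)
        (invFun (LeafSpace.param b)) x u) := by
  subst hx
  exact ((LeafSpace.isSmoothParam b).mfderiv_mfderiv_inv z u).symm

/-- The first projection maps a graph isomorphically onto its domain, so it carries bases to bases.
-/
lemma linearIndependent_graph {E F ι : Type*} [AddCommGroup E] [Module ℝ E] [AddCommGroup F]
    [Module ℝ F] {B : E →ₗ[ℝ] F} {w : ι → E × F} (h : LinearIndependent ℝ w)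
    (hs : Submodule.span ℝ (range w) = B.graph) :
    LinearIndependent ℝ (fun i => (w i).1) ∧ ⊤ ≤ Submodule.span ℝ (range fun i => (w i).1) := by
  constructor
  · refine h.map_injOn (LinearMap.fst ℝ E F) ?_
    rw [hs]
    intro u hu v hv huv
    refine Prod.ext huv ?_
    rw [(LinearMap.mem_graph_iff _ _).1 hu, (LinearMap.mem_graph_iff _ _).1 hv]
    exact congrArg B huv
  · have h1 : Submodule.span ℝ (range fun i => (w i).1) =
        (Submodule.span ℝ (range w)).map (LinearMap.fst ℝ E F) := by
      rw [Submodule.map_span, ← range_comp]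
      rfl
    rw [h1, hs]
    exact fun x _ => ⟨(x, B x), (LinearMap.mem_graph_iff _ _).2 rfl, rfl⟩

lemma graph_basis {E F ι : Type*} [AddCommGroup E] [Module ℝ E] [AddCommGroup F]
    [Module ℝ F] (B : E →ₗ[ℝ] F) (e : Basis ι ℝ E) :
    LinearIndependent ℝ (fun i => (e i, B (e i))) ∧
      Submodule.span ℝ (range fun i => (e i, B (e i))) = B.graph := by
  constructor
  · exact LinearIndependent.of_comp (LinearMap.fst ℝ E F) e.linearIndependent
  · have h1 : (range fun i => (e i, B (e i))) = (LinearMap.id.prod B) '' range e := by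
      rw [← range_comp]
      rfl
    rw [h1, ← Submodule.map_span, e.span_eq, Submodule.map_top, LinearMap.graph_eq_range_prod]

variable [TopologicalSpace J] [ChartedSpace (SymForm j R N) J] (hJ : IsAffineManifold j R N J)
include hJ

/-- In a chart the plane at z is the graph of the derivative of the class `z.2`, so a fixed basis of
the Grassmannian model lifts to a basis of the plane depending smoothly on z. -/
lemma isSmoothPlaneFamily_qMap {r : ℕ} {g : EuclideanSpace ℝ (Fin r) → LeafSpace j l R N J p}
    (hg : ContMDiff (𝓡 r) 𝓘(ℝ, LeafModel j l R N p) ∞ g) :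
    IsSmoothPlaneFamily fun t => qMap j l R N J p (g t) := by
  intro t₀
  obtain ⟨b, hb⟩ := LeafSpace.exists_param (g t₀)
  have hP := LeafSpace.isSmoothParam (J := J) (N := N) (p := p) b
  have hP' := LeafSpace.isSmoothParam (J := J) (N := N) (p := p + 1) b
  let z : EuclideanSpace ℝ (Fin r) → LeafModel j l R N p := fun t =>
    invFun (LeafSpace.param b) (g t)
  let ζ : EuclideanSpace ℝ (Fin r) → LeafModel j l R N (p + 1) := fun t =>
    ((z t).1, LeafFiber.projL (z t).2)
  let e := finBasis ℝ (GrModel l R)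
  let w : Fin (finrank ℝ (GrModel l R)) → EuclideanSpace ℝ (Fin r) →
    LeafModel j l R N (p + 1) := fun i t => (e i, LeafFiber.derivL (z t).2 (e i))
  refine ⟨g ⁻¹' range (LeafSpace.param b),
    hg.continuous.continuousAt.preimage_mem_nhds (hP.isOpen_range.mem_nhds hb), _,
    fun i t => (LeafSpace.dparam J b (ζ t) (w i t) : LeafModel j l R N (p + 1)), ?_, ?_⟩
  · intro i t ht
    have hz : ContDiffAt ℝ ∞ z t :=
      (((hP.smooth_inv _ ht).contMDiffAt (hP.isOpen_range.mem_nhds ht)).comp t (hg t)).contDiffAt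
    have hζ : ContDiffAt ℝ ∞ ζ t := by
      have : ContDiff ℝ ∞ fun u : LeafModel j l R N p => (u.1, LeafFiber.projL u.2) := by fun_prop
      exact this.contDiffAt.comp t hz
    have hw : ContDiffAt ℝ ∞ (w i) t := by
      have : ContDiff ℝ ∞ fun u : LeafModel j l R N p => (e i, LeafFiber.derivL u.2 (e i)) :=
        contDiff_const.prodMk
          ((LeafFiber.derivL.contDiff.comp contDiff_snd).clm_apply contDiff_const)
      exact this.contDiffAt.comp t hz
    refine ((hP'.contMDiffAt_tangent hζ hw).congr_of_eventuallyEq ?_).contMDiffWithinAt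
    filter_upwards [hg.continuous.continuousAt.preimage_mem_nhds (hP.isOpen_range.mem_nhds ht)]
      with u hu
    refine tangentBundle_mk_eq_iff.2 ⟨?_, rfl⟩
    have h1 := leafProj_param (J := J) b (z u)
    rwa [show LeafSpace.param b (z u) = g u from hP.apply_inv hu] at h1
  · intro t ht
    have h1 := qMap_param hJ b (z t)
    rw [show LeafSpace.param b (z t) = g t from hP.apply_inv ht] at h1
    refine (isBasis_plane_iff (w := fun i => w i t) h1 fun i => rfl).2 ?_
    exact graph_basis (LeafFiber.deriv (z t).2) e

/-- A smooth basis of the planes determines the linear maps of which they are graphs, and these are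
the derivatives of the class. With the base point, which is the projection of the class, they
determine the class through a fixed linear left inverse. -/
lemma contMDiff_of_isSmoothPlaneFamily_qMap (hl : 1 ≤ l) (hp : p + 1 ≤ j) {r : ℕ}
    {g : EuclideanSpace ℝ (Fin r) → LeafSpace j l R N J p}
    (hx : ContMDiff (𝓡 r) 𝓘(ℝ, LeafModel j l R N (p + 1)) ∞ fun t => leafProj j l R N J p (g t))
    (hQ : IsSmoothPlaneFamily fun t => qMap j l R N J p (g t)) :
    ContMDiff (𝓡 r) 𝓘(ℝ, LeafModel j l R N p) ∞ g := by
  intro t₀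
  obtain ⟨b, hb⟩ := LeafSpace.exists_param (leafProj j l R N J p (g t₀))
  have hP := LeafSpace.isSmoothParam (J := J) (N := N) (p := p) b
  have hP' := LeafSpace.isSmoothParam (J := J) (N := N) (p := p + 1) b
  let z : EuclideanSpace ℝ (Fin r) → LeafModel j l R N p := fun t =>
    invFun (LeafSpace.param b) (g t)
  have hV : ∀ᶠ t in 𝓝 t₀, leafProj j l R N J p (g t) ∈ range (LeafSpace.param b) :=
    hx.continuous.continuousAt.preimage_mem_nhds (hP'.isOpen_range.mem_nhds hb)
  -- Continuity of g is not yet known. Still g t lies in the chart when its projection does, since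
  -- this depends only on the l-plane.
  have hz : ∀ᶠ t in 𝓝 t₀, LeafSpace.param b (z t) = g t := by
    filter_upwards [hV] with t ht
    refine hP.apply_inv ?_
    rw [LeafSpace.mem_range_param_iff] at ht ⊢
    obtain ⟨x, hx⟩ := Quotient.exists_rep (g t)
    rw [← hx] at ht ⊢
    exact ht
  obtain ⟨U, hU, d, s, hs, hbasis⟩ := hQ t₀
  have hζ : ContDiffAt ℝ ∞ (fun t => ((z t).1, LeafFiber.proj (z t).2)) t₀ := by
    have h1 := (((hP'.smooth_inv _ hb).contMDiffAt (hP'.isOpen_range.mem_nhds hb)).comp t₀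
      (hx t₀)).contDiffAt
    refine h1.congr_of_eventuallyEq ?_
    filter_upwards [hz] with t ht
    rw [comp_apply, ← ht, leafProj_param, hP'.inv_apply]
  let w : Fin d → EuclideanSpace ℝ (Fin r) → LeafModel j l R N (p + 1) := fun i t =>
    mfderiv 𝓘(ℝ, LeafModel j l R N (p + 1)) 𝓘(ℝ, LeafModel j l R N (p + 1))
        (invFun (LeafSpace.param b)) (qMap j l R N J p (g t)).1 (s i t)
  have hw (i : Fin d) : ContDiffAt ℝ ∞ (w i) t₀ :=
    hP'.contDiffAt_of_tangent ((hs i).contMDiffAt hU) hb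
  have hwb : ∀ᶠ t in 𝓝 t₀, LinearIndependent ℝ (fun i => w i t) ∧
      Submodule.span ℝ (range fun i => w i t) = (LeafFiber.deriv (z t).2).graph := by
    filter_upwards [hz, hU] with t ht htU
    have h1 := qMap_param hJ b (z t)
    rw [ht] at h1
    exact (isBasis_plane_iff h1 fun i =>
      dparam_mfderiv_inv (congrArg Sigma.fst h1) (s i t)).1 (hbasis t htU)
  -- The first components of the basis vectors form a smooth moving basis of the Grassmannian model,
  -- and the second components are the values of the derivative map on it.
  have hderiv : ContDiffAt ℝ ∞ (fun t => LeafFiber.derivL (z t).2) t₀ := by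
    have h1 := hwb.self_of_nhds
    obtain ⟨h2, h3⟩ := linearIndependent_graph h1.1 h1.2
    refine contDiffAt_clm_of_basis (a := fun i t => (w i t).1) (fun i => (hw i).fst)
      (fun i => (hw i).snd.congr_of_eventuallyEq ?_) h2 h3
    filter_upwards [hwb] with t ht
    have h4 : w i t ∈ (LeafFiber.deriv (z t).2).graph :=
      ht.2 ▸ Submodule.subset_span (mem_range_self i)
    exact ((LinearMap.mem_graph_iff _ _).1 h4).symm
  have hz2 : ContDiffAt ℝ ∞ (fun t => (z t).2) t₀ := by
    let T : LeafFiber j l R N p →L[ℝ]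
        LeafFiber j l R N (p + 1) × (GrModel l R →L[ℝ] LeafFiber j l R N (p + 1)) :=
      LeafFiber.projL.prod LeafFiber.derivL
    have hT : ContDiffAt ℝ ∞ (fun t => T.toLinearMap (z t).2) t₀ := hζ.snd.prodMk hderiv
    refine contDiffAt_of_injective_linear ?_ hT
    rw [injective_iff_map_eq_zero]
    intro y hy
    obtain ⟨h1, h2⟩ := Prod.mk_inj.1 (show (LeafFiber.projL y, LeafFiber.derivL y) = 0 from hy)
    exact LeafFiber.eq_zero_of_proj_of_deriv hl hp h1 fun A => DFunLike.congr_fun h2 A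
  have hzz : ContDiffAt ℝ ∞ z t₀ := hζ.fst.prodMk hz2
  refine ((hP.smooth.contMDiffAt.comp t₀ hzz.contMDiffAt)).congr_of_eventuallyEq ?_
  filter_upwards [hz] with t ht using ht.symm

theorem isProlongation_qMap (hl : 1 ≤ l) (hp : p + 2 ≤ j) :
    IsProlongation (GrModel l R) (reducedDist j l R N J (p + 1)) (toGr j l R N J (p + 1))
      (reducedDist j l R N J p) (qMap j l R N J p) where
  injective := qMap_injective hJ hl (by omega)
  range_eq := by
    ext S
    constructor
    · rintro ⟨φ, rfl⟩
      exact ⟨isIntegralElement_qMap hJ φ, isHorizontal_toGr_qMap hJ φ, finrank_qMap hJ φ⟩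
    · rintro ⟨h1, h2, h3⟩
      exact exists_qMap_eq hJ hl hp h1 h2 h3
  smooth_iff r g := ⟨fun h => ⟨contMDiff_leafProj.comp h, isSmoothPlaneFamily_qMap hJ h⟩,
    fun h => contMDiff_of_isSmoothPlaneFamily_qMap hJ hl (by omega) h.1 h.2⟩
  lift φ := reducedDist_eq_comap hJ φ

end Prolongation

end PartialJets

theorem mainTheorem5 (n m k l p q : ℕ) [NeZero k] (hl : 1 ≤ l) (hln : l ≤ n)
    (hpq : p + q = k + 1) (hq : 1 ≤ q)
    {E : Type*} [TopologicalSpace E] [ChartedSpace (EuclideanSpace ℝ (Fin (n + m))) E]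
    [IsManifold (𝓡 (n + m)) ∞ E] (θ : Jet n m E k) :
    (∀ φ : θ.Level l p,
      IsHorizontalMaximal (θ.LevelModel l (p + 2)) (θ.dist l (p + 1)) (θ.proj l (p + 1))
          (θ.proj l p φ) (θ.Q l p φ) ∧
        finrank ℝ (θ.Q l p φ) = finrank ℝ (GrModel l θ.tangentPlane)) ∧
    (∀ (x : θ.Level l (p + 1))
        (S : Submodule ℝ (TangentSpace 𝓘(ℝ, θ.LevelModel l (p + 1)) x)), S ≤ θ.dist l (p + 1) x →
      (IsHorizontal (θ.LevelModel l (p + 2)) (θ.proj l (p + 1)) x S ↔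
        IsHorizontal (GrModel l θ.tangentPlane) (θ.projGr l (p + 1)) x S)) ∧
    (∀ φ ψ : θ.Level l p, θ.proj l p φ = θ.proj l p ψ → θ.QMap l p φ = θ.QMap l p ψ → φ = ψ) ∧
    (2 ≤ q →
      (∀ (x : θ.Level l (p + 1))
          (S : Submodule ℝ (TangentSpace 𝓘(ℝ, θ.LevelModel l (p + 1)) x)),
        IsHorizontalMaximal (θ.LevelModel l (p + 2)) (θ.dist l (p + 1)) (θ.proj l (p + 1)) x S →
          ∃ φ : θ.Level l p, θ.proj l p φ = x ∧ θ.QMap l p φ = ⟨x, S⟩) ∧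
      IsProlongation (GrModel l θ.tangentPlane) (θ.dist l (p + 1)) (θ.projGr l (p + 1))
        (θ.dist l p) (θ.QMap l p)) := by
  -- Here j = k + 1 = p + q, so q ≥ 1 means p + 1 ≤ j, as injectivity needs, and q ≥ 2 means p + 2 ≤
  -- j, as exactness needs.
  have hJ := θ.isAffineManifold_fiber
  refine ⟨fun φ => ⟨isHorizontalMaximal_qMap hJ φ, finrank_qMap hJ φ⟩,
    fun x S hS => isHorizontal_leafProj_iff hJ x S hS,
    fun φ ψ _ h => qMap_injective hJ hl (by omega) h, fun hq2 => ⟨fun x S hS =>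
      exists_qMap_eq_of_isHorizontalMaximal hJ hl (by omega) x S hS,
      isProlongation_qMap hJ hl (by omega)⟩⟩
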